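/- Let $M$ be a closed $3$-manifold with an open book decomposition $(B,\pi)$, that is: $B\subset M$ is a non-empty link, $\pi\colon M\setminus B\to S^1$ is a locally trivial fibration whose fibres are connected surfaces, and $B$ has a tubular neighbourhood $B\times D^2$ on which $\pi$ is the angular coordinate of $D^2$. Let $\Sigma_0=\pi^{-1}(\theta_0)\cup B$ be a page, and let $N=N(\Sigma_0)$ be a closed regular neighbourhood of $\Sigma_0$, that is, a codimension-zero submanifold with boundary that is the mapping cylinder of a map $\partial N\to\Sigma_0$. Let $\Lambda\subset M\setminus N$ be an oriented knot. A Seifert surface for $\Lambda$ is a compact oriented (not necessarily connected) embedded surface $H\subset M$ with oriented boundary $\Lambda$; its class $[H]\in H_2(M,\Lambda;\mathbb Z)$ is the image of its fundamental class in $H_2(H,\Lambda;\mathbb Z)$. If $H$ is transverse to $\partial N$, let $X=H\cap\partial(M\setminus N)$, oriented so that the oriented boundary of $H\cap (M\setminus \operatorname{int}N)$ is $\Lambda\cup X$. Then the oriented link $X$ uniquely determines $[H]$: if $H$ and $H'$ are Seifert surfaces for $\Lambda$, both transverse to $\partial N$, and $H\cap\partial(M\setminus N)=H'\cap\partial(M\setminus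 N)$ as oriented links, then $[H]=[H']$ in $H_2(M,\Lambda;\mathbb Z)$. (Manifolds are topological manifolds, submanifolds are locally flat, and transversality means transversality in local charts; smooth manifolds, submanifolds and transversality are a special case.) -/

import Mathlib

open CategoryTheory Limits AlgebraicTopology Topology

universe u

noncomputable section

/-! ### Singular homology of pairs of subsets of a space, with integer coefficients -/

section Homology

variable {M : Type u} [TopologicalSpace M]

/-- The inclusion of a subset `A` in a subset `Y`, as a continuous map. -/
def subsetIncl {A Y : Set M} (h : A ⊆ Y) : TopCat.of A ⟶ TopCat.of Y :=
  TopCat.ofHom ⟨Set.inclusion h, continuous_inclusion h⟩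

/-- The integral singular chain complex functor. -/
abbrev singChains : TopCat.{u} ⥤ ChainComplex (ModuleCat.{u} ℤ) ℕ :=
  (singularChainComplexFunctor (ModuleCat.{u} ℤ)).obj (ModuleCat.of ℤ (ULift.{u} ℤ))

/-- The singular homology `H_n(Y; ℤ)` of a subset `Y` (with the subspace topology). -/
abbrev singHomology (n : ℕ) (Y : Set M) : ModuleCat.{u} ℤ :=
  (singChains.obj (TopCat.of Y)).homology n

/-- The map `H_n(Y) → H_n(Y')` induced by an inclusion. -/
def singHomologyMap (n : ℕ) {Y Y' : Set M} (h : Y ⊆ Y') :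
    singHomology n Y ⟶ singHomology n Y' :=
  HomologicalComplex.homologyMap (singChains.map (subsetIncl h)) n

/-- The relative singular chain complex `C(Y) / C(A)` of a pair `A ⊆ Y`. -/
abbrev relChains {A Y : Set M} (h : A ⊆ Y) : ChainComplex (ModuleCat.{u} ℤ) ℕ :=
  cokernel (singChains.map (subsetIncl h))

/-- The relative singular homology `H_n(Y, A; ℤ)` of a pair `A ⊆ Y`. -/
abbrev relHomology (n : ℕ) {A Y : Set M} (h : A ⊆ Y) : ModuleCat.{u} ℤ :=
  (relChains h).homology n

/-- The map `H_n(Y, A) → H_n(Y', A')` induced by an inclusion of pairs. -/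
def relHomologyMap (n : ℕ) {A Y A' Y' : Set M} (h : A ⊆ Y) (h' : A' ⊆ Y')
    (hY : Y ⊆ Y') (hA : A ⊆ A') : relHomology n h ⟶ relHomology n h' :=
  HomologicalComplex.homologyMap
    (cokernel.map _ _ (singChains.map (subsetIncl hA)) (singChains.map (subsetIncl hY))
      (by rw [← Functor.map_comp, ← Functor.map_comp]; rfl)) n

/-- The short complex `C(A) → C(Y) → C(Y) / C(A)`. -/
abbrev pairShortComplex {A Y : Set M} (h : A ⊆ Y) :
    ShortComplex (ChainComplex (ModuleCat.{u} ℤ) ℕ) :=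
  ShortComplex.mk (singChains.map (subsetIncl h)) (cokernel.π (singChains.map (subsetIncl h)))
    (cokernel.condition _)

theorem pairShortComplex_shortExact {A Y : Set M} (h : A ⊆ Y) :
    (pairShortComplex h).ShortExact := by
  have hm : Mono (subsetIncl h) :=
    (TopCat.mono_iff_injective _).2 (Set.inclusion_injective h)
  have : Mono (singChains.map (subsetIncl h)) := inferInstance
  exact
    { exact := ShortComplex.exact_cokernel _
      mono_f := this
      epi_g := inferInstance }

/-- The connecting homomorphism `H_{n+1}(Y, A) → H_n(A)` of the long exact sequence of a pair. -/
def relBoundary (n : ℕ) {A Y : Set M} (h : A ⊆ Y) :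
    relHomology (n + 1) h ⟶ singHomology n A :=
  (pairShortComplex_shortExact h).δ (n + 1) n (by simp)

/-- `μ ∈ H_n(Y, A)` is a fundamental class of the pair: at every point `x` of `Y ∖ A` it restricts
to a generator of the local homology group `H_n(Y, Y ∖ {x})`. If `Y` is a compact `n`-manifold with
boundary `A`, the fundamental classes correspond to the orientations of `Y`. -/
def IsFundamentalClass (n : ℕ) {A Y : Set M} (h : A ⊆ Y) (μ : relHomology n h) : Prop :=
  ∀ (x : M) (hx : x ∈ Y \ A),
    Submodule.span ℤ {relHomologyMap n h (Set.sdiff_subset : Y \ {x} ⊆ Y) subset_rfl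
      (fun _ ha => ⟨h ha, fun hax => hx.2 (hax ▸ ha)⟩) μ} = ⊤

end Homology

/-! ### Open books and regular neighbourhoods -/

section Topology3

/-- Euclidean three-space. -/
abbrev E3 : Type := EuclideanSpace ℝ (Fin 3)

/-- An open book decomposition `(B, π)` of a 3-manifold `M` with connected pages and non-empty
binding. -/
structure OpenBook (M : Type u) [TopologicalSpace M] where
  /-- the binding `B` -/
  binding : Set M
  /-- `B` is a non-empty link -/
  binding_link : ∃ k : ℕ, 0 < k ∧ Nonempty (binding ≃ₜ Fin k × Circle)
  /-- the projection `π : M ∖ B → S¹` -/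
  proj : C(↥(bindingᶜ), Circle)
  /-- `π` is a locally trivial fibration -/
  locallyTrivial : ∀ θ : Circle,
    ∃ t : Bundle.Trivialization ↥(proj ⁻¹' {θ}) proj, θ ∈ t.baseSet
  /-- the fibres of `π` (the interiors of the pages) are surfaces -/
  fiber_surface : ∀ θ : Circle,
    Nonempty (ChartedSpace (EuclideanSpace ℝ (Fin 2)) ↥(proj ⁻¹' {θ}))
  /-- the fibres of `π` are connected -/
  fiber_connected : ∀ θ : Circle, IsConnected (proj ⁻¹' {θ})
  /-- `B` has a tubular neighbourhood `B × D²` on which `π` is the angular coordinate of `D²` -/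
  tubular : ∃ τ : binding × Metric.closedBall (0 : ℂ) 1 → M,
    IsEmbedding τ ∧
    (∀ b : binding, Set.range τ ∈ 𝓝 (b : M)) ∧
    (∀ b : binding, τ (b, ⟨0, by simp⟩) = b) ∧
    ∀ (b : binding) (z : Metric.closedBall (0 : ℂ) 1) (h : τ (b, z) ∈ bindingᶜ),
      (z : ℂ) = (‖(z : ℂ)‖ : ℂ) * (proj ⟨τ (b, z), h⟩ : ℂ)

variable {M : Type u} [TopologicalSpace M]

/-- The (compact) page `Σ_θ = π⁻¹(θ) ∪ B`. -/
def OpenBook.page (ob : OpenBook M) (θ : Circle) : Set M :=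
  Subtype.val '' (ob.proj ⁻¹' {θ}) ∪ ob.binding

/-- `N` is a (closed) regular neighbourhood of `K` in the 3-manifold `M`: it is a codimension-zero
submanifold with locally flat boundary, and it is the mapping cylinder of a map `∂N → K`. -/
structure IsRegularNeighborhood (K N : Set M) : Prop where
  isClosed : IsClosed N
  locallyFlat : ∀ x ∈ frontier N, ∃ e : OpenPartialHomeomorph M E3, x ∈ e.source ∧
    ∀ y ∈ e.source, (y ∈ N ↔ e y 2 ≤ 0)
  /-- `Φ` presents `N` as `∂N × [0,1]` with the end `∂N × {1}` projected onto `K` -/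
  mappingCylinder : ∃ Φ : C(frontier N × unitInterval, M),
    (∀ x, Φ (x, 0) = x) ∧
    Set.InjOn Φ {p | p.2 < 1} ∧
    Φ '' {p | p.2 < 1} = N \ K ∧
    Φ '' {p | p.2 = 1} = K

/-! ### Seifert surfaces -/

/-- An oriented knot: a subset homeomorphic to the circle with a generator `o` of its first
homology group. -/
structure IsOrientedKnot (L : Set M) (o : singHomology 1 L) : Prop where
  circle : Nonempty (L ≃ₜ Circle)
  generator : Submodule.span ℤ {o} = ⊤

/-- A Seifert surface in the 3-manifold `M` for `L` with orientation `o`: a compact, oriented,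
locally flat surface with oriented boundary `L`. It need not be connected. -/
structure SeifertSurface (L : Set M) (o : singHomology 1 L) where
  carrier : Set M
  isCompact : IsCompact carrier
  boundary_subset : L ⊆ carrier
  /-- away from `L`, the surface is locally a plane in a chart of `M` -/
  interior_chart : ∀ x ∈ carrier \ L, ∃ e : OpenPartialHomeomorph M E3, x ∈ e.source ∧
    ∀ y ∈ e.source, y ∉ L ∧ (y ∈ carrier ↔ e y 2 = 0)
  /-- along `L`, the surface is locally a half-plane with boundary line `L` in a chart of `M` -/
  boundary_chart : ∀ x ∈ L, ∃ e : OpenPartialHomeomorph M E3, x ∈ e.source ∧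
    ∀ y ∈ e.source, (y ∈ carrier ↔ e y 2 = 0 ∧ 0 ≤ e y 1) ∧ (y ∈ L ↔ e y 2 = 0 ∧ e y 1 = 0)
  /-- the fundamental class of the surface, that is, its orientation -/
  fundClass : relHomology 2 boundary_subset
  isFundamentalClass : IsFundamentalClass 2 boundary_subset fundClass
  /-- the oriented boundary of the surface is the oriented knot -/
  boundary_eq : relBoundary 1 boundary_subset fundClass = o

namespace SeifertSurface

variable {L : Set M} {o : singHomology 1 L}

/-- The class `[H] ∈ H_2(M, L)` of a Seifert surface. -/
def homologyClass (S : SeifertSurface L o) : relHomology 2 (Set.subset_univ L) :=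
  relHomologyMap 2 S.boundary_subset (Set.subset_univ L) (Set.subset_univ _) subset_rfl S.fundClass

/-- `S` is transverse to `∂N`: near a common point there is a chart of `M` in which `N` is a
half-space and `S` is a plane orthogonal to its boundary. -/
def TransverseTo (S : SeifertSurface L o) (N : Set M) : Prop :=
  ∀ x ∈ S.carrier ∩ frontier N, ∃ e : OpenPartialHomeomorph M E3, x ∈ e.source ∧
    ∀ y ∈ e.source, (y ∈ N ↔ e y 2 ≤ 0) ∧ (y ∈ S.carrier ↔ e y 1 = 0)

/-- The part `H ∩ (M ∖ int N)` of a surface outside `N`. -/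
def outer (S : SeifertSurface L o) (N : Set M) : Set M := S.carrier ∩ (interior N)ᶜ

/-- The part `H ∩ N` of a surface inside `N`. -/
def inner (S : SeifertSurface L o) (N : Set M) : Set M := S.carrier ∩ N

/-- The intersection `H ∩ ∂(M ∖ N)`, as a set. -/
def slice (S : SeifertSurface L o) (N : Set M) : Set M := S.carrier ∩ frontier (Nᶜ)

theorem boundary_union_slice_subset (S : SeifertSurface L o) {N : Set M} (hL : Disjoint L N) :
    L ∪ S.slice N ⊆ S.outer N := by
  rintro x (hx | hx)
  · exact ⟨S.boundary_subset hx, fun hi => hL.le_bot ⟨hx, interior_subset hi⟩⟩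
  · refine ⟨hx.1, ?_⟩
    have h2 := hx.2
    rw [frontier_compl] at h2
    exact h2.2

theorem boundary_union_inner_subset (S : SeifertSurface L o) (N : Set M) :
    L ∪ S.inner N ⊆ S.carrier :=
  Set.union_subset S.boundary_subset Set.inter_subset_left

theorem slice_subset_inner (S : SeifertSurface L o) {N : Set M} (hN : IsClosed N) :
    S.slice N ⊆ S.inner N := by
  intro x hx
  have h2 := hx.2
  rw [frontier_compl] at h2
  exact ⟨hx.1, hN.frontier_subset h2⟩

/-- The oriented link `(X, ξ)`, `ξ ∈ H_1(X)`, is the intersection of the surface `S` with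
`∂(M ∖ N)`, oriented as part of the boundary of the outer piece `S ∖ int N`. In detail: `S` is
transverse to `∂N`; the set `X` is `S ∩ ∂(M ∖ N)`; and if `μ` is the fundamental class of the
outer piece with the orientation of `S` (the class in `H_2(S ∖ int N, L ∪ X)` with the same image
as the fundamental class of `S` in `H_2(S, L ∪ (S ∩ N))`, a group that is isomorphic to it by
excision), then the boundary of `μ` in `H_1(L ∪ X)` is the sum of the classes of `L` and `X`. -/
structure MeetsIn (S : SeifertSurface L o) {N : Set M} (hN : IsClosed N) (hL : Disjoint L N)
    (X : Set M) (ξ : singHomology 1 X) : Prop where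
  transverse : S.TransverseTo N
  slice_eq : X = S.slice N
  orientation : ∃ μ : relHomology 2 (S.boundary_union_slice_subset hL),
    relHomologyMap 2 (S.boundary_union_slice_subset hL) (S.boundary_union_inner_subset N)
        Set.inter_subset_left (Set.union_subset_union_right L (S.slice_subset_inner hN)) μ =
      relHomologyMap 2 S.boundary_subset (S.boundary_union_inner_subset N)
        subset_rfl Set.subset_union_left S.fundClass ∧
    relBoundary 1 (S.boundary_union_slice_subset hL) μ =
      singHomologyMap 1 Set.subset_union_left o +
        singHomologyMap 1 (slice_eq.subset.trans Set.subset_union_right) ξ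

end SeifertSurface

end Topology3

end

/-! Write K for the page. The outer pieces of H and H' avoid K and have the same oriented boundary Λ
∪ X, so they give classes in H_2(M ∖ K, Λ ∪ X) with the same image in H_1(Λ ∪ X). Now M ∖ K is a
bundle over an open arc whose fibres are open pages, that is, connected non-compact surfaces. Hence
H_2(M ∖ K) = 0 (`OpenBook.cyclesBoundOn_compl_page`), the connecting map is injective
(`relBoundary_injective`), and the two outer classes agree. Therefore [H] and [H'] have the same
image in H_2(M, Λ ∪ N).

The inner pieces make no difference either. The class [H] - [H'] has zero boundary in H_1(Λ), so it
lifts to H_2(M), and the lift dies in H_2(M, Λ ∪ N). The neighbourhood N deforms into K, and K can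
be pushed off the binding into an open page, so H_2(Λ ∪ N) = 0. Thus H_2(M) injects into H_2(M, Λ ∪
N) and the lift is zero (`eq_of_relBoundary_eq`).

Everything rests on the vanishing of H_2 of a connected non-compact surface
(`cyclesBound_one_of_noncompact`). It is proved as in the construction of fundamental classes:
relative to the complement of a compact set, H_3 and higher groups vanish and a class in H_2 is
detected at points; a cycle on a non-compact connected surface is trivial near some point, hence
near all. Vanishing passes from fibres to a bundle over an interval by Mayer–Vietoris and
connectedness (`cyclesBound_of_locallyTrivial`).

These arguments manipulate explicit cycles in free abelian groups on singular simplices. Barycentric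
subdivision yields `exists_eq_add_add_bdry`, the common source of excision and Mayer–Vietoris. Only
the vanishing results are carried over to the homology of the statement, by
`subsingleton_singHomology`. -/

noncomputable section

/-! ### Chains of ordered tuples -/

section Tuples

variable {T T' T'' : Type*}

/-- The free abelian group on ordered `m`-tuples of elements of `T`. -/
abbrev TupleChain (m : ℕ) (T : Type*) : Type _ := (Fin m → T) →₀ ℤ

/-- The alternating sum of the faces of a tuple. -/
def tupleBdry {m : ℕ} : TupleChain (m + 1) T →ₗ[ℤ] TupleChain m T :=
  Finsupp.linearCombination ℤ fun v =>
    ∑ i : Fin (m + 1), (-1 : ℤ) ^ (i : ℕ) • Finsupp.single (v ∘ i.succAbove) 1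

/-- Prepending a fixed vertex. -/
def tupleCone {m : ℕ} (p : T) : TupleChain m T →ₗ[ℤ] TupleChain (m + 1) T :=
  Finsupp.linearCombination ℤ fun v => Finsupp.single (Fin.cons p v) 1

/-- The map on tuple chains induced by a map of vertices. -/
def tupleMap {m : ℕ} (f : T → T') : TupleChain m T →ₗ[ℤ] TupleChain m T' :=
  Finsupp.linearCombination ℤ fun v => Finsupp.single (f ∘ v) 1

@[simp]
theorem tupleBdry_single {m : ℕ} (v : Fin (m + 1) → T) :
    tupleBdry (Finsupp.single v 1) =
      ∑ i : Fin (m + 1), (-1 : ℤ) ^ (i : ℕ) • Finsupp.single (v ∘ i.succAbove) 1 := by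
  simp [tupleBdry]

@[simp]
theorem tupleCone_single {m : ℕ} (p : T) (v : Fin m → T) :
    tupleCone p (Finsupp.single v 1) = Finsupp.single (Fin.cons p v) 1 := by
  simp [tupleCone]

@[simp]
theorem tupleMap_single {m : ℕ} (f : T → T') (v : Fin m → T) :
    tupleMap f (Finsupp.single v 1) = Finsupp.single (f ∘ v) 1 := by
  simp [tupleMap]

theorem cons_comp_succ_succAbove {m : ℕ} (p : T) (w : Fin (m + 1) → T) (i : Fin (m + 1)) :
    (Fin.cons p w : Fin (m + 2) → T) ∘ i.succ.succAbove = Fin.cons p (w ∘ i.succAbove) := by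
  funext j
  cases j using Fin.cases with
  | zero => simp
  | succ j => simp

/-- Two linear maps out of a free abelian group agree if they agree on the generators. -/
theorem linearMap_ext_single {α A : Type*} [AddCommGroup A] [Module ℤ A] {f g : (α →₀ ℤ) →ₗ[ℤ] A}
    (h : ∀ a, f (Finsupp.single a 1) = g (Finsupp.single a 1)) (c : α →₀ ℤ) : f c = g c :=
  DFunLike.congr_fun (Finsupp.lhom_ext' fun a => LinearMap.ext_ring (h a)) c

theorem tupleBdry_cone_zero (p : T) (c : TupleChain 0 T) :
    tupleBdry (tupleCone p c) = c := by
  refine linearMap_ext_single (f := tupleBdry ∘ₗ tupleCone p) (g := LinearMap.id) (fun v => ?_) c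
  simp

/-- Face 0 of a cone is its base, and the other faces are cones over the faces of the base, with
signs shifted by one. Since the empty tuple is allowed, the tuple complex is augmented and coning is
a contraction of it; the later operators are all built by coning off a cycle. -/
theorem tupleBdry_cone {m : ℕ} (p : T) (c : TupleChain (m + 1) T) :
    tupleBdry (tupleCone p c) = c - tupleCone p (tupleBdry c) := by
  refine linearMap_ext_single (f := tupleBdry ∘ₗ tupleCone p)
    (g := LinearMap.id - tupleCone p ∘ₗ tupleBdry) (fun v => ?_) c
  simp only [LinearMap.comp_apply, tupleCone_single, tupleBdry_single, LinearMap.sub_apply,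
    LinearMap.id_apply, map_sum, map_smul]
  rw [Fin.sum_univ_succ]
  simp only [cons_comp_succ_succAbove, Fin.val_succ, pow_succ, Fin.val_zero, pow_zero, one_smul,
    mul_neg, mul_one, neg_smul, Finset.sum_neg_distrib, sub_eq_add_neg]
  congr 2

/-- Every non-empty tuple is the cone on its tail from its first vertex, so the cone formula reduces
the claim to one degree lower. -/
theorem tupleBdry_tupleBdry {m : ℕ} (c : TupleChain (m + 2) T) :
    tupleBdry (tupleBdry c) = 0 := by
  induction m with
  | zero =>
    refine linearMap_ext_single (f := tupleBdry ∘ₗ tupleBdry) (g := 0) (fun v => ?_) c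
    have : Finsupp.single v 1 = tupleCone (v 0) (Finsupp.single (Fin.tail v) 1) := by simp
    rw [LinearMap.comp_apply, this, tupleBdry_cone, map_sub, tupleBdry_cone_zero]
    simp
  | succ m ih =>
    refine linearMap_ext_single (f := tupleBdry ∘ₗ tupleBdry) (g := 0) (fun v => ?_) c
    have : Finsupp.single v 1 = tupleCone (v 0) (Finsupp.single (Fin.tail v) 1) := by simp
    rw [LinearMap.comp_apply, this, tupleBdry_cone, map_sub, tupleBdry_cone, ih]
    simp

theorem tupleMap_tupleBdry {m : ℕ} (f : T → T') (c : TupleChain (m + 1) T) :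
    tupleMap f (tupleBdry c) = tupleBdry (tupleMap f c) := by
  refine linearMap_ext_single (f := tupleMap f ∘ₗ tupleBdry) (g := tupleBdry ∘ₗ tupleMap f)
    (fun v => ?_) c
  simp only [LinearMap.comp_apply, tupleBdry_single, tupleMap_single, map_sum, map_smul,
    Function.comp_assoc]

theorem tupleMap_tupleCone {m : ℕ} (f : T → T') (p : T) (c : TupleChain m T) :
    tupleMap f (tupleCone p c) = tupleCone (f p) (tupleMap f c) := by
  refine linearMap_ext_single (f := tupleMap f ∘ₗ tupleCone p)
    (g := tupleCone (f p) ∘ₗ tupleMap f) (fun v => ?_) c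
  simp [Fin.comp_cons]

theorem tupleMap_tupleMap {m : ℕ} (f : T → T') (g : T' → T'') (c : TupleChain m T) :
    tupleMap g (tupleMap f c) = tupleMap (g ∘ f) c := by
  refine linearMap_ext_single (f := tupleMap g ∘ₗ tupleMap f) (g := tupleMap (g ∘ f))
    (fun v => ?_) c
  simp [Function.comp_assoc]

variable (b : ∀ m : ℕ, (Fin (m + 1) → T) → T)

/-- The subdivision of a tuple chain in which the simplex `v` is subdivided from its interior point
`b m v`. -/
def tupleSd : ∀ m : ℕ, TupleChain m T →ₗ[ℤ] TupleChain m T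
  | 0 => LinearMap.id
  | m + 1 => Finsupp.linearCombination ℤ fun v =>
      tupleCone (b m v) (tupleSd m (tupleBdry (Finsupp.single v 1)))

@[simp]
theorem tupleSd_single (m : ℕ) (v : Fin (m + 1) → T) :
    tupleSd b (m + 1) (Finsupp.single v 1) =
      tupleCone (b m v) (tupleSd b m (tupleBdry (Finsupp.single v 1))) := by
  simp [tupleSd]

theorem tupleBdry_tupleSd {m : ℕ} (c : TupleChain (m + 1) T) :
    tupleBdry (tupleSd b (m + 1) c) = tupleSd b m (tupleBdry c) := by
  induction m with
  | zero =>
    refine linearMap_ext_single (f := tupleBdry ∘ₗ tupleSd b 1) (g := tupleSd b 0 ∘ₗ tupleBdry)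
      (fun v => ?_) c
    rw [LinearMap.comp_apply, tupleSd_single, tupleBdry_cone_zero, LinearMap.comp_apply]
  | succ m ih =>
    refine linearMap_ext_single (f := tupleBdry ∘ₗ tupleSd b (m + 2))
      (g := tupleSd b (m + 1) ∘ₗ tupleBdry) (fun v => ?_) c
    rw [LinearMap.comp_apply, tupleSd_single, tupleBdry_cone, ih, tupleBdry_tupleBdry]
    simp

/-- Naturality in the vertices. With f an affine map of simplices and b the barycenter, this is what
makes subdivision of singular simplices compatible with faces. -/
theorem tupleMap_tupleSd {b : ∀ m : ℕ, (Fin (m + 1) → T) → T}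
    {b' : ∀ m : ℕ, (Fin (m + 1) → T') → T'} {f : T → T'}
    (hf : ∀ m v, f (b m v) = b' m (f ∘ v)) {m : ℕ} (c : TupleChain m T) :
    tupleMap f (tupleSd b m c) = tupleSd b' m (tupleMap f c) := by
  induction m with
  | zero => rfl
  | succ m ih =>
    refine linearMap_ext_single (f := tupleMap f ∘ₗ tupleSd b (m + 1))
      (g := tupleSd b' (m + 1) ∘ₗ tupleMap f) (fun v => ?_) c
    rw [LinearMap.comp_apply, tupleSd_single, tupleMap_tupleCone, ih, tupleMap_tupleBdry,
      LinearMap.comp_apply, tupleMap_single, tupleSd_single, hf]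

/-- The prism over a tuple chain, which joins its subdivision at height `0` to itself at
height `1`. -/
def tuplePrism : ∀ m : ℕ, TupleChain m T →ₗ[ℤ] TupleChain (m + 1) (T × unitInterval)
  | 0 => 0
  | m + 1 => Finsupp.linearCombination ℤ fun v =>
      tupleCone (v 0, 0) (tupleMap (·, 1) (Finsupp.single v 1) -
        tupleMap (·, 0) (tupleSd b (m + 1) (Finsupp.single v 1)) -
        tuplePrism m (tupleBdry (Finsupp.single v 1)))

@[simp]
theorem tuplePrism_single (m : ℕ) (v : Fin (m + 1) → T) :
    tuplePrism b (m + 1) (Finsupp.single v 1) =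
      tupleCone (v 0, 0) (tupleMap (·, 1) (Finsupp.single v 1) -
        tupleMap (·, 0) (tupleSd b (m + 1) (Finsupp.single v 1)) -
        tuplePrism b m (tupleBdry (Finsupp.single v 1))) := by
  rw [tuplePrism, Finsupp.linearCombination_single, one_smul]

theorem tupleBdry_tuplePrism_zero (c : TupleChain 0 T) :
    tupleBdry (tuplePrism b 0 c) = tupleMap (·, 1) c - tupleMap (·, 0) (tupleSd b 0 c) := by
  rw [eq_comm]
  simp only [tuplePrism, tupleSd, LinearMap.zero_apply, map_zero, LinearMap.id_apply]
  rw [sub_eq_zero]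
  refine linearMap_ext_single (fun v => ?_) c
  simp only [tupleMap_single]
  congr 1
  exact Subsingleton.elim _ _

theorem tupleBdry_tuplePrism {m : ℕ} (c : TupleChain (m + 1) T) :
    tupleBdry (tuplePrism b (m + 1) c) =
      tupleMap (·, 1) c - tupleMap (·, 0) (tupleSd b (m + 1) c) -
        tuplePrism b m (tupleBdry c) := by
  -- The prism is a cone, so its boundary is the coned chain minus the cone on that chain's
  -- boundary. The formula one degree lower, needed only on boundaries, says that the coned chain is
  -- a cycle.
  have key : ∀ {m : ℕ}, (∀ c : TupleChain (m + 1) T, tupleBdry (tuplePrism b m (tupleBdry c)) =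
      tupleMap (·, 1) (tupleBdry c) - tupleMap (·, 0) (tupleSd b m (tupleBdry c))) →
      ∀ c : TupleChain (m + 1) T, tupleBdry (tuplePrism b (m + 1) c) =
      tupleMap (·, 1) c - tupleMap (·, 0) (tupleSd b (m + 1) c) -
        tuplePrism b m (tupleBdry c) := by
    intro m h c
    refine linearMap_ext_single (f := tupleBdry ∘ₗ tuplePrism b (m + 1))
      (g := tupleMap (·, 1) - tupleMap (·, 0) ∘ₗ tupleSd b (m + 1) -
        tuplePrism b m ∘ₗ tupleBdry) (fun v => ?_) c
    rw [LinearMap.comp_apply, tuplePrism_single, tupleBdry_cone, map_sub tupleBdry,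
      map_sub tupleBdry, h, ← tupleMap_tupleBdry, ← tupleMap_tupleBdry, tupleBdry_tupleSd]
    simp only [sub_self, map_zero, sub_zero, LinearMap.sub_apply, LinearMap.comp_apply]
  induction m with
  | zero => exact key (fun c => tupleBdry_tuplePrism_zero b _) c
  | succ m ih =>
    refine key (fun c => ?_) c
    rw [ih, tupleBdry_tupleBdry, map_zero, sub_zero]

theorem tupleMap_tuplePrism {b : ∀ m : ℕ, (Fin (m + 1) → T) → T}
    {b' : ∀ m : ℕ, (Fin (m + 1) → T') → T'} {f : T → T'}
    (hf : ∀ m v, f (b m v) = b' m (f ∘ v)) {m : ℕ} (c : TupleChain m T) :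
    tupleMap (Prod.map f id) (tuplePrism b m c) = tuplePrism b' m (tupleMap f c) := by
  induction m with
  | zero => simp [tuplePrism]
  | succ m ih =>
    refine linearMap_ext_single (f := tupleMap (Prod.map f id) ∘ₗ tuplePrism b (m + 1))
      (g := tuplePrism b' (m + 1) ∘ₗ tupleMap f) (fun v => ?_) c
    rw [LinearMap.comp_apply, tuplePrism_single, tupleMap_tupleCone, map_sub (tupleMap _),
      map_sub (tupleMap _), ih,
      tupleMap_tupleBdry, LinearMap.comp_apply, tupleMap_single f, tuplePrism_single,
      tupleMap_tupleMap, tupleMap_tupleMap, ← tupleMap_single f, ← tupleMap_tupleSd hf,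
      tupleMap_tupleMap, tupleMap_tupleMap]
    rfl

end Tuples

/-! ### Affine simplices -/

section Affine

/-- The standard topological simplex. -/
abbrev Simplex (n : ℕ) : Type := stdSimplex ℝ (Fin (n + 1))

/-- The tuple of the vertices of the standard simplex. -/
def simplexVertex (n : ℕ) : Fin (n + 1) → Simplex n := fun i => stdSimplex.vertex i

variable {E : Type*} [AddCommGroup E] [Module ℝ E] [TopologicalSpace E]
  [IsTopologicalAddGroup E] [ContinuousSMul ℝ E] {s : Set E}

/-- The affine simplex with given vertices in a convex set. -/
def affineSimplex (hs : Convex ℝ s) {n : ℕ} (v : Fin (n + 1) → s) : C(Simplex n, s) where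
  toFun t := ⟨∑ i, t.1 i • (v i : E),
    hs.sum_mem (fun i _ => t.2.1 i) t.2.2 fun i _ => (v i).2⟩
  continuous_toFun := by
    refine Continuous.subtype_mk (continuous_finsetSum _ fun i _ => ?_) _
    exact ((continuous_apply i).comp continuous_subtype_val).smul continuous_const

theorem coe_affineSimplex (hs : Convex ℝ s) {n : ℕ} (v : Fin (n + 1) → s) (t : Simplex n) :
    (affineSimplex hs v t : E) = ∑ i, t.1 i • (v i : E) := rfl

/-- The affine simplex with given vertices in a standard simplex. -/
abbrev simplexMap {k n : ℕ} (v : Fin (k + 1) → Simplex n) : C(Simplex k, Simplex n) :=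
  affineSimplex (convex_stdSimplex ℝ (Fin (n + 1))) v

theorem affineSimplex_vertex (hs : Convex ℝ s) {n : ℕ} (v : Fin (n + 1) → s) (i : Fin (n + 1)) :
    affineSimplex hs v (simplexVertex n i) = v i := by
  ext
  simp [coe_affineSimplex, simplexVertex, Pi.single_apply]

theorem affineSimplex_comp (hs : Convex ℝ s) {k n : ℕ} (v : Fin (n + 1) → s)
    (w : Fin (k + 1) → Simplex n) :
    (affineSimplex hs v).comp (simplexMap w) = affineSimplex hs (affineSimplex hs v ∘ w) := by
  ext t
  simp only [ContinuousMap.comp_apply, coe_affineSimplex, Function.comp_apply, Finset.sum_apply,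
    Pi.smul_apply, smul_eq_mul, Finset.sum_smul, Finset.smul_sum, smul_smul]
  exact Finset.sum_comm

theorem simplexMap_vertex (n : ℕ) : simplexMap (simplexVertex n) = ContinuousMap.id _ := by
  refine ContinuousMap.ext fun t => Subtype.ext ?_
  rw [coe_affineSimplex]
  ext i
  simp [simplexVertex, Pi.single_apply]

/-- The inclusion of a face of the standard simplex. -/
def simplexFace {n : ℕ} (i : Fin (n + 2)) : C(Simplex n, Simplex (n + 1)) :=
  simplexMap (simplexVertex (n + 1) ∘ i.succAbove)

theorem affineSimplex_comp_face (hs : Convex ℝ s) {n : ℕ} (v : Fin (n + 2) → s)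
    (i : Fin (n + 2)) :
    (affineSimplex hs v).comp (simplexFace i) = affineSimplex hs (v ∘ i.succAbove) := by
  rw [simplexFace, affineSimplex_comp]
  congr 1
  funext j
  exact affineSimplex_vertex hs v _

/-- The barycenter of a tuple of points of a convex set. -/
def tupleBarycenter (hs : Convex ℝ s) (n : ℕ) (v : Fin (n + 1) → s) : s :=
  affineSimplex hs v stdSimplex.barycenter

/-- The barycenter of a tuple of points of a standard simplex. -/
abbrev simplexBarycenter (k n : ℕ) (v : Fin (n + 1) → Simplex k) : Simplex k :=
  tupleBarycenter (convex_stdSimplex ℝ (Fin (k + 1))) n v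

theorem affineSimplex_barycenter (hs : Convex ℝ s) {k : ℕ} (v : Fin (k + 1) → s) (n : ℕ)
    (w : Fin (n + 1) → Simplex k) :
    affineSimplex hs v (simplexBarycenter k n w) =
      tupleBarycenter hs n (affineSimplex hs v ∘ w) :=
  DFunLike.congr_fun (affineSimplex_comp hs v w) _

end Affine

/-! ### Mesh of iterated barycentric subdivisions. -/

section Mesh

variable {E : Type*} [NormedAddCommGroup E] [NormedSpace ℝ E] {s : Set E}

/-- The vector from the barycenter to `v j` is the average of the n + 1 vectors `v j - v i`. The one
with i = j vanishes, which leaves n terms of length at most d. -/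
theorem dist_barycenter_le (hs : Convex ℝ s) {n : ℕ} {v : Fin (n + 1) → s} {d : ℝ}
    (hd : ∀ i j, dist (v i) (v j) ≤ d) (j : Fin (n + 1)) :
    dist (v j : E) (tupleBarycenter hs n v) ≤ n / (n + 1) * d := by
  have hn : (0 : ℝ) < n + 1 := by positivity
  have hb : (tupleBarycenter hs n v : E) = ∑ i, ((n : ℝ) + 1)⁻¹ • (v i : E) := by
    simp [tupleBarycenter, coe_affineSimplex]
  have h1 : (v j : E) - tupleBarycenter hs n v = ∑ i, ((n : ℝ) + 1)⁻¹ • ((v j : E) - v i) := by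
    rw [hb]
    simp only [smul_sub, Finset.sum_sub_distrib, Finset.sum_const, Finset.card_univ,
      Fintype.card_fin]
    rw [← Nat.cast_smul_eq_nsmul ℝ, smul_smul]
    push_cast
    rw [mul_inv_cancel₀ hn.ne', one_smul]
  rw [dist_eq_norm, h1, ← Finset.sum_erase Finset.univ (a := j) (by simp)]
  refine (norm_sum_le_of_le _ (f := fun i => ((n : ℝ) + 1)⁻¹ • ((v j : E) - v i))
    (n := fun _ => ((n : ℝ) + 1)⁻¹ * d) fun i _ => ?_).trans ?_
  · rw [norm_smul, Real.norm_of_nonneg (inv_nonneg.2 hn.le), ← dist_eq_norm]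
    exact mul_le_mul_of_nonneg_left (hd j i) (inv_nonneg.2 hn.le)
  · simp [div_eq_mul_inv, mul_assoc]

/-- Barycentric subdivision stays in the convex hull and shrinks the mesh. -/
theorem tupleSd_single_mem (hs : Convex ℝ s) {n : ℕ} {v : Fin (n + 1) → s} {d : ℝ}
    (hd : ∀ i j, dist (v i) (v j) ≤ d) :
    tupleSd (tupleBarycenter hs) (n + 1) (Finsupp.single v 1) ∈ Finsupp.supported ℤ ℤ
      {w : Fin (n + 1) → s |
        (∀ i, (w i : E) ∈ convexHull ℝ (Set.range fun j => (v j : E))) ∧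
          ∀ i j, dist (w i) (w j) ≤ n / (n + 1) * d} := by
  have hd0 : 0 ≤ d := dist_nonneg.trans (hd 0 0)
  have hbar : ∀ {n : ℕ} (v : Fin (n + 1) → s),
      (tupleBarycenter hs n v : E) ∈ convexHull ℝ (Set.range fun j => (v j : E)) := fun v =>
    (convex_convexHull ℝ _).sum_mem (fun i _ => stdSimplex.barycenter.2.1 i)
      stdSimplex.barycenter.2.2 fun i _ => subset_convexHull ℝ _ (Set.mem_range_self i)
  induction n with
  | zero =>
    have : tupleSd (tupleBarycenter hs) 1 (Finsupp.single v 1) =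
        Finsupp.single (fun _ => tupleBarycenter hs 0 v) 1 := by
      simp [tupleSd]
      congr 1
      funext i
      obtain rfl : i = 0 := Fin.fin_one_eq_zero i
      rfl
    rw [this]
    refine Finsupp.single_mem_supported ℤ _ ?_
    exact ⟨fun _ => hbar v, by simp⟩
  | succ n ih =>
    have hle : (n : ℝ) / (n + 1) * d ≤ (n + 1 : ℕ) / ((n + 1 : ℕ) + 1) * d := by
      refine mul_le_mul_of_nonneg_right ?_ hd0
      rw [div_le_div_iff₀ (by positivity) (by positivity)]
      push_cast
      nlinarith
    have hnn : (0 : ℝ) ≤ (n + 1 : ℕ) / ((n + 1 : ℕ) + 1) * d := by positivity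
    rw [tupleSd_single, tupleBdry_single, map_sum, map_sum]
    refine Submodule.sum_mem _ fun i _ => ?_
    rw [map_smul, map_smul]
    refine Submodule.smul_mem _ _ ?_
    have h := ih (v := v ∘ i.succAbove) fun a b => hd _ _
    rw [Finsupp.supported_eq_span_single] at h
    refine Submodule.span_induction (p := fun x _ => tupleCone _ x ∈ _) ?_ (by simp)
      (fun x y _ _ hx hy => by rw [map_add]; exact add_mem hx hy)
      (fun a x _ hx => by rw [map_smul]; exact Submodule.smul_mem _ _ hx) h
    rintro _ ⟨w, ⟨hw1, hw2⟩, rfl⟩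
    have hhull : ∀ j, (w j : E) ∈ convexHull ℝ (Set.range fun j => (v j : E)) := fun j =>
      convexHull_mono (by rintro _ ⟨a, rfl⟩; exact ⟨i.succAbove a, rfl⟩) (hw1 j)
    -- A closed ball around the barycenter that contains all the vertices contains their convex
    -- hull, hence every vertex of the subdivided face.
    have hdist : ∀ j, dist (w j) (tupleBarycenter hs (n + 1) v) ≤
        (n + 1 : ℕ) / ((n + 1 : ℕ) + 1) * d := fun j =>
      convexHull_min (s := Set.range fun j => (v j : E))
        (t := Metric.closedBall (tupleBarycenter hs (n + 1) v : E) _)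
        (by rintro _ ⟨a, rfl⟩; exact dist_barycenter_le hs hd a) (convex_closedBall _ _) (hhull j)
    rw [tupleCone_single]
    refine Finsupp.single_mem_supported ℤ _ (And.intro ?_ ?_)
    · intro j
      cases j using Fin.cases with
      | zero => simpa using hbar v
      | succ j => simpa using hhull j
    · intro j k
      cases j using Fin.cases with
      | zero =>
        cases k using Fin.cases with
        | zero => simpa using hnn
        | succ k => simpa [dist_comm] using hdist k
      | succ j =>
        cases k using Fin.cases with
        | zero => simpa using hdist j
        | succ k => simpa using (hw2 j k).trans hle

/-- Iterated barycentric subdivisions of a simplex have arbitrarily small mesh. -/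
theorem exists_tupleSd_iterate_mem (hs : Convex ℝ s) (n : ℕ) (v : Fin (n + 1) → s) {ε : ℝ}
    (hε : 0 < ε) :
    ∃ m : ℕ, ((tupleSd (tupleBarycenter hs) (n + 1))^[m]) (Finsupp.single v 1) ∈
      Finsupp.supported ℤ ℤ {w : Fin (n + 1) → s | ∀ i j, dist (w i) (w j) < ε} := by
  obtain ⟨d, hd⟩ : ∃ d : ℝ, ∀ i j, dist (v i) (v j) ≤ d := by
    obtain ⟨d, hd⟩ := (Set.finite_range fun p : Fin (n + 1) × Fin (n + 1) =>
      dist (v p.1) (v p.2)).bddAbove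
    exact ⟨d, fun i j => hd ⟨(i, j), rfl⟩⟩
  set r : ℝ := n / (n + 1) with hr
  have hr0 : 0 ≤ r := by positivity
  have hr1 : r < 1 := by rw [hr, div_lt_one (by positivity)]; linarith
  have key : ∀ m : ℕ, ((tupleSd (tupleBarycenter hs) (n + 1))^[m]) (Finsupp.single v 1) ∈
      Finsupp.supported ℤ ℤ {w : Fin (n + 1) → s | ∀ i j, dist (w i) (w j) ≤ r ^ m * d} := by
    intro m
    induction m with
    | zero => exact Finsupp.single_mem_supported ℤ _ (by simpa using hd)
    | succ m ih =>
      rw [Function.iterate_succ_apply']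
      rw [Finsupp.supported_eq_span_single] at ih
      refine Submodule.span_induction (p := fun x _ => tupleSd _ _ x ∈ _) ?_ (by simp)
        (fun x y _ _ hx hy => by rw [map_add]; exact add_mem hx hy)
        (fun a x _ hx => by rw [map_smul]; exact Submodule.smul_mem _ _ hx) ih
      rintro _ ⟨w, hw, rfl⟩
      refine Finsupp.supported_mono (fun u hu i j => ?_) (tupleSd_single_mem hs hw)
      rw [pow_succ', mul_assoc]
      exact hu.2 i j
  have hlim : Filter.Tendsto (fun m : ℕ => r ^ m * d) Filter.atTop (𝓝 0) := by
    simpa using (tendsto_pow_atTop_nhds_zero_of_lt_one hr0 hr1).mul_const d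
  obtain ⟨m, hm⟩ := (hlim.eventually_lt_const hε).exists
  exact ⟨m, Finsupp.supported_mono (fun u hu i j => (hu i j).trans_lt hm) (key m)⟩

end Mesh

/-! ### Singular chains -/

section Singular

variable {X Y Z : Type*} [TopologicalSpace X] [TopologicalSpace Y] [TopologicalSpace Z]

/-- The group of integral singular `n`-chains. -/
abbrev SChain (n : ℕ) (X : Type*) [TopologicalSpace X] : Type _ := C(Simplex n, X) →₀ ℤ

/-- The boundary of a singular chain. -/
def bdry {n : ℕ} : SChain (n + 1) X →ₗ[ℤ] SChain n X :=
  Finsupp.linearCombination ℤ fun σ =>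
    ∑ i : Fin (n + 2), (-1 : ℤ) ^ (i : ℕ) • Finsupp.single (σ.comp (simplexFace i)) 1

/-- The map on singular chains induced by a continuous map. -/
def push {n : ℕ} (f : C(X, Y)) : SChain n X →ₗ[ℤ] SChain n Y :=
  Finsupp.linearCombination ℤ fun σ => Finsupp.single (f.comp σ) 1

@[simp]
theorem bdry_single {n : ℕ} (σ : C(Simplex (n + 1), X)) :
    bdry (Finsupp.single σ 1) =
      ∑ i : Fin (n + 2), (-1 : ℤ) ^ (i : ℕ) • Finsupp.single (σ.comp (simplexFace i)) 1 := by
  simp [bdry]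

@[simp]
theorem push_single {n : ℕ} (f : C(X, Y)) (σ : C(Simplex n, X)) :
    push f (Finsupp.single σ 1) = Finsupp.single (f.comp σ) 1 := by
  simp [push]

theorem push_bdry {n : ℕ} (f : C(X, Y)) (c : SChain (n + 1) X) :
    push f (bdry c) = bdry (push f c) := by
  refine linearMap_ext_single (f := push f ∘ₗ bdry) (g := bdry ∘ₗ push f) (fun σ => ?_) c
  simp only [LinearMap.comp_apply, bdry_single, push_single, map_sum, map_smul,
    ContinuousMap.comp_assoc]

theorem push_push {n : ℕ} (f : C(X, Y)) (g : C(Y, Z)) (c : SChain n X) :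
    push g (push f c) = push (g.comp f) c := by
  refine linearMap_ext_single (f := push g ∘ₗ push f) (g := push (g.comp f)) (fun σ => ?_) c
  simp [ContinuousMap.comp_assoc]

theorem push_id {n : ℕ} (c : SChain n X) : push (ContinuousMap.id X) c = c := by
  refine linearMap_ext_single (f := push (ContinuousMap.id X)) (g := LinearMap.id)
    (fun σ => ?_) c
  simp

/-- The chains supported in a subset. -/
def chainsOn (n : ℕ) (U : Set X) : Submodule ℤ (SChain n X) :=
  Finsupp.supported ℤ ℤ {σ | ∀ t, σ t ∈ U}

theorem single_mem_chainsOn {n : ℕ} {U : Set X} {σ : C(Simplex n, X)} (h : ∀ t, σ t ∈ U) (a : ℤ) :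
    Finsupp.single σ a ∈ chainsOn n U :=
  Finsupp.single_mem_supported ℤ _ h

theorem map_mem_of_mem_supported {α A : Type*} [AddCommGroup A] {s : Set α} {c : α →₀ ℤ}
    (hc : c ∈ Finsupp.supported ℤ ℤ s) (f : (α →₀ ℤ) →ₗ[ℤ] A) (N : Submodule ℤ A)
    (h : ∀ a ∈ s, f (Finsupp.single a 1) ∈ N) : f c ∈ N := by
  rw [Finsupp.supported_eq_span_single] at hc
  have : Submodule.span ℤ ((fun i => Finsupp.single i (1 : ℤ)) '' s) ≤ N.comap f := by
    rw [Submodule.span_le]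
    rintro _ ⟨a, ha, rfl⟩
    exact h a ha
  exact this hc

theorem chainsOn_mono {n : ℕ} {U V : Set X} (h : U ⊆ V) : chainsOn n U ≤ chainsOn n V :=
  Finsupp.supported_mono fun _ hσ t => h (hσ t)

theorem chainsOn_inter {n : ℕ} (U V : Set X) :
    chainsOn n U ⊓ chainsOn n V = chainsOn n (U ∩ V) := by
  rw [chainsOn, chainsOn, chainsOn, ← Finsupp.supported_inter]
  congr 1
  ext σ
  simp [forall_and]

theorem chainsOn_empty {n : ℕ} : chainsOn n (∅ : Set X) = ⊥ := by
  rw [chainsOn, ← Finsupp.supported_empty]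
  congr 1
  ext σ
  simp only [Set.mem_empty_iff_false, Set.mem_ofPred_eq, forall_const]

theorem mem_chainsOn_univ {n : ℕ} (c : SChain n X) : c ∈ chainsOn n (Set.univ : Set X) := by
  simp [chainsOn]

theorem push_mem_chainsOn {n : ℕ} {f : C(X, Y)} {U : Set X} {V : Set Y} (h : Set.MapsTo f U V)
    {c : SChain n X} (hc : c ∈ chainsOn n U) : push f c ∈ chainsOn n V :=
  map_mem_of_mem_supported hc _ _ fun σ hσ => by
    rw [push_single]
    exact single_mem_chainsOn (fun t => h (hσ t)) 1

theorem bdry_mem_chainsOn {n : ℕ} {U : Set X} {c : SChain (n + 1) X}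
    (hc : c ∈ chainsOn (n + 1) U) : bdry c ∈ chainsOn n U :=
  map_mem_of_mem_supported hc _ _ fun σ hσ => by
    rw [bdry_single]
    exact Submodule.sum_mem _ fun i _ =>
      Submodule.smul_mem _ _ (single_mem_chainsOn (fun t => hσ (simplexFace i t)) 1)

/-- If every simplex in `U ∪ V` lies in `U` or in `V`, then chains in the union split. -/
theorem chainsOn_union {n : ℕ} {U V : Set X}
    (h : ∀ σ : C(Simplex n, X), (∀ t, σ t ∈ U ∪ V) → (∀ t, σ t ∈ U) ∨ ∀ t, σ t ∈ V) :
    chainsOn n (U ∪ V) = chainsOn n U ⊔ chainsOn n V := by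
  rw [chainsOn, chainsOn, chainsOn, ← Finsupp.supported_union]
  congr 1
  ext σ
  refine ⟨h σ, ?_⟩
  rintro (h | h) t
  exacts [Or.inl (h t), Or.inr (h t)]

theorem chainsOn_union_of_isOpen {n : ℕ} {U V : Set X} (hU : IsOpen U) (hV : IsOpen V)
    (hd : Disjoint U V) : chainsOn n (U ∪ V) = chainsOn n U ⊔ chainsOn n V := by
  refine chainsOn_union fun σ hσ => ?_
  have hr : IsPreconnected (Set.range σ) := isPreconnected_range σ.continuous
  have := hr.subset_or_subset hU hV hd (by rintro _ ⟨t, rfl⟩; exact hσ t)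
  simpa [Set.range_subset_iff] using this

theorem chainsOn_union_of_isClosed {n : ℕ} {U V : Set X} (hU : IsClosed U) (hV : IsClosed V)
    (hd : Disjoint U V) : chainsOn n (U ∪ V) = chainsOn n U ⊔ chainsOn n V := by
  refine chainsOn_union fun σ hσ => ?_
  have hr : IsPreconnected (Set.range σ) := isPreconnected_range σ.continuous
  have := isPreconnected_iff_subset_of_disjoint_closed.1 hr U V hU hV
    (by rintro _ ⟨t, rfl⟩; exact hσ t) (by rw [hd.inter_eq, Set.inter_empty])
  simpa [Set.range_subset_iff] using this

/-- The realization of tuple chains, given a realization of each tuple. -/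
def realize {T : Type*} (a : ∀ m : ℕ, (Fin (m + 1) → T) → C(Simplex m, X)) {m : ℕ} :
    TupleChain (m + 1) T →ₗ[ℤ] SChain m X :=
  Finsupp.linearCombination ℤ fun v => Finsupp.single (a m v) 1

@[simp]
theorem realize_single {T : Type*} (a : ∀ m : ℕ, (Fin (m + 1) → T) → C(Simplex m, X)) {m : ℕ}
    (v : Fin (m + 1) → T) : realize a (Finsupp.single v 1) = Finsupp.single (a m v) 1 := by
  simp [realize]

theorem bdry_realize {T : Type*} {a : ∀ m : ℕ, (Fin (m + 1) → T) → C(Simplex m, X)}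
    (ha : ∀ m v i, (a (m + 1) v).comp (simplexFace i) = a m (v ∘ i.succAbove)) {m : ℕ}
    (c : TupleChain (m + 2) T) : bdry (realize a c) = realize a (tupleBdry c) := by
  refine linearMap_ext_single (f := bdry ∘ₗ realize a) (g := realize a ∘ₗ tupleBdry)
    (fun σ => ?_) c
  simp only [LinearMap.comp_apply, realize_single, bdry_single, tupleBdry_single, map_sum,
    map_smul, ha]

theorem realize_tupleMap {T T' : Type*} {a : ∀ m : ℕ, (Fin (m + 1) → T) → C(Simplex m, X)}
    {a' : ∀ m : ℕ, (Fin (m + 1) → T') → C(Simplex m, X)} {f : T' → T}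
    (ha : ∀ m v, a m (f ∘ v) = a' m v) {m : ℕ} (c : TupleChain (m + 1) T') :
    realize a (tupleMap f c) = realize a' c := by
  refine linearMap_ext_single (f := realize a ∘ₗ tupleMap f) (g := realize a') (fun v => ?_) c
  simp [ha]

theorem push_realize {T : Type*} (a : ∀ m : ℕ, (Fin (m + 1) → T) → C(Simplex m, X)) (f : C(X, Y))
    {m : ℕ} (c : TupleChain (m + 1) T) :
    push f (realize a c) = realize (fun m v => f.comp (a m v)) c := by
  refine linearMap_ext_single (f := push f ∘ₗ realize a)
    (g := realize fun m v => f.comp (a m v)) (fun v => ?_) c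
  simp

theorem realize_mem_chainsOn {T : Type*} {a : ∀ m : ℕ, (Fin (m + 1) → T) → C(Simplex m, X)}
    {U : Set X} (ha : ∀ m v t, a m v t ∈ U) {m : ℕ} (c : TupleChain (m + 1) T) :
    realize a c ∈ chainsOn m U := by
  refine map_mem_of_mem_supported (s := Set.univ) (by simp) _ _ fun v _ => ?_
  rw [realize_single]
  exact single_mem_chainsOn (ha m v) 1

/-- The realization, through a singular simplex `σ`, of tuples of points of the standard simplex. -/
def simplexRealization {k : ℕ} (σ : C(Simplex k, X)) (m : ℕ) (v : Fin (m + 1) → Simplex k) :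
    C(Simplex m, X) :=
  σ.comp (simplexMap v)

theorem simplexRealization_face {k : ℕ} (σ : C(Simplex k, X)) (m : ℕ)
    (v : Fin (m + 2) → Simplex k) (i : Fin (m + 2)) :
    (simplexRealization σ (m + 1) v).comp (simplexFace i) =
      simplexRealization σ m (v ∘ i.succAbove) := by
  rw [simplexRealization, ContinuousMap.comp_assoc, affineSimplex_comp_face]
  rfl

theorem simplexRealization_comp {k l : ℕ} (σ : C(Simplex k, X)) (w : Fin (l + 1) → Simplex k)
    (m : ℕ) (v : Fin (m + 1) → Simplex l) :
    simplexRealization σ m (simplexMap w ∘ v) = simplexRealization (σ.comp (simplexMap w)) m v := by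
  rw [simplexRealization, simplexRealization, ContinuousMap.comp_assoc, affineSimplex_comp]

theorem simplexRealization_vertex {k : ℕ} (σ : C(Simplex k, X)) :
    simplexRealization σ k (simplexVertex k) = σ := by
  rw [simplexRealization, simplexMap_vertex, ContinuousMap.comp_id]

/-- The tuple chain of the vertices of the standard simplex. -/
abbrev vertexChain (n : ℕ) : TupleChain (n + 1) (Simplex n) := Finsupp.single (simplexVertex n) 1

theorem tupleBdry_vertexChain (n : ℕ) :
    tupleBdry (vertexChain (n + 1)) = ∑ i : Fin (n + 2), (-1 : ℤ) ^ (i : ℕ) •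
      tupleMap (simplexFace i) (vertexChain n) := by
  rw [tupleBdry_single]
  refine Finset.sum_congr rfl fun i _ => ?_
  rw [tupleMap_single]
  congr 2
  funext j
  exact (affineSimplex_vertex (convex_stdSimplex ℝ (Fin (n + 2))) _ j).symm

theorem bdry_bdry {n : ℕ} (c : SChain (n + 2) X) : bdry (bdry c) = 0 := by
  refine linearMap_ext_single (f := bdry ∘ₗ bdry) (g := 0) (fun σ => ?_) c
  have : Finsupp.single σ 1 = realize (simplexRealization σ) (vertexChain (n + 2)) := by
    rw [realize_single, simplexRealization_vertex]
  rw [LinearMap.comp_apply, this, bdry_realize (simplexRealization_face σ),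
    bdry_realize (simplexRealization_face σ), tupleBdry_tupleBdry]
  simp

/-! ### Subdivision and homotopy operators -/

/-- Barycentric subdivision of singular chains. -/
def sd {n : ℕ} : SChain n X →ₗ[ℤ] SChain n X :=
  Finsupp.linearCombination ℤ fun σ =>
    realize (simplexRealization σ) (tupleSd (simplexBarycenter n) (n + 1) (vertexChain n))

theorem sd_single {n : ℕ} (σ : C(Simplex n, X)) :
    sd (Finsupp.single σ 1) =
      realize (simplexRealization σ) (tupleSd (simplexBarycenter n) (n + 1) (vertexChain n)) := by
  simp [sd]

/-- Subdividing affine simplices inside σ can be done in the coordinates of the standard simplex.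
Identities for `sd` and its iterates thereby reduce to identities for tuples. -/
theorem sd_realize {k : ℕ} (σ : C(Simplex k, X)) {m : ℕ} (c : TupleChain (m + 1) (Simplex k)) :
    sd (realize (simplexRealization σ) c) =
      realize (simplexRealization σ) (tupleSd (simplexBarycenter k) (m + 1) c) := by
  refine linearMap_ext_single (f := sd ∘ₗ realize (simplexRealization σ))
    (g := realize (simplexRealization σ) ∘ₗ tupleSd (simplexBarycenter k) (m + 1))
    (fun v => ?_) c
  have hv : tupleMap (simplexMap v) (vertexChain m) = Finsupp.single v 1 := by
    rw [tupleMap_single]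
    congr 1
    funext j
    exact affineSimplex_vertex _ _ j
  rw [LinearMap.comp_apply, LinearMap.comp_apply, realize_single, sd_single, ← hv,
    ← tupleMap_tupleSd (fun n w => affineSimplex_barycenter _ v n w),
    realize_tupleMap (simplexRealization_comp σ v)]
  rfl

theorem push_sd {n : ℕ} (f : C(X, Y)) (c : SChain n X) : push f (sd c) = sd (push f c) := by
  refine linearMap_ext_single (f := push f ∘ₗ sd) (g := sd ∘ₗ push f) (fun σ => ?_) c
  rw [LinearMap.comp_apply, LinearMap.comp_apply, push_single, sd_single, sd_single, push_realize]
  rfl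

theorem sd_mem_chainsOn {n : ℕ} {U : Set X} {c : SChain n X} (hc : c ∈ chainsOn n U) :
    sd c ∈ chainsOn n U :=
  map_mem_of_mem_supported hc _ _ fun σ hσ => by
    rw [sd_single]
    exact realize_mem_chainsOn (fun m v t => hσ _) _

theorem bdry_sd {n : ℕ} (c : SChain (n + 1) X) : bdry (sd c) = sd (bdry c) := by
  refine linearMap_ext_single (f := bdry ∘ₗ sd) (g := sd ∘ₗ bdry) (fun σ => ?_) c
  have : Finsupp.single σ 1 = realize (simplexRealization σ) (vertexChain (n + 1)) := by
    rw [realize_single, simplexRealization_vertex]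
  rw [LinearMap.comp_apply, LinearMap.comp_apply, this, sd_realize,
    bdry_realize (simplexRealization_face σ), bdry_realize (simplexRealization_face σ),
    tupleBdry_tupleSd, sd_realize]

/-- The realization of tuples of points of `Δ × [0,1]` through a singular simplex and a homotopy. -/
def prismRealization (H : C(X × unitInterval, Y)) {k : ℕ} (σ : C(Simplex k, X)) (m : ℕ)
    (v : Fin (m + 1) → Simplex k × unitInterval) : C(Simplex m, Y) :=
  H.comp ((σ.comp (simplexMap (Prod.fst ∘ v))).prodMk
    (affineSimplex (convex_Icc (0 : ℝ) 1) (Prod.snd ∘ v)))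

theorem prismRealization_face (H : C(X × unitInterval, Y)) {k : ℕ} (σ : C(Simplex k, X)) (m : ℕ)
    (v : Fin (m + 2) → Simplex k × unitInterval) (i : Fin (m + 2)) :
    (prismRealization H σ (m + 1) v).comp (simplexFace i) =
      prismRealization H σ m (v ∘ i.succAbove) := by
  have h1 := affineSimplex_comp_face (convex_stdSimplex ℝ (Fin (k + 1))) (Prod.fst ∘ v) i
  have h2 := affineSimplex_comp_face (convex_Icc (0 : ℝ) 1) (Prod.snd ∘ v) i
  ext t
  exact congrArg H (Prod.ext (congrArg σ (DFunLike.congr_fun h1 t)) (DFunLike.congr_fun h2 t))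

theorem prismRealization_comp (H : C(X × unitInterval, Y)) {k l : ℕ} (σ : C(Simplex k, X))
    (w : Fin (l + 1) → Simplex k) (m : ℕ) (v : Fin (m + 1) → Simplex l × unitInterval) :
    prismRealization H σ m (Prod.map (simplexMap w) id ∘ v) =
      prismRealization H (σ.comp (simplexMap w)) m v := by
  have h1 := affineSimplex_comp (convex_stdSimplex ℝ (Fin (k + 1))) w (Prod.fst ∘ v)
  ext t
  exact congrArg H (Prod.ext (congrArg σ (DFunLike.congr_fun h1 t).symm) rfl)

theorem prismRealization_const (H : C(X × unitInterval, Y)) (s : unitInterval) {k : ℕ}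
    (σ : C(Simplex k, X)) (m : ℕ) (v : Fin (m + 1) → Simplex k) :
    prismRealization H σ m ((fun x => (x, s)) ∘ v) =
      simplexRealization ((H.comp ((ContinuousMap.id X).prodMk (ContinuousMap.const X s))).comp σ)
        m v := by
  ext t
  refine congrArg H (Prod.ext rfl (Subtype.ext ?_))
  have : ∑ i, t.1 i * (s : ℝ) = s := by rw [← Finset.sum_mul, t.2.2, one_mul]
  exact this

/-- The map at time `s` of a homotopy. -/
abbrev homotopyAt (H : C(X × unitInterval, Y)) (s : unitInterval) : C(X, Y) :=
  H.comp ((ContinuousMap.id X).prodMk (ContinuousMap.const X s))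

/-- The prism operator of a homotopy, which also subdivides at time `0`. -/
def prism (H : C(X × unitInterval, Y)) {n : ℕ} : SChain n X →ₗ[ℤ] SChain (n + 1) Y :=
  Finsupp.linearCombination ℤ fun σ =>
    realize (prismRealization H σ) (tuplePrism (simplexBarycenter n) (n + 1) (vertexChain n))

theorem prism_single (H : C(X × unitInterval, Y)) {n : ℕ} (σ : C(Simplex n, X)) :
    prism H (Finsupp.single σ 1) = realize (prismRealization H σ)
      (tuplePrism (simplexBarycenter n) (n + 1) (vertexChain n)) := by
  simp [prism]

theorem prism_mem_chainsOn (H : C(X × unitInterval, Y)) {n : ℕ} {U : Set X} {V : Set Y}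
    (h : ∀ x ∈ U, ∀ s, H (x, s) ∈ V) {c : SChain n X} (hc : c ∈ chainsOn n U) :
    prism H c ∈ chainsOn (n + 1) V :=
  map_mem_of_mem_supported hc _ _ fun σ hσ => by
    rw [prism_single]
    exact realize_mem_chainsOn (fun m v t => h _ (hσ _) _) _

/-- The tuple formula, realized through σ and H. The faces of the vertex tuple are images under face
inclusions, so naturality of `tuplePrism` identifies the last term with the prism on the boundary of
σ. -/
theorem bdry_prism (H : C(X × unitInterval, Y)) {n : ℕ} (c : SChain (n + 1) X) :
    bdry (prism H c) = push (homotopyAt H 1) c - push (homotopyAt H 0) (sd c) -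
      prism H (bdry c) := by
  refine linearMap_ext_single (f := bdry ∘ₗ prism H)
    (g := push (homotopyAt H 1) - push (homotopyAt H 0) ∘ₗ sd - prism H ∘ₗ bdry)
    (fun σ => ?_) c
  simp only [LinearMap.comp_apply, LinearMap.sub_apply]
  rw [prism_single, bdry_realize (prismRealization_face H σ), tupleBdry_tuplePrism, map_sub,
    map_sub, realize_tupleMap (prismRealization_const H 1 σ),
    realize_tupleMap (prismRealization_const H 0 σ), tupleBdry_vertexChain]
  congr 1
  · congr 1
    · rw [realize_single, simplexRealization_vertex, push_single]
    · rw [push_sd, push_single, sd_single]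
  · rw [bdry_single]
    simp only [map_sum, map_smul, prism_single]
    refine Finset.sum_congr rfl fun i _ => ?_
    congr 1
    rw [← tupleMap_tuplePrism (f := simplexFace i)
      (fun m w => affineSimplex_barycenter _ _ m w)]
    exact realize_tupleMap (prismRealization_comp H σ _) _

/-- A homotopy between two maps yields a chain homotopy up to subdivision, and hence homologous
images of cycles. -/
theorem exists_bdry_eq_push_sub_push (H : C(X × unitInterval, Y)) {n : ℕ} {U : Set X} {V : Set Y}
    (h : ∀ x ∈ U, ∀ s, H (x, s) ∈ V) {c : SChain (n + 1) X} (hc : c ∈ chainsOn (n + 1) U)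
    (hz : bdry c = 0) :
    ∃ w ∈ chainsOn (n + 2) V,
      bdry w = push (homotopyAt H 1) c - push (homotopyAt H 0) c := by
  -- The prism of the stationary homotopy at time 0 is subtracted to turn the subdivided term `sd c`
  -- back into c.
  let H0 : C(X × unitInterval, Y) := (homotopyAt H 0).comp ContinuousMap.fst
  refine ⟨prism H c - prism H0 c, sub_mem (prism_mem_chainsOn H h hc)
    (prism_mem_chainsOn H0 (fun x hx s => h x hx 0) hc), ?_⟩
  rw [map_sub, bdry_prism, bdry_prism, hz, map_zero, map_zero]
  have : ∀ s, homotopyAt H0 s = homotopyAt H 0 := fun s => rfl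
  rw [this, this]
  abel

/-- An iterated subdivision is chain homotopic to the identity, by a homotopy that preserves
supports. -/
theorem exists_subdivision_homotopy (X : Type*) [TopologicalSpace X] (m : ℕ) :
    ∃ T : ∀ n : ℕ, SChain n X →ₗ[ℤ] SChain (n + 1) X,
      (∀ n (c : SChain (n + 1) X),
        bdry (T (n + 1) c) + T n (bdry c) = c - (sd (X := X) (n := n + 1))^[m] c) ∧
      ∀ n (U : Set X), ∀ c ∈ chainsOn n U, T n c ∈ chainsOn (n + 1) U := by
  induction m with
  | zero => exact ⟨fun n => 0, by simp, by simp⟩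
  | succ m ih =>
    obtain ⟨T, hT, hU⟩ := ih
    -- The prism of the stationary homotopy is a chain homotopy from `sd` to the identity. Adding
    -- the given homotopy precomposed with `sd` accounts for one more subdivision.
    let P : C(X × unitInterval, X) := ContinuousMap.fst
    have hP : ∀ s, homotopyAt P s = ContinuousMap.id X := fun s => rfl
    refine ⟨fun n => prism P + T n ∘ₗ sd, fun n c => ?_, fun n U c hc => ?_⟩
    · have h1 := hT n (sd c)
      simp only [LinearMap.add_apply, LinearMap.comp_apply, map_add, bdry_prism, hP, push_id]
      rw [Function.iterate_succ_apply, ← bdry_sd]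
      rw [← sub_eq_zero] at h1 ⊢
      rw [← h1]
      abel
    · exact add_mem (prism_mem_chainsOn P (fun x hx _ => hx) hc) (hU n U _ (sd_mem_chainsOn hc))

theorem sd_iterate_mem_sup {n : ℕ} {U V : Set X} {c : SChain n X}
    (hc : c ∈ chainsOn n U ⊔ chainsOn n V) (m : ℕ) :
    (sd (X := X) (n := n))^[m] c ∈ chainsOn n U ⊔ chainsOn n V := by
  induction m with
  | zero => exact hc
  | succ m ih =>
    rw [Function.iterate_succ_apply']
    obtain ⟨a, ha, b, hb, hab⟩ := Submodule.mem_sup.1 ih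
    rw [← hab, map_add]
    exact Submodule.add_mem_sup (sd_mem_chainsOn ha) (sd_mem_chainsOn hb)

/-- Iterated subdivisions of a chain are eventually small with respect to an open cover. -/
theorem exists_sd_iterate_mem_sup {n : ℕ} {U V : Set X} (hU : IsOpen U) (hV : IsOpen V)
    {c : SChain n X} (hc : c ∈ chainsOn n (U ∪ V)) :
    ∃ m : ℕ, (sd (X := X) (n := n))^[m] c ∈ chainsOn n U ⊔ chainsOn n V := by
  have key : ∀ σ : C(Simplex n, X), (∀ t, σ t ∈ U ∪ V) →
      ∃ m : ℕ, (sd (X := X) (n := n))^[m] (Finsupp.single σ 1) ∈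
        chainsOn n U ⊔ chainsOn n V := by
    intro σ hσ
    obtain ⟨δ, hδ, hL⟩ := lebesgue_number_lemma_of_metric (s := (Set.univ : Set (Simplex n)))
      (c := fun b : Bool => σ ⁻¹' (if b then U else V)) isCompact_univ
      (by rintro (_ | _) <;> simp [hU.preimage σ.continuous, hV.preimage σ.continuous])
      (fun t _ => by
        rcases hσ t with h | h
        exacts [Set.mem_iUnion.2 ⟨true, by simpa⟩, Set.mem_iUnion.2 ⟨false, by simpa⟩])
    -- With vertices closer than δ / 2 the whole small simplex lies in a closed ball of radius δ /
    -- 2, by convexity, hence in the open Lebesgue ball of radius δ.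
    obtain ⟨m, hm⟩ := exists_tupleSd_iterate_mem (convex_stdSimplex ℝ (Fin (n + 1))) n
      (simplexVertex n) (half_pos hδ)
    refine ⟨m, ?_⟩
    have hit : ∀ m : ℕ, (sd (X := X) (n := n))^[m] (Finsupp.single σ 1) =
        realize (simplexRealization σ)
          ((tupleSd (simplexBarycenter n) (n + 1))^[m] (vertexChain n)) := by
      intro m
      induction m with
      | zero => simp [simplexRealization_vertex]
      | succ m ih => rw [Function.iterate_succ_apply', ih, sd_realize, Function.iterate_succ_apply']
    rw [hit]
    refine map_mem_of_mem_supported hm _ _ fun w hw => ?_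
    rw [realize_single]
    obtain ⟨b, hb⟩ := hL (w 0) trivial
    have hball : ∀ t, simplexMap w t ∈ Metric.ball (w 0) δ := fun t => by
      have : (simplexMap w t : Fin (n + 1) → ℝ) ∈ Metric.closedBall (w 0 : Fin (n + 1) → ℝ) (δ / 2) :=
        (convex_closedBall _ _).sum_mem (fun i _ => t.2.1 i) t.2.2 fun i _ => (hw i 0).le
      exact (Metric.mem_closedBall.1 this).trans_lt (half_lt_self hδ)
    cases b with
    | true =>
      exact Submodule.mem_sup_left
        (single_mem_chainsOn (U := U) (σ := simplexRealization σ n w) (fun t => hb (hball t)) 1)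
    | false =>
      have h : ∀ t, simplexRealization σ n w t ∈ V := fun t => by
        have := hb (hball t)
        rwa [if_neg Bool.false_ne_true] at this
      exact Submodule.mem_sup_right (single_mem_chainsOn h 1)
  rw [chainsOn, Finsupp.supported_eq_span_single] at hc
  refine Submodule.span_induction (p := fun c _ => ∃ m : ℕ, (sd (X := X) (n := n))^[m] c ∈
    chainsOn n U ⊔ chainsOn n V) ?_ ⟨0, by simp⟩ ?_ ?_ hc
  · rintro _ ⟨σ, hσ, rfl⟩
    exact key σ hσ
  · rintro x y _ _ ⟨k, hk⟩ ⟨l, hl⟩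
    -- Smallness survives further subdivision, so k + l subdivisions serve both summands.
    refine ⟨k + l, ?_⟩
    rw [← Module.End.coe_pow, map_add, Module.End.coe_pow]
    refine add_mem ?_ ?_
    · rw [add_comm k l, Function.iterate_add_apply]
      exact sd_iterate_mem_sup hk l
    · rw [Function.iterate_add_apply]
      exact sd_iterate_mem_sup hl k
  · rintro a x _ ⟨k, hk⟩
    refine ⟨k, ?_⟩
    rw [← Module.End.coe_pow, map_smul, Module.End.coe_pow]
    exact Submodule.smul_mem _ _ hk

end Singular

/-! ### Vanishing of homology, in terms of cycles -/

section Vanishing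

variable {X Y Z : Type*} [TopologicalSpace X] [TopologicalSpace Y] [TopologicalSpace Z]

/-- Every `(n+1)`-cycle in `U` is a boundary in `U`, that is, `H_{n+1}(U) = 0`. -/
def CyclesBoundOn (n : ℕ) (U : Set X) : Prop :=
  ∀ c ∈ chainsOn (n + 1) U, bdry c = 0 → ∃ w ∈ chainsOn (n + 2) U, bdry w = c

/-- Every `(n+1)`-cycle of the space `X` is a boundary, that is, `H_{n+1}(X) = 0`. -/
def CyclesBound (n : ℕ) (X : Type*) [TopologicalSpace X] : Prop :=
  ∀ c : SChain (n + 1) X, bdry c = 0 → ∃ w, bdry w = c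

theorem exists_push_eq {f : X → Y} (hf : IsEmbedding f) {n : ℕ} {V : Set X} {c : SChain n Y}
    (hc : c ∈ chainsOn n (f '' V)) :
    ∃ c' ∈ chainsOn n V, push ⟨f, hf.continuous⟩ c' = c := by
  have : c ∈ (chainsOn n V).map (push ⟨f, hf.continuous⟩) := by
    refine map_mem_of_mem_supported hc LinearMap.id _ fun σ hσ => ?_
    choose g hg hgσ using hσ
    -- The pointwise lift of a simplex is continuous because an embedding induces the topology of
    -- its source.
    have hgc : Continuous g := hf.continuous_iff.2 (by
      rw [show f ∘ g = σ from funext hgσ]; exact σ.continuous)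
    refine ⟨Finsupp.single ⟨g, hgc⟩ 1, single_mem_chainsOn hg 1, ?_⟩
    rw [push_single, LinearMap.id_apply]
    congr 1
    ext t
    exact hgσ t
  exact this

theorem push_injective {f : C(X, Y)} (hf : Function.Injective f) {n : ℕ} :
    Function.Injective (push f : SChain n X → SChain n Y) := by
  have : (push f : SChain n X → SChain n Y) = Finsupp.mapDomain fun σ => f.comp σ := by
    funext c
    refine linearMap_ext_single (f := push f) (g := Finsupp.lmapDomain ℤ ℤ fun σ => f.comp σ)
      (fun σ => ?_) c
    simp
  rw [this]
  exact Finsupp.mapDomain_injective fun σ τ h => ContinuousMap.ext fun t =>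
    hf (DFunLike.congr_fun h t)

theorem cyclesBoundOn_image {f : X → Y} (hf : IsEmbedding f) {n : ℕ} {V : Set X} :
    CyclesBoundOn n (f '' V) ↔ CyclesBoundOn n V := by
  have hinj {n : ℕ} := push_injective (n := n) (f := ⟨f, hf.continuous⟩) hf.injective
  constructor
  · intro h c hc hz
    obtain ⟨w, hw, hwc⟩ := h (push ⟨f, hf.continuous⟩ c)
      (push_mem_chainsOn (Set.mapsTo_image f V) hc) (by rw [← push_bdry, hz, map_zero])
    obtain ⟨w', hw', rfl⟩ := exists_push_eq hf hw
    exact ⟨w', hw', hinj (by rw [push_bdry, hwc])⟩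
  · intro h c hc hz
    obtain ⟨c', hc', rfl⟩ := exists_push_eq hf hc
    obtain ⟨w, hw, rfl⟩ := h c' hc' (hinj (by rw [push_bdry, hz, map_zero]))
    exact ⟨push ⟨f, hf.continuous⟩ w, push_mem_chainsOn (Set.mapsTo_image f V) hw,
      (push_bdry _ _).symm⟩

theorem cyclesBoundOn_univ {n : ℕ} : CyclesBoundOn n (Set.univ : Set X) ↔ CyclesBound n X :=
  ⟨fun h c hz => (h c (mem_chainsOn_univ c) hz).imp fun _ hw => hw.2,
    fun h c _ hz => (h c hz).imp fun w hw => ⟨mem_chainsOn_univ w, hw⟩⟩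

theorem cyclesBoundOn_iff {n : ℕ} {U : Set X} : CyclesBoundOn n U ↔ CyclesBound n U := by
  rw [← cyclesBoundOn_univ, ← cyclesBoundOn_image (IsEmbedding.subtypeVal (p := (· ∈ U)))]
  simp

theorem cyclesBoundOn_range {f : X → Y} (hf : IsEmbedding f) {n : ℕ} :
    CyclesBoundOn n (Set.range f) ↔ CyclesBound n X := by
  rw [← Set.image_univ, cyclesBoundOn_image hf, cyclesBoundOn_univ]

/-- Homotopic maps send a cycle to homologous cycles. -/
theorem exists_bdry_eq_of_homotopic {f g : C(X, Y)} (h : f.Homotopic g) {n : ℕ}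
    {c : SChain (n + 1) X} (hz : bdry c = 0) : ∃ w, bdry w = push f c - push g c := by
  obtain ⟨F⟩ := h.symm
  obtain ⟨w, -, hw⟩ := exists_bdry_eq_push_sub_push (F.toContinuousMap.comp ContinuousMap.prodSwap)
    (U := Set.univ) (V := Set.univ) (by simp) (mem_chainsOn_univ c) hz
  refine ⟨w, hw.trans ?_⟩
  congr 2
  · congr 1
    ext x
    exact F.apply_one x
  · congr 1
    ext x
    exact F.apply_zero x

/-- If `i` has a left homotopy inverse then cycles bound as soon as their images under `i` do. -/
theorem exists_bdry_eq_of_leftInverse {i : C(Y, X)} {r : C(X, Y)}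
    (h : (r.comp i).Homotopic (ContinuousMap.id Y)) {n : ℕ} {c : SChain (n + 1) Y}
    (hz : bdry c = 0) (hb : ∃ w, bdry w = push i c) : ∃ w, bdry w = c := by
  obtain ⟨w, hw⟩ := hb
  obtain ⟨v, hv⟩ := exists_bdry_eq_of_homotopic h hz
  refine ⟨push r w - v, ?_⟩
  rw [map_sub, ← push_bdry, hw, hv, push_push, push_id]
  abel

theorem CyclesBound.of_leftInverse {i : C(Y, X)} {r : C(X, Y)}
    (h : (r.comp i).Homotopic (ContinuousMap.id Y)) {n : ℕ} (hX : CyclesBound n X) :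
    CyclesBound n Y := fun c hz =>
  exists_bdry_eq_of_leftInverse h hz (hX _ (by rw [← push_bdry, hz, map_zero]))

theorem CyclesBound.of_homeomorph (e : Y ≃ₜ X) {n : ℕ} (hX : CyclesBound n X) :
    CyclesBound n Y :=
  hX.of_leftInverse (i := e) (r := e.symm) (by
    rw [show (e.symm : C(X, Y)).comp (e : C(Y, X)) = ContinuousMap.id Y by ext; simp])

/-- There is one simplex in each degree, and its boundary is an alternating sum of equal terms: zero
if the number of faces is even, the simplex one degree lower if it is odd. So in each positive
degree either the outgoing boundary is injective or the incoming one is onto. -/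
theorem cyclesBound_of_unique [Unique X] (n : ℕ) : CyclesBound n X := by
  intro c hz
  have huniq : ∀ {m : ℕ} (σ : C(Simplex m, X)), σ = ContinuousMap.const _ default :=
    fun σ => ContinuousMap.ext fun t => Subsingleton.elim _ _
  have hb : ∀ m : ℕ, bdry (Finsupp.single (ContinuousMap.const (Simplex (m + 1)) (default : X)) 1) =
      if Even (m + 2) then 0 else Finsupp.single (ContinuousMap.const (Simplex m) default) 1 := by
    intro m
    rw [bdry_single]
    simp_rw [huniq (_ : C(Simplex m, X))]
    rw [← Finset.sum_smul, Fin.sum_neg_one_pow]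
    split_ifs <;> simp
  obtain ⟨a, rfl⟩ : ∃ a : ℤ, c = a • Finsupp.single (ContinuousMap.const _ default) 1 := by
    refine ⟨c (ContinuousMap.const _ default), Finsupp.ext fun σ => ?_⟩
    rw [huniq σ]
    simp
  rw [map_smul, hb] at hz
  by_cases hn : Even (n + 2)
  · refine ⟨a • Finsupp.single (ContinuousMap.const _ default) 1, ?_⟩
    rw [map_smul, hb, if_neg (by rw [Nat.even_add_one]; simpa using hn)]
  · rw [if_neg hn] at hz
    have ha : a = 0 := by simpa using hz
    exact ⟨0, by simp [ha]⟩

theorem cyclesBound_of_contractible [ContractibleSpace X] (n : ℕ) : CyclesBound n X := by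
  obtain ⟨x, hx⟩ := id_nullhomotopic X
  refine (cyclesBound_of_unique (X := Unit) n).of_leftInverse (i := ContinuousMap.const X ())
    (r := ContinuousMap.const Unit x) ?_
  rw [ContinuousMap.comp_const]
  exact hx.symm

/-- A chain is supported in a compact set. -/
theorem exists_isCompact_mem_chainsOn {n : ℕ} {U : Set X} {c : SChain n X}
    (hc : c ∈ chainsOn n U) : ∃ T ⊆ U, IsCompact T ∧ c ∈ chainsOn n T := by
  refine ⟨⋃ σ ∈ c.support, Set.range σ, ?_, ?_, ?_⟩
  · refine Set.iUnion₂_subset fun σ hσ => ?_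
    rintro _ ⟨t, rfl⟩
    exact hc hσ t
  · exact c.support.finite_toSet.isCompact_biUnion fun σ _ => isCompact_range σ.continuous
  · intro σ hσ t
    exact Set.mem_biUnion hσ ⟨t, rfl⟩

/-- A chain in a union of two open sets, whose boundary is small, is homologous to a small one. -/
theorem exists_eq_add_add_bdry {n : ℕ} {U V : Set X} (hU : IsOpen U) (hV : IsOpen V)
    {c : SChain (n + 1) X} (hc : c ∈ chainsOn (n + 1) (U ∪ V))
    (hb : bdry c ∈ chainsOn n U ⊔ chainsOn n V) :
    ∃ a ∈ chainsOn (n + 1) U, ∃ b ∈ chainsOn (n + 1) V, ∃ w ∈ chainsOn (n + 2) (U ∪ V),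
      c = a + b + bdry w := by
  obtain ⟨m, hm⟩ := exists_sd_iterate_mem_sup hU hV hc
  obtain ⟨T, hT, hTU⟩ := exists_subdivision_homotopy X m
  -- The chain c is its m-th subdivision plus `T (bdry c)` plus `bdry (T c)`. The first is small by
  -- the choice of m; the second is small because T preserves supports and `bdry c` is small
  -- already.
  have hTb : T n (bdry c) ∈ chainsOn (n + 1) U ⊔ chainsOn (n + 1) V := by
    obtain ⟨x, hx, y, hy, hxy⟩ := Submodule.mem_sup.1 hb
    rw [← hxy, map_add]
    exact Submodule.add_mem_sup (hTU _ _ _ hx) (hTU _ _ _ hy)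
  obtain ⟨a, ha, b, hb, hab⟩ := Submodule.mem_sup.1 (add_mem hm hTb)
  refine ⟨a, ha, b, hb, T (n + 1) c, hTU _ _ _ hc, ?_⟩
  have h := hT n c
  rw [hab, ← sub_eq_zero]
  rw [← sub_eq_zero] at h
  rw [← neg_eq_zero, ← h]
  abel

/-- Mayer–Vietoris: vanishing of the homology of a union of two open sets, if the intersection
injects on homology into one of them. -/
theorem CyclesBoundOn.union_of_injective {n : ℕ} {U V : Set X} (hU : IsOpen U) (hV : IsOpen V)
    (h1 : CyclesBoundOn (n + 1) U) (h2 : CyclesBoundOn (n + 1) V)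
    (h3 : ∀ d ∈ chainsOn (n + 1) (U ∩ V), bdry d = 0 → (∃ w ∈ chainsOn (n + 2) V, bdry w = d) →
      ∃ w ∈ chainsOn (n + 2) (U ∩ V), bdry w = d) :
    CyclesBoundOn (n + 1) (U ∪ V) := by
  intro c hc hz
  obtain ⟨a, ha, b, hb, w, hw, rfl⟩ := exists_eq_add_add_bdry hU hV hc (by rw [hz]; exact zero_mem _)
  rw [map_add, map_add, bdry_bdry, add_zero] at hz
  have hab : bdry a = -bdry b := eq_neg_of_add_eq_zero_left hz
  have hmem : bdry a ∈ chainsOn (n + 1) (U ∩ V) := by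
    rw [← chainsOn_inter]
    refine ⟨bdry_mem_chainsOn ha, ?_⟩
    rw [hab]
    exact neg_mem (bdry_mem_chainsOn hb)
  -- The cycle `bdry a` of the intersection bounds `-b` in V, so it bounds some y in the
  -- intersection. Correcting by y makes a and b into cycles.
  obtain ⟨y, hy, hya⟩ := h3 _ hmem (bdry_bdry a) ⟨-b, neg_mem hb, by rw [map_neg, hab]⟩
  obtain ⟨p, hp, hpa⟩ := h1 (a - y) (sub_mem ha (chainsOn_mono Set.inter_subset_left hy))
    (by rw [map_sub, hya, sub_self])
  obtain ⟨q, hq, hqb⟩ := h2 (b + y) (add_mem hb (chainsOn_mono Set.inter_subset_right hy))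
    (by rw [map_add, hya, hab]; simp)
  refine ⟨p + q + w, add_mem (add_mem (chainsOn_mono Set.subset_union_left hp)
    (chainsOn_mono Set.subset_union_right hq)) hw, ?_⟩
  rw [map_add, map_add, hpa, hqb]
  abel

theorem CyclesBoundOn.union {n : ℕ} {U V : Set X} (hU : IsOpen U) (hV : IsOpen V)
    (h1 : CyclesBoundOn (n + 1) U) (h2 : CyclesBoundOn (n + 1) V) (h3 : CyclesBoundOn n (U ∩ V)) :
    CyclesBoundOn (n + 1) (U ∪ V) :=
  CyclesBoundOn.union_of_injective hU hV h1 h2 fun d hd hz _ => h3 d hd hz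

/-- Chains on the union split, and the boundaries of the two parts cancel inside an empty
intersection, so each part is a cycle. Splitting is taken as a hypothesis to cover both a pair of
open sets and a pair of closed sets. -/
theorem CyclesBoundOn.union_of_disjoint {n : ℕ} {U V : Set X} (hd : Disjoint U V)
    (hs : ∀ m, chainsOn m (U ∪ V) = chainsOn m U ⊔ chainsOn m V)
    (h1 : CyclesBoundOn n U) (h2 : CyclesBoundOn n V) : CyclesBoundOn n (U ∪ V) := by
  intro c hc hz
  rw [hs] at hc
  obtain ⟨a, ha, b, hb, rfl⟩ := Submodule.mem_sup.1 hc
  rw [map_add] at hz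
  have hab : bdry a = -bdry b := eq_neg_of_add_eq_zero_left hz
  have hmem : bdry a ∈ chainsOn n (U ∩ V) := by
    rw [← chainsOn_inter]
    refine ⟨bdry_mem_chainsOn ha, ?_⟩
    rw [hab]
    exact neg_mem (bdry_mem_chainsOn hb)
  rw [hd.inter_eq, chainsOn_empty, Submodule.mem_bot] at hmem
  obtain ⟨p, hp, rfl⟩ := h1 a ha hmem
  obtain ⟨q, hq, rfl⟩ := h2 b hb (by rwa [hmem, eq_comm, neg_eq_zero] at hab)
  exact ⟨p + q, add_mem (chainsOn_mono Set.subset_union_left hp)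
    (chainsOn_mono Set.subset_union_right hq), map_add _ _ _⟩

/-! ### Relative homology of complements -/

/-- The chain `c` is homologous to a chain in `U`. -/
def NullRel {n : ℕ} (U : Set X) (c : SChain n X) : Prop :=
  ∃ w : SChain (n + 1) X, c - bdry w ∈ chainsOn n U

/-- `H_{n+1}(X, X ∖ A) = 0`. -/
def RelAcyclic (n : ℕ) (A : Set X) : Prop :=
  ∀ c : SChain (n + 1) X, bdry c ∈ chainsOn n Aᶜ → NullRel Aᶜ c

theorem NullRel.mono {n : ℕ} {U V : Set X} (h : U ⊆ V) {c : SChain n X} (hc : NullRel U c) :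
    NullRel V c :=
  hc.imp fun _ hw => chainsOn_mono h hw

/-- Relative Mayer–Vietoris: gluing of null homologies. -/
theorem NullRel.union {n : ℕ} {A B : Set X} (hA : IsClosed A) (hB : IsClosed B)
    (hAB : RelAcyclic n (A ∩ B)) {c : SChain n X} (h1 : NullRel Aᶜ c) (h2 : NullRel Bᶜ c) :
    NullRel (A ∪ B)ᶜ c := by
  obtain ⟨wA, hwA⟩ := h1
  obtain ⟨wB, hwB⟩ := h2
  have hsup : ∀ m, chainsOn m Aᶜ ⊔ chainsOn m Bᶜ ≤ chainsOn m (A ∩ B)ᶜ := fun m =>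
    sup_le (chainsOn_mono (Set.compl_subset_compl.2 Set.inter_subset_left))
      (chainsOn_mono (Set.compl_subset_compl.2 Set.inter_subset_right))
  have hmem : bdry (wA - wB) ∈ chainsOn n Aᶜ ⊔ chainsOn n Bᶜ := by
    have : bdry (wA - wB) = -(c - bdry wA) + (c - bdry wB) := by rw [map_sub]; abel
    rw [this]
    exact Submodule.add_mem_sup (neg_mem hwA) hwB
  -- The two null homologies differ by a relative cycle modulo the complement of A ∩ B, so up to a
  -- boundary the difference misses A ∩ B. It then splits into a part off A and a part off B;
  -- removing the former from `wA` adapts it to both sets.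
  obtain ⟨y, hy⟩ := hAB (wA - wB) (hsup n hmem)
  obtain ⟨a, ha, b, hb, w, -, hw⟩ := exists_eq_add_add_bdry hA.isOpen_compl hB.isOpen_compl
    (c := wA - wB - bdry y) (by rwa [← Set.compl_inter])
    (by rwa [map_sub bdry (wA - wB), bdry_bdry, sub_zero])
  have hbd : bdry wA - bdry wB = bdry a + bdry b := by
    have := congrArg bdry hw
    simpa only [map_sub, map_add, bdry_bdry, sub_zero, add_zero] using this
  refine ⟨wA - a, ?_⟩
  rw [Set.compl_union, ← chainsOn_inter]
  constructor
  · have : c - bdry (wA - a) = c - bdry wA + bdry a := by rw [map_sub]; abel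
    rw [this]
    exact add_mem hwA (bdry_mem_chainsOn ha)
  · have : c - bdry (wA - a) = c - bdry wB - bdry b := by
      rw [map_sub, ← sub_eq_zero]
      rw [← sub_eq_zero] at hbd
      rw [← neg_eq_zero, ← hbd]
      abel
    rw [this]
    exact sub_mem hwB (bdry_mem_chainsOn hb)

/-- Relative Mayer–Vietoris: the intersection is needed one degree higher, since there the two null
homologies are compared. -/
theorem RelAcyclic.union {n : ℕ} {A B : Set X} (hA : IsClosed A) (hB : IsClosed B)
    (h1 : RelAcyclic n A) (h2 : RelAcyclic n B) (h3 : RelAcyclic (n + 1) (A ∩ B)) :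
    RelAcyclic n (A ∪ B) := fun c hc =>
  NullRel.union hA hB h3
    (h1 c (chainsOn_mono (Set.compl_subset_compl.2 Set.subset_union_left) hc))
    (h2 c (chainsOn_mono (Set.compl_subset_compl.2 Set.subset_union_right) hc))

theorem relAcyclic_empty (n : ℕ) : RelAcyclic n (∅ : Set X) := fun c _ =>
  ⟨0, by rw [Set.compl_empty]; exact mem_chainsOn_univ _⟩

/-- The intersection of A with the rest of the list is the union of another list from the same
family, of the same length as the rest. Hence the induction is on length, and it treats all degrees
from k upwards because the intersection enters with its degree raised. -/
theorem RelAcyclic.biUnion_list {k : ℕ} {𝒞 : Set (Set X)} (hcl : ∀ A ∈ 𝒞, IsClosed A)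
    (hint : ∀ A ∈ 𝒞, ∀ B ∈ 𝒞, A ∩ B ∈ 𝒞) (hac : ∀ A ∈ 𝒞, ∀ n ≥ k, RelAcyclic n A)
    (l : List (Set X)) (hl : ∀ A ∈ l, A ∈ 𝒞) :
    IsClosed (⋃ A ∈ l, A) ∧ ∀ n ≥ k, RelAcyclic n (⋃ A ∈ l, A) := by
  induction hlen : l.length generalizing l with
  | zero =>
    rw [List.length_eq_zero_iff] at hlen
    subst hlen
    simpa using fun n _ => relAcyclic_empty n
  | succ m ih =>
    obtain _ | ⟨A, l⟩ := l
    · simp at hlen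
    have hA := hl A (by simp)
    have hl' : ∀ B ∈ l, B ∈ 𝒞 := fun B hB => hl B (by simp [hB])
    have hlen' : l.length = m := by simpa using hlen
    obtain ⟨hc, hr⟩ := ih l hl' hlen'
    obtain ⟨-, hr'⟩ := ih (l.map (A ∩ ·)) (by
      intro B hB
      obtain ⟨C, hC, rfl⟩ := List.mem_map.1 hB
      exact hint _ hA _ (hl' C hC)) (by simpa using hlen')
    have hinter : (⋃ B ∈ l.map (A ∩ ·), B) = A ∩ ⋃ B ∈ l, B := by
      ext x
      simp
    rw [hinter] at hr'
    have hun : (⋃ B ∈ A :: l, B) = A ∪ ⋃ B ∈ l, B := by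
      ext x
      simp
    rw [hun]
    exact ⟨(hcl A hA).union hc, fun n hn => RelAcyclic.union (hcl A hA) hc (hac A hA n hn) (hr n hn)
      (hr' (n + 1) (Nat.le_succ_of_le hn))⟩

theorem NullRel.biUnion_list {k : ℕ} {𝒞 : Set (Set X)} (hcl : ∀ A ∈ 𝒞, IsClosed A)
    (hint : ∀ A ∈ 𝒞, ∀ B ∈ 𝒞, A ∩ B ∈ 𝒞) (hac : ∀ A ∈ 𝒞, ∀ n ≥ k, RelAcyclic n A)
    (l : List (Set X)) (hl : ∀ A ∈ l, A ∈ 𝒞) {n : ℕ} (hn : k ≤ n) {c : SChain n X}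
    (hc : ∀ A ∈ l, NullRel Aᶜ c) : NullRel (⋃ A ∈ l, A)ᶜ c := by
  induction l with
  | nil => exact ⟨0, by simpa using mem_chainsOn_univ c⟩
  | cons A l ih =>
    have hA := hl A (by simp)
    have hl' : ∀ B ∈ l, B ∈ 𝒞 := fun B hB => hl B (by simp [hB])
    have hun : (⋃ B ∈ A :: l, B) = A ∪ ⋃ B ∈ l, B := by
      ext x
      simp
    have hinter : (⋃ B ∈ l.map (A ∩ ·), B) = A ∩ ⋃ B ∈ l, B := by
      ext x
      simp
    rw [hun]
    refine NullRel.union (hcl A hA) (RelAcyclic.biUnion_list hcl hint hac l hl').1 ?_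
      (hc A (by simp)) (ih hl' fun B hB => hc B (by simp [hB]))
    rw [← hinter]
    refine (RelAcyclic.biUnion_list hcl hint hac _ ?_).2 n hn
    intro B hB
    obtain ⟨C, hC, rfl⟩ := List.mem_map.1 hB
    exact hint _ hA _ (hl' C hC)

/-- Excision: a relative cycle is homologous to one in an open embedded subspace. -/
theorem exists_push_excision {f : Y → X} (hf : IsOpenEmbedding f) {n : ℕ} {A : Set Y}
    (hA : IsClosed (f '' A)) {c : SChain (n + 1) X} (hc : bdry c ∈ chainsOn n (f '' A)ᶜ) :
    ∃ c' : SChain (n + 1) Y, bdry c' ∈ chainsOn n Aᶜ ∧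
      NullRel (f '' A)ᶜ (c - push ⟨f, hf.continuous⟩ c') := by
  have hcov : Set.range f ∪ (f '' A)ᶜ = Set.univ :=
    Set.compl_subset_iff_union.1 (Set.compl_subset_compl.2 (Set.image_subset_range f A))
  obtain ⟨a, ha, b, hb, w, -, rfl⟩ := exists_eq_add_add_bdry hf.isOpen_range hA.isOpen_compl
    (c := c) (by rw [hcov]; exact mem_chainsOn_univ c) (Submodule.mem_sup_right hc)
  rw [← Set.image_univ] at ha
  obtain ⟨c', -, rfl⟩ := exists_push_eq hf.isEmbedding ha
  refine ⟨c', ?_, w, ?_⟩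
  · have h1 : push ⟨f, hf.continuous⟩ (bdry c') ∈ chainsOn n (f '' A)ᶜ := by
      rw [map_add, map_add, bdry_bdry, add_zero] at hc
      rw [push_bdry]
      exact (add_mem_cancel_right (bdry_mem_chainsOn hb)).1 hc
    have h2 : push ⟨f, hf.continuous⟩ (bdry c') ∈ chainsOn n (f '' Set.univ) :=
      push_mem_chainsOn (Set.mapsTo_image f _) (mem_chainsOn_univ _)
    have h3 : push ⟨f, hf.continuous⟩ (bdry c') ∈ chainsOn n (f '' Aᶜ) := by
      refine chainsOn_mono ?_ ((chainsOn_inter _ _).le ⟨h1, h2⟩)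
      rintro _ ⟨hx, y, -, rfl⟩
      exact ⟨y, fun hy => hx ⟨y, hy, rfl⟩, rfl⟩
    obtain ⟨d, hd, hdc⟩ := exists_push_eq hf.isEmbedding h3
    rwa [← push_injective (f := ⟨f, hf.continuous⟩) hf.injective hdc]
  · have : push ⟨f, hf.continuous⟩ c' + b + bdry w - push ⟨f, hf.continuous⟩ c' - bdry w = b := by
      abel
    rwa [this]

theorem NullRel.push {f : C(Y, X)} {n : ℕ} {U : Set Y} {V : Set X} (h : Set.MapsTo f U V)
    {c : SChain n Y} (hc : NullRel U c) : NullRel V (push f c) := by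
  obtain ⟨w, hw⟩ := hc
  refine ⟨_root_.push f w, ?_⟩
  rw [← push_bdry, ← map_sub]
  exact push_mem_chainsOn h hw

theorem NullRel.add {n : ℕ} {U : Set X} {c d : SChain n X} (hc : NullRel U c) (hd : NullRel U d) :
    NullRel U (c + d) := by
  obtain ⟨w, hw⟩ := hc
  obtain ⟨v, hv⟩ := hd
  refine ⟨w + v, ?_⟩
  rw [map_add, add_sub_add_comm]
  exact add_mem hw hv

theorem NullRel.neg {n : ℕ} {U : Set X} {c : SChain n X} (hc : NullRel U c) : NullRel U (-c) := by
  obtain ⟨w, hw⟩ := hc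
  refine ⟨-w, ?_⟩
  rw [map_neg, neg_sub_neg, ← neg_sub]
  exact neg_mem hw

theorem RelAcyclic.image {f : Y → X} (hf : IsOpenEmbedding f) {n : ℕ} {A : Set Y}
    (hA : IsClosed (f '' A)) (h : RelAcyclic n A) : RelAcyclic n (f '' A) := by
  intro c hc
  obtain ⟨c', hc', hn⟩ := exists_push_excision hf hA hc
  have := hn.add ((h c' hc').push (f := ⟨f, hf.continuous⟩)
    (Set.mapsTo_iff_image_subset.2 (Set.image_compl_subset hf.injective)))
  rwa [sub_add_cancel] at this

/-- Excision is injective. -/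
theorem NullRel.of_push {f : Y → X} (hf : IsOpenEmbedding f) {n : ℕ} {A : Set Y}
    (hA : IsClosed (f '' A)) {c : SChain n Y}
    (hc : NullRel (f '' A)ᶜ (_root_.push ⟨f, hf.continuous⟩ c)) : NullRel Aᶜ c := by
  obtain ⟨y, hy⟩ := hc
  have hcov : Set.range f ∪ (f '' A)ᶜ = Set.univ :=
    Set.compl_subset_iff_union.1 (Set.compl_subset_compl.2 (Set.image_subset_range f A))
  have hpc : _root_.push ⟨f, hf.continuous⟩ c ∈ chainsOn n (Set.range f) := by
    rw [← Set.image_univ]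
    exact push_mem_chainsOn (Set.mapsTo_image f _) (mem_chainsOn_univ c)
  obtain ⟨a, ha, b, hb, w, -, rfl⟩ := exists_eq_add_add_bdry hf.isOpen_range hA.isOpen_compl
    (c := y) (by rw [hcov]; exact mem_chainsOn_univ _) (by
      rw [← sub_sub_cancel (_root_.push ⟨f, hf.continuous⟩ c) (bdry y)]
      exact sub_mem (Submodule.mem_sup_left hpc) (Submodule.mem_sup_right hy))
  rw [map_add, map_add, bdry_bdry, add_zero, ← sub_sub] at hy
  have h1 : _root_.push ⟨f, hf.continuous⟩ c - bdry a ∈ chainsOn n (f '' A)ᶜ := by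
    have := add_mem hy (bdry_mem_chainsOn hb)
    rwa [sub_add_cancel] at this
  have h2 := sub_mem hpc (bdry_mem_chainsOn ha)
  rw [← Set.image_univ] at ha
  obtain ⟨a', -, rfl⟩ := exists_push_eq hf.isEmbedding ha
  refine ⟨a', ?_⟩
  have h3 : _root_.push ⟨f, hf.continuous⟩ (c - bdry a') ∈ chainsOn n (f '' Aᶜ) := by
    rw [map_sub, push_bdry]
    refine chainsOn_mono ?_ ((chainsOn_inter _ _).le ⟨h1, h2⟩)
    rintro _ ⟨hx, y, rfl⟩
    exact ⟨y, fun hy => hx ⟨y, hy, rfl⟩, rfl⟩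
  obtain ⟨d, hd, hdc⟩ := exists_push_eq hf.isEmbedding h3
  rwa [← push_injective (f := ⟨f, hf.continuous⟩) hf.injective hdc]

end Vanishing

/-! ### Homology of complements in the plane -/

section Plane

/-- A map r from V to U that is a left homotopy inverse of the inclusion makes H(U) → H(V)
injective. -/
theorem exists_bdry_eq_of_subset {X : Type*} [TopologicalSpace X] {U V : Set X} (h : U ⊆ V)
    (r : C(V, U))
    (hr : (r.comp ⟨Set.inclusion h, continuous_inclusion h⟩).Homotopic (ContinuousMap.id U))
    {n : ℕ} {c : SChain (n + 1) X} (hc : c ∈ chainsOn (n + 1) U) (hz : bdry c = 0)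
    (hb : ∃ w ∈ chainsOn (n + 2) V, bdry w = c) : ∃ w ∈ chainsOn (n + 2) U, bdry w = c := by
  have hinj {W : Set X} {n : ℕ} := push_injective (n := n) (f := ⟨(Subtype.val : W → X),
    continuous_subtype_val⟩) Subtype.val_injective
  have himage : ∀ W : Set X, (Subtype.val : W → X) '' Set.univ = W := by simp
  rw [← himage U] at hc
  obtain ⟨c, -, rfl⟩ := exists_push_eq IsEmbedding.subtypeVal hc
  obtain ⟨w, hw, hwc⟩ := hb
  rw [← himage V] at hw
  obtain ⟨w, -, rfl⟩ := exists_push_eq IsEmbedding.subtypeVal hw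
  obtain ⟨v, hv⟩ := exists_bdry_eq_of_leftInverse hr (c := c)
    (hinj (by rw [push_bdry, hz, map_zero])) ⟨w, hinj (by
      rw [push_bdry, hwc, push_push]; rfl)⟩
  refine ⟨push ⟨Subtype.val, continuous_subtype_val⟩ v,
    push_mem_chainsOn (U := Set.univ) (fun x _ => x.2) (mem_chainsOn_univ v), ?_⟩
  rw [← push_bdry, hv]

theorem Convex.cyclesBoundOn {E : Type*} [AddCommGroup E] [Module ℝ E] [TopologicalSpace E]
    [ContinuousAdd E] [ContinuousSMul ℝ E] {s : Set E} (hs : Convex ℝ s) (hne : s.Nonempty)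
    (n : ℕ) : CyclesBoundOn n s :=
  have := hs.contractibleSpace hne
  cyclesBoundOn_iff.2 (cyclesBound_of_contractible n)

theorem cyclesBound_complex (n : ℕ) : CyclesBound n ℂ := cyclesBound_of_contractible n

/-- The punctured plane is the union of the slit plane and its negative, both star-shaped, and these
meet in two open half-planes. Mayer–Vietoris leaves no homology in degrees n + 2 ≥ 2, since the
half-planes have none in degree n + 1 ≥ 1. -/
theorem cyclesBoundOn_compl_zero (n : ℕ) : CyclesBoundOn (n + 1) ({0}ᶜ : Set ℂ) := by
  let V : Set ℂ := Homeomorph.neg ℂ '' Complex.slitPlane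
  have hVmem : ∀ z, z ∈ V ↔ -z ∈ Complex.slitPlane := fun z => by
    simp [V]
  have hU : ∀ n, CyclesBoundOn n Complex.slitPlane := fun n =>
    have := Complex.starConvex_one_slitPlane.contractibleSpace ⟨1, Complex.one_mem_slitPlane⟩
    cyclesBoundOn_iff.2 (cyclesBound_of_contractible n)
  have hV : ∀ n, CyclesBoundOn n V := fun n =>
    (cyclesBoundOn_image (Homeomorph.neg ℂ).isEmbedding).2 (hU n)
  have hVo : IsOpen V := (Homeomorph.neg ℂ).isOpenMap _ Complex.isOpen_slitPlane
  have hunion : ({0}ᶜ : Set ℂ) = Complex.slitPlane ∪ V := by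
    ext z
    rw [Set.mem_union, hVmem, Complex.mem_slitPlane_iff, Complex.mem_slitPlane_iff,
      Set.mem_compl_singleton_iff, ne_eq, Complex.ext_iff]
    simp only [Complex.zero_re, Complex.zero_im, Complex.neg_re, Complex.neg_im]
    grind
  have hinter : Complex.slitPlane ∩ V = {z : ℂ | 0 < z.im} ∪ {z : ℂ | z.im < 0} := by
    ext z
    rw [Set.mem_inter_iff, hVmem, Complex.mem_slitPlane_iff, Complex.mem_slitPlane_iff]
    simp only [Complex.neg_re, Complex.neg_im, Set.mem_union, Set.mem_ofPred_eq]
    grind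
  rw [hunion]
  refine CyclesBoundOn.union Complex.isOpen_slitPlane hVo (hU _) (hV _) ?_
  rw [hinter]
  have hd : Disjoint {z : ℂ | 0 < z.im} {z : ℂ | z.im < 0} :=
    Set.disjoint_left.2 fun z (h : 0 < z.im) (h' : z.im < 0) => lt_asymm h h'
  exact CyclesBoundOn.union_of_disjoint hd
    (fun m => chainsOn_union_of_isOpen (isOpen_lt continuous_const Complex.continuous_im)
      (isOpen_lt Complex.continuous_im continuous_const) hd)
    ((convex_halfSpace_im_gt 0).cyclesBoundOn ⟨Complex.I, by simp⟩ n)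
    ((convex_halfSpace_im_lt 0).cyclesBoundOn ⟨-Complex.I, by simp⟩ n)

theorem cyclesBoundOn_compl_singleton (n : ℕ) (x : ℂ) : CyclesBoundOn (n + 1) ({x}ᶜ : Set ℂ) := by
  have : ({x}ᶜ : Set ℂ) = Homeomorph.addRight x '' {0}ᶜ := by
    rw [Set.image_compl_eq (Homeomorph.addRight x).bijective]
    simp
  rw [this]
  exact (cyclesBoundOn_image (Homeomorph.addRight x).isEmbedding).2 (cyclesBoundOn_compl_zero n)

/-- A cycle outside a compact convex set bounds there if it bounds outside one point of the set. -/
theorem exists_bdry_eq_compl_convex {A : Set ℂ} (hA : Convex ℝ A) (hAc : IsCompact A) {x : ℂ}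
    (hx : x ∈ A) {n : ℕ} {c : SChain (n + 1) ℂ} (hc : c ∈ chainsOn (n + 1) Aᶜ) (hz : bdry c = 0)
    (hb : ∃ w ∈ chainsOn (n + 2) {x}ᶜ, bdry w = c) : ∃ w ∈ chainsOn (n + 2) Aᶜ, bdry w = c := by
  obtain ⟨R, hR0, hR⟩ := hAc.isBounded.subset_closedBall_lt 0 x
  have hsub : Aᶜ ⊆ {x}ᶜ := Set.compl_subset_compl.2 (Set.singleton_subset_iff.2 hx)
  have hne : ∀ y : ({x}ᶜ : Set ℂ), ‖(y : ℂ) - x‖ ≠ 0 := fun y => by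
    rw [norm_ne_zero_iff, sub_ne_zero]
    exact y.2
  -- The homotopy pushes y radially away from x by the distance t * R. At time 1 every point is
  -- further than R from x, hence outside A.
  let g : ({x}ᶜ : Set ℂ) → ℝ → ℂ := fun y t => x + (1 + t * R / ‖(y : ℂ) - x‖) • ((y : ℂ) - x)
  have hg : Continuous fun p : ({x}ᶜ : Set ℂ) × ℝ => g p.1 p.2 := by
    have : Continuous fun p : ({x}ᶜ : Set ℂ) × ℝ => ‖(p.1 : ℂ) - x‖ := by fun_prop
    have h2 : Continuous fun p : ({x}ᶜ : Set ℂ) × ℝ => p.2 * R / ‖(p.1 : ℂ) - x‖ :=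
      Continuous.div (by fun_prop) this fun p => hne p.1
    exact continuous_const.add ((continuous_const.add h2).smul (by fun_prop))
  have hg1 : ∀ y, g y 1 ∉ A := fun y hy => by
    have h1 := mem_closedBall_iff_norm.1 (hR hy)
    have hpos : 0 < ‖(y : ℂ) - x‖ := lt_of_le_of_ne (norm_nonneg _) (hne y).symm
    have h2 : ‖g y 1 - x‖ = ‖(y : ℂ) - x‖ + R := by
      simp only [g, add_sub_cancel_left, norm_smul]
      rw [Real.norm_of_nonneg (by positivity)]
      field_simp
    linarith
  have hgA : ∀ y : ({x}ᶜ : Set ℂ), (y : ℂ) ∉ A → ∀ t : ℝ, 0 ≤ t → g y t ∉ A := by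
    intro y hy t ht hgy
    apply hy
    set s : ℝ := 1 + t * R / ‖(y : ℂ) - x‖ with hs
    have hs1 : 1 ≤ s := by
      rw [hs]
      have : 0 ≤ t * R / ‖(y : ℂ) - x‖ := by positivity
      linarith
    -- The point y lies on the segment from x to its image, so by convexity an image in A would
    -- force y into A.
    have h3 : (y : ℂ) = (1 - s⁻¹) • x + s⁻¹ • g y t := by
      simp only [g, ← hs, smul_add, smul_smul, inv_mul_cancel₀ (by positivity : s ≠ 0), one_smul,
        sub_smul]
      abel
    rw [h3]
    exact hA hx hgy (by rw [sub_nonneg]; exact inv_le_one_of_one_le₀ hs1) (by positivity) (by ring)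
  let r : C(({x}ᶜ : Set ℂ), (Aᶜ : Set ℂ)) :=
    ⟨fun y => ⟨g y 1, hg1 y⟩, (hg.comp (by fun_prop : Continuous fun y => (y, (1 : ℝ)))).subtype_mk _⟩
  refine exists_bdry_eq_of_subset hsub r (ContinuousMap.Homotopic.symm ⟨?_⟩) hc hz hb
  exact
    { toFun := fun p => ⟨g (Set.inclusion hsub p.2) p.1, hgA (Set.inclusion hsub p.2) p.2.2 _ p.1.2.1⟩
      continuous_toFun := (hg.comp (((continuous_inclusion hsub).comp continuous_snd).prodMk
        (continuous_subtype_val.comp continuous_fst))).subtype_mk _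
      map_zero_left := fun y => by ext; simp [g]
      map_one_left := fun y => rfl }

theorem cyclesBoundOn_compl_convex {A : Set ℂ} (hA : Convex ℝ A) (hAc : IsCompact A) (n : ℕ) :
    CyclesBoundOn (n + 1) Aᶜ := by
  rcases A.eq_empty_or_nonempty with rfl | ⟨x, hx⟩
  · rw [Set.compl_empty, cyclesBoundOn_univ]
    exact cyclesBound_complex _
  · intro c hc hz
    refine exists_bdry_eq_compl_convex hA hAc hx hc hz (cyclesBoundOn_compl_singleton n x c ?_ hz)
    exact chainsOn_mono (Set.compl_subset_compl.2 (Set.singleton_subset_iff.2 hx)) hc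

/-- As the plane is contractible, H_{n+1} of the plane modulo the complement of A is H_n of that
complement, which vanishes for n ≥ 2. -/
theorem relAcyclic_convex {A : Set ℂ} (hA : Convex ℝ A) (hAc : IsCompact A) {n : ℕ} (hn : 2 ≤ n) :
    RelAcyclic n A := by
  obtain ⟨n, rfl⟩ := Nat.exists_eq_add_of_le' hn
  intro c hc
  obtain ⟨d, hd, hdc⟩ := cyclesBoundOn_compl_convex hA hAc n _ hc (bdry_bdry c)
  obtain ⟨w, hw⟩ := cyclesBound_complex (n + 2) (c - d) (by rw [map_sub, hdc, sub_self])
  exact ⟨w, by rw [hw, sub_sub_cancel]; exact hd⟩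

/-- A relative cycle modulo the complement of a compact convex set is detected at one point. -/
theorem nullRel_convex {A : Set ℂ} (hA : Convex ℝ A) (hAc : IsCompact A) {x : ℂ} (hx : x ∈ A)
    {n : ℕ} {c : SChain (n + 2) ℂ} (hc : bdry c ∈ chainsOn (n + 1) Aᶜ) (h : NullRel {x}ᶜ c) :
    NullRel Aᶜ c := by
  obtain ⟨w, hw⟩ := h
  obtain ⟨d, hd, hdc⟩ := exists_bdry_eq_compl_convex hA hAc hx hc (bdry_bdry c)
    ⟨_, hw, by rw [map_sub, bdry_bdry, sub_zero]⟩
  obtain ⟨w, hw⟩ := cyclesBound_complex (n + 1) (c - d) (by rw [map_sub, hdc, sub_self])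
  exact ⟨w, by rw [hw, sub_sub_cancel]; exact hd⟩

end Plane

/-! ### Homology of surfaces -/

section Surface

variable {X : Type*} [TopologicalSpace X]

theorem inter_mem_image_convex {f : ℂ → X} (hf : IsOpenEmbedding f) :
    ∀ A ∈ (f '' ·) '' {B | Convex ℝ B ∧ IsCompact B},
      ∀ A' ∈ (f '' ·) '' {B | Convex ℝ B ∧ IsCompact B},
        A ∩ A' ∈ (f '' ·) '' {B | Convex ℝ B ∧ IsCompact B} := by
  rintro _ ⟨B, hB, rfl⟩ _ ⟨C, hC, rfl⟩
  exact ⟨B ∩ C, ⟨hB.1.inter hC.1, hB.2.inter hC.2⟩, Set.image_inter hf.injective⟩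

/-- The compact subsets of plane charts. -/
def chartCompacts (X : Type*) [TopologicalSpace X] : Set (Set X) :=
  {A | ∃ f : ℂ → X, IsOpenEmbedding f ∧ ∃ B, IsCompact B ∧ A = f '' B}

theorem inter_mem_chartCompacts {A : Set X} (hA : A ∈ chartCompacts X) {A' : Set X}
    (hA' : IsClosed A') : A ∩ A' ∈ chartCompacts X := by
  obtain ⟨f, hf, B, hB, rfl⟩ := hA
  exact ⟨f, hf, B ∩ f ⁻¹' A', hB.inter_right (hA'.preimage hf.continuous),
    (Set.image_inter_preimage f B A').symm⟩

theorem exists_chartCompact_mem_nhds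
    (hX : ∀ x : X, ∃ f : ℂ → X, IsOpenEmbedding f ∧ x ∈ Set.range f)
    (x : X) : ∃ A ∈ chartCompacts X, A ∈ 𝓝 x := by
  obtain ⟨f, hf, y, rfl⟩ := hX x
  exact ⟨_, ⟨f, hf, Metric.closedBall y 1, isCompact_closedBall _ _, rfl⟩,
    hf.isOpenMap.image_mem_nhds (Metric.closedBall_mem_nhds y one_pos)⟩

variable [T2Space X]

/-- In a chart, a relative cycle modulo the complement of a compact convex set is detected at one
point. -/
theorem nullRel_image_convex {f : ℂ → X} (hf : IsOpenEmbedding f) {A : Set ℂ} (hA : Convex ℝ A)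
    (hAc : IsCompact A) {x : ℂ} (hx : x ∈ A) {n : ℕ} {c : SChain (n + 2) X}
    (hc : bdry c ∈ chainsOn (n + 1) (f '' A)ᶜ) (h : NullRel {f x}ᶜ c) : NullRel (f '' A)ᶜ c := by
  obtain ⟨c', hc', hn⟩ := exists_push_excision hf (hAc.image hf.continuous).isClosed hc
  have hsub : (f '' A)ᶜ ⊆ {f x}ᶜ :=
    Set.compl_subset_compl.2 (Set.singleton_subset_iff.2 ⟨x, hx, rfl⟩)
  have h1 := (hn.mono hsub).neg.add h
  rw [neg_sub, sub_add_cancel, ← Set.image_singleton] at h1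
  have h2 := NullRel.of_push hf (isCompact_singleton.image hf.continuous).isClosed h1
  have h3 := (nullRel_convex hA hAc hx hc' h2).push (f := ⟨f, hf.continuous⟩)
    (Set.mapsTo_iff_image_subset.2 (Set.image_compl_subset hf.injective))
  have h4 := hn.add h3
  rwa [sub_add_cancel] at h4

/-- A compact set in an open set of the plane is covered by finitely many compact convex sets that
meet it and lie in the open set. -/
theorem exists_convex_cover {A O : Set ℂ} (hA : IsCompact A) (hO : IsOpen O) (hAO : A ⊆ O) :
    ∃ l : List (Set ℂ), (∀ B ∈ l, Convex ℝ B ∧ IsCompact B ∧ (A ∩ B).Nonempty ∧ B ⊆ O) ∧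
      A ⊆ ⋃ B ∈ l, B := by
  have : ∀ x ∈ A, ∃ ε > 0, Metric.closedBall x ε ⊆ O := fun x hx =>
    Metric.nhds_basis_closedBall.mem_iff.1 (hO.mem_nhds (hAO hx))
  choose! ε hε hεO using this
  obtain ⟨t, htA, ht⟩ := hA.elim_nhds_subcover (fun x => Metric.closedBall x (ε x))
    fun x hx => Metric.closedBall_mem_nhds x (hε x hx)
  refine ⟨t.toList.map fun x => Metric.closedBall x (ε x), ?_, ?_⟩
  · intro B hB
    obtain ⟨x, hx, rfl⟩ := List.mem_map.1 hB
    have hxA := htA x (Finset.mem_toList.1 hx)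
    exact ⟨convex_closedBall _ _, isCompact_closedBall _ _,
      ⟨x, hxA, Metric.mem_closedBall_self (hε x hxA).le⟩, hεO x hxA⟩
  · refine ht.trans fun y hy => ?_
    simpa using hy

/-- The images of compact convex sets in a chart. -/
theorem exists_good_cover {f : ℂ → X} (hf : IsOpenEmbedding f) {A : Set ℂ} (hA : IsCompact A)
    {n : ℕ} {d : SChain n X} (hd : d ∈ chainsOn n (f '' A)ᶜ) :
    ∃ l : List (Set X), (∀ B ∈ l, B ∈ (f '' ·) '' {B | Convex ℝ B ∧ IsCompact B}) ∧
      (∀ B ∈ l, (f '' A ∩ B).Nonempty) ∧ f '' A ⊆ (⋃ B ∈ l, B) ∧ d ∈ chainsOn n (⋃ B ∈ l, B)ᶜ := by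
  -- The chain d has compact support T missing the image of A; choosing the convex sets inside the
  -- preimage of the complement of T keeps d off their images.
  obtain ⟨T, hT, hTc, hdT⟩ := exists_isCompact_mem_chainsOn hd
  obtain ⟨l, hl, hAl⟩ := exists_convex_cover hA (hTc.isClosed.isOpen_compl.preimage hf.continuous)
    (fun x hx hxT => hT hxT ⟨x, hx, rfl⟩)
  refine ⟨l.map (f '' ·), ?_, ?_, ?_, ?_⟩
  · intro B hB
    obtain ⟨C, hC, rfl⟩ := List.mem_map.1 hB
    exact ⟨C, ⟨(hl C hC).1, (hl C hC).2.1⟩, rfl⟩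
  · intro B hB
    obtain ⟨C, hC, rfl⟩ := List.mem_map.1 hB
    obtain ⟨x, hxA, hxC⟩ := (hl C hC).2.2.1
    exact ⟨f x, ⟨x, hxA, rfl⟩, ⟨x, hxC, rfl⟩⟩
  · rintro _ ⟨x, hx, rfl⟩
    obtain ⟨C, hC, hxC⟩ := Set.mem_iUnion₂.1 (hAl hx)
    exact Set.mem_iUnion₂.2 ⟨f '' C, List.mem_map_of_mem hC, x, hxC, rfl⟩
  · refine chainsOn_mono (fun y hy hyB => ?_) hdT
    obtain ⟨B, hB, hyB⟩ := Set.mem_iUnion₂.1 hyB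
    obtain ⟨C, hC, rfl⟩ := List.mem_map.1 hB
    obtain ⟨x, hx, rfl⟩ := hyB
    exact (hl C hC).2.2.2 hx hy

theorem isClosed_of_mem_image_convex {f : ℂ → X} (hf : IsOpenEmbedding f) :
    ∀ A ∈ (f '' ·) '' {B | Convex ℝ B ∧ IsCompact B}, IsClosed A := by
  rintro _ ⟨B, hB, rfl⟩
  exact (hB.2.image hf.continuous).isClosed

theorem relAcyclic_of_mem_image_convex {f : ℂ → X} (hf : IsOpenEmbedding f) :
    ∀ A ∈ (f '' ·) '' {B | Convex ℝ B ∧ IsCompact B}, ∀ n ≥ 2, RelAcyclic n A := by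
  rintro _ ⟨B, hB, rfl⟩ n hn
  exact (relAcyclic_convex hB.1 hB.2 hn).image hf (hB.2.image hf.continuous).isClosed

/-- The boundary of a relative cycle misses not only the image of A but a finite union of images of
convex sets covering it. The cycle is null relative to that larger union, hence relative to the
image of A. -/
theorem relAcyclic_image {f : ℂ → X} (hf : IsOpenEmbedding f) {A : Set ℂ} (hA : IsCompact A)
    {n : ℕ} (hn : 2 ≤ n) : RelAcyclic n (f '' A) := by
  intro c hc
  obtain ⟨l, hl, -, hAl, hcl⟩ := exists_good_cover hf hA hc
  exact ((RelAcyclic.biUnion_list (isClosed_of_mem_image_convex hf) (inter_mem_image_convex hf)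
    (relAcyclic_of_mem_image_convex hf) l hl).2 n hn c hcl).mono (Set.compl_subset_compl.2 hAl)

/-- Each convex set of the cover meets A, and local triviality at one of its points spreads over it
by `nullRel_image_convex`. The pieces glue because the relative H_3 of their intersections vanishes.
-/
theorem nullRel_image {f : ℂ → X} (hf : IsOpenEmbedding f) {A : Set ℂ} (hA : IsCompact A)
    {c : SChain 2 X} (hc : bdry c ∈ chainsOn 1 (f '' A)ᶜ)
    (h : ∀ x ∈ f '' A, NullRel {x}ᶜ c) : NullRel (f '' A)ᶜ c := by
  obtain ⟨l, hl, hlA, hAl, hcl⟩ := exists_good_cover hf hA hc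
  refine (NullRel.biUnion_list (isClosed_of_mem_image_convex hf) (inter_mem_image_convex hf)
    (relAcyclic_of_mem_image_convex hf) l hl le_rfl fun B hB => ?_).mono
    (Set.compl_subset_compl.2 hAl)
  obtain ⟨y, hyA, hyB⟩ := hlA B hB
  have hyB' := hyB
  have hsub : (⋃ B ∈ l, B)ᶜ ⊆ Bᶜ :=
    Set.compl_subset_compl.2 (Set.subset_biUnion_of_mem (u := fun B => B) hB)
  obtain ⟨C, hC, rfl⟩ := hl B hB
  obtain ⟨x, hx, rfl⟩ := hyB
  exact nullRel_image_convex hf hC.1 hC.2 hx (chainsOn_mono hsub hcl) (h _ hyA)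

theorem isClosed_of_mem_chartCompacts : ∀ A ∈ chartCompacts X, IsClosed A := by
  rintro _ ⟨f, hf, B, hB, rfl⟩
  exact (hB.image hf.continuous).isClosed

theorem relAcyclic_of_mem_chartCompacts : ∀ A ∈ chartCompacts X, ∀ n ≥ 2, RelAcyclic n A := by
  rintro _ ⟨f, hf, B, hB, rfl⟩ n hn
  exact relAcyclic_image hf hB hn

theorem exists_chartCompacts_cover
    (hX : ∀ x : X, ∃ f : ℂ → X, IsOpenEmbedding f ∧ x ∈ Set.range f)
    {A : Set X} (hA : IsCompact A) :
    ∃ l : List (Set X), (∀ B ∈ l, B ∈ chartCompacts X) ∧ (⋃ B ∈ l, B) = A := by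
  choose N hN hNx using exists_chartCompact_mem_nhds hX
  obtain ⟨t, -, ht⟩ := hA.elim_nhds_subcover N fun x _ => hNx x
  refine ⟨t.toList.map fun x => N x ∩ A, ?_, ?_⟩
  · intro B hB
    obtain ⟨x, -, rfl⟩ := List.mem_map.1 hB
    exact inter_mem_chartCompacts (hN x) hA.isClosed
  · ext y
    simp only [List.mem_map, Finset.mem_toList, Set.mem_iUnion, exists_prop]
    constructor
    · rintro ⟨_, ⟨x, -, rfl⟩, hy⟩
      exact hy.2
    · intro hy
      obtain ⟨x, hx, hyx⟩ := Set.mem_iUnion₂.1 (ht hy)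
      exact ⟨_, ⟨x, hx, rfl⟩, hyx, hy⟩

/-- A compact set is a finite union of compact sets in charts, a family closed under intersection.
-/
theorem relAcyclic_isCompact
    (hX : ∀ x : X, ∃ f : ℂ → X, IsOpenEmbedding f ∧ x ∈ Set.range f)
    {A : Set X} (hA : IsCompact A) {n : ℕ} (hn : 2 ≤ n) :
    RelAcyclic n A := by
  obtain ⟨l, hl, rfl⟩ := exists_chartCompacts_cover hX hA
  exact (RelAcyclic.biUnion_list isClosed_of_mem_chartCompacts
    (fun A hA B hB => inter_mem_chartCompacts hA (isClosed_of_mem_chartCompacts B hB))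
    relAcyclic_of_mem_chartCompacts l hl).2 n hn

/-- A relative class of top degree is determined by its restrictions to points. -/
theorem nullRel_isCompact
    (hX : ∀ x : X, ∃ f : ℂ → X, IsOpenEmbedding f ∧ x ∈ Set.range f)
    {A : Set X} (hA : IsCompact A) {c : SChain 2 X}
    (hc : bdry c ∈ chainsOn 1 Aᶜ) (h : ∀ x ∈ A, NullRel {x}ᶜ c) : NullRel Aᶜ c := by
  obtain ⟨l, hl, rfl⟩ := exists_chartCompacts_cover hX hA
  refine NullRel.biUnion_list isClosed_of_mem_chartCompacts
    (fun A hA B hB => inter_mem_chartCompacts hA (isClosed_of_mem_chartCompacts B hB))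
    relAcyclic_of_mem_chartCompacts l hl le_rfl fun B hB => ?_
  have hBl : B ⊆ ⋃ B ∈ l, B := fun x hx => Set.mem_iUnion₂.2 ⟨B, hB, hx⟩
  obtain ⟨f, hf, B, hB', rfl⟩ := hl B hB
  exact nullRel_image hf hB' (chainsOn_mono (Set.compl_subset_compl.2 hBl) hc)
    fun x hx => h x (hBl hx)

/-- On a connected non-compact surface every top-dimensional cycle is locally null-homologous. -/
theorem nullRel_compl_singleton [ConnectedSpace X] [NoncompactSpace X]
    (hX : ∀ x : X, ∃ f : ℂ → X, IsOpenEmbedding f ∧ x ∈ Set.range f)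
    {c : SChain 2 X}
    (hz : bdry c = 0) (x : X) : NullRel {x}ᶜ c := by
  have key : ∀ x : X, ∃ B ∈ 𝓝 x, ∀ y ∈ B, ∀ z ∈ B, NullRel {y}ᶜ c → NullRel {z}ᶜ c := by
    intro x
    obtain ⟨f, hf, p, rfl⟩ := hX x
    refine ⟨f '' Metric.closedBall p 1,
      hf.isOpenMap.image_mem_nhds (Metric.closedBall_mem_nhds p one_pos), ?_⟩
    rintro _ ⟨y, hy, rfl⟩ _ ⟨z, hz', rfl⟩ h
    refine (nullRel_image_convex hf (convex_closedBall p 1) (isCompact_closedBall p 1) hy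
      (by rw [hz]; exact zero_mem _) h).mono ?_
    exact Set.compl_subset_compl.2 (Set.singleton_subset_iff.2 ⟨z, hz', rfl⟩)
  have hclopen : IsClopen {x | NullRel {x}ᶜ c} := by
    constructor
    · rw [← isOpen_compl_iff, isOpen_iff_mem_nhds]
      intro x hx
      obtain ⟨B, hB, h⟩ := key x
      exact Filter.mem_of_superset hB fun y hy hyn => hx (h y hy x (mem_of_mem_nhds hB) hyn)
    · rw [isOpen_iff_mem_nhds]
      intro x hx
      obtain ⟨B, hB, h⟩ := key x
      exact Filter.mem_of_superset hB fun y hy => h x (mem_of_mem_nhds hB) y hy hx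
  obtain ⟨T, -, hT, hcT⟩ := exists_isCompact_mem_chainsOn (mem_chainsOn_univ c)
  obtain ⟨y, hy⟩ : ∃ y, y ∉ T := by
    by_contra! h
    exact noncompact_univ X (by rwa [← Set.eq_univ_of_forall h])
  -- The clopen set is non-empty: the support of c is compact, so c itself misses some point of a
  -- non-compact space.
  have : {x | NullRel {x}ᶜ c} = Set.univ := hclopen.eq_univ ⟨y, 0, by
    rw [map_zero, sub_zero]
    exact chainsOn_mono (fun z hz (hzy : z = y) => hy (hzy ▸ hz)) hcT⟩
  exact this.symm.subset (Set.mem_univ x)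

/-- The second homology of a connected non-compact surface vanishes. -/
theorem cyclesBound_one_of_noncompact [ConnectedSpace X] [NoncompactSpace X]
    (hX : ∀ x : X, ∃ f : ℂ → X, IsOpenEmbedding f ∧ x ∈ Set.range f) :
    CyclesBound 1 X := by
  intro z hz
  have : WeaklyLocallyCompactSpace X := ⟨fun x => by
    obtain ⟨A, ⟨f, hf, B, hB, rfl⟩, hAx⟩ := exists_chartCompact_mem_nhds hX x
    exact ⟨_, hB.image hf.continuous, hAx⟩⟩
  obtain ⟨T, -, hT, hzT⟩ := exists_isCompact_mem_chainsOn (mem_chainsOn_univ z)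
  obtain ⟨U, hUo, hTU, hUc⟩ := exists_isOpen_superset_and_isCompact_closure hT
  have hzU := chainsOn_mono hTU hzT
  -- Local triviality at all points of the compact closure of U gives w with `z - bdry w` outside
  -- that closure. As z lies in U, `bdry w` misses the frontier.
  obtain ⟨w, hw⟩ := nullRel_isCompact hX hUc (by rw [hz]; exact zero_mem _)
    fun x _ => nullRel_compl_singleton hX hz x
  have hfr : (frontier U)ᶜ = U ∪ (closure U)ᶜ := by
    rw [hUo.frontier_eq, Set.compl_sdiff]
  have hd : Disjoint U (closure U)ᶜ := disjoint_compl_right.mono_left subset_closure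
  have hbw : bdry w ∈ chainsOn 2 (frontier U)ᶜ := by
    rw [hfr, ← sub_sub_cancel z (bdry w)]
    exact sub_mem (chainsOn_mono Set.subset_union_left hzU)
      (chainsOn_mono Set.subset_union_right hw)
  -- Vanishing of the relative H_3 at the compact frontier moves w off the frontier; it then splits
  -- into a inside U and b outside the closure. The chain `z - bdry a` is supported on both sides,
  -- so it is zero.
  obtain ⟨y, hy⟩ := relAcyclic_isCompact hX
    (hUc.of_isClosed_subset isClosed_frontier frontier_subset_closure) le_rfl w hbw
  rw [hfr, chainsOn_union_of_isOpen hUo isClosed_closure.isOpen_compl hd] at hy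
  obtain ⟨a, ha, b, hb, hab⟩ := Submodule.mem_sup.1 hy
  refine ⟨a, ?_⟩
  have hbd : bdry w = bdry a + bdry b := by
    rw [← map_add, hab, map_sub, bdry_bdry, sub_zero]
  have hmem : z - bdry a ∈ chainsOn 2 (U ∩ (closure U)ᶜ) := by
    rw [← chainsOn_inter]
    refine ⟨sub_mem hzU (bdry_mem_chainsOn ha), ?_⟩
    have : z - bdry a = z - bdry w + bdry b := by rw [hbd]; abel
    rw [this]
    exact add_mem hw (bdry_mem_chainsOn hb)
  rw [hd.inter_eq, chainsOn_empty, Submodule.mem_bot] at hmem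
  exact (sub_eq_zero.1 hmem).symm

end Surface

/-! ### Comparison with the singular chain complex -/

section Comparison

open Simplicial

theorem simplexFace_eq_map {n : ℕ} (i : Fin (n + 2)) (t : Simplex n) :
    simplexFace i t = stdSimplex.map i.succAbove t := by
  refine Subtype.ext ?_
  rw [simplexFace, coe_affineSimplex]
  ext j
  simp only [simplexVertex, Finset.sum_apply, Pi.smul_apply, Function.comp_apply, smul_eq_mul,
    Pi.single_apply, mul_ite, mul_one, mul_zero]
  change _ = FunOnFinite.linearMap ℝ ℝ i.succAbove t.1 j
  rw [FunOnFinite.linearMap_apply_apply, Finset.sum_filter]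
  refine Finset.sum_congr rfl fun k _ => ?_
  simp only [eq_comm]

variable (X : TopCat.{u})

/-- The singular simplices of a space, as simplices of its singular simplicial set. -/
def toSSetSimplex (n : ℕ) (σ : C(Simplex n, X)) : (TopCat.toSSet.obj X) _⦋n⦌ :=
  (TopCat.toSSetObjEquiv X (.op ⦋n⦌)).symm σ

theorem δ_toSSetSimplex {n : ℕ} (σ : C(Simplex (n + 1), X)) (i : Fin (n + 2)) :
    (TopCat.toSSet.obj X).δ i (toSSetSimplex X (n + 1) σ) =
      toSSetSimplex X n (σ.comp (simplexFace i)) := by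
  apply (TopCat.toSSetObjEquiv X (.op ⦋n⦌)).injective
  rw [toSSetSimplex, toSSetSimplex, Equiv.apply_symm_apply]
  ext t
  refine congrArg σ ?_
  rw [simplexFace_eq_map]
  rfl

/-- The singular chain complex of a space, as the chain complex of its singular simplicial set. -/
abbrev ssetChains : ChainComplex (ModuleCat.{u} ℤ) ℕ :=
  (TopCat.toSSet.obj X).chainComplex (ModuleCat.of ℤ (ULift.{u} ℤ))

/-- The comparison map from singular chains to the singular chain complex. -/
def toSingChains (n : ℕ) : SChain n X →ₗ[ℤ] (ssetChains X).X n :=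
  Finsupp.linearCombination ℤ fun σ =>
    ((TopCat.toSSet.obj X).ιChainComplex (R := ModuleCat.of ℤ (ULift.{u} ℤ))
      (toSSetSimplex X n σ)).hom ⟨1⟩

theorem toSingChains_single (n : ℕ) (σ : C(Simplex n, X)) :
    toSingChains X n (Finsupp.single σ 1) =
      ((TopCat.toSSet.obj X).ιChainComplex (R := ModuleCat.of ℤ (ULift.{u} ℤ))
        (toSSetSimplex X n σ)).hom ⟨1⟩ :=
  (Finsupp.linearCombination_single ℤ 1 σ).trans
    (((ssetChains X).X n).isModule.toMulAction.one_smul _)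

theorem d_toSingChains {n : ℕ} (c : SChain (n + 1) X) :
    ((ssetChains X).d (n + 1) n).hom (toSingChains X (n + 1) c) =
      toSingChains X n (bdry c) := by
  refine linearMap_ext_single
    (f := ((ssetChains X).d (n + 1) n).hom ∘ₗ toSingChains X (n + 1))
    (g := toSingChains X n ∘ₗ bdry) (fun σ => ?_) c
  let ev : (ModuleCat.of ℤ (ULift.{u} ℤ) ⟶ (ssetChains X).X n) →+ (ssetChains X).X n :=
    { toFun := fun f => f.hom ⟨1⟩
      map_zero' := rfl
      map_add' := fun _ _ => rfl }
  have h := congrArg ev ((TopCat.toSSet.obj X).ιChainComplex_d (R := ModuleCat.of ℤ (ULift.{u} ℤ))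
    (toSSetSimplex X (n + 1) σ))
  rw [map_sum] at h
  rw [LinearMap.comp_apply, toSingChains_single, LinearMap.comp_apply, bdry_single, map_sum]
  refine h.trans (Finset.sum_congr rfl fun i _ => ?_)
  rw [map_zsmul, δ_toSSetSimplex]
  refine Eq.trans ?_ (map_zsmul (toSingChains X n).toAddMonoidHom _ _).symm
  exact congrArg (_ • ·) (toSingChains_single X n _).symm

/-- The inverse of the comparison map. -/
def ofSingChains (n : ℕ) : (ssetChains X).X n ⟶ ModuleCat.of ℤ (SChain n X) :=
  Cofan.IsColimit.desc ((TopCat.toSSet.obj X).isColimitChainComplexXCofan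
    (ModuleCat.of ℤ (ULift.{u} ℤ)) n) fun x =>
    ModuleCat.ofHom ((LinearMap.toSpanSingleton ℤ (SChain n X)
      (Finsupp.single (TopCat.toSSetObjEquiv X (.op ⦋n⦌) x) 1)) ∘ₗ
      (ULift.moduleEquiv : ULift.{u} ℤ ≃ₗ[ℤ] ℤ).toLinearMap)

theorem ι_ofSingChains (n : ℕ) (x : (TopCat.toSSet.obj X) _⦋n⦌) (r : ULift.{u} ℤ) :
    (ofSingChains X n).hom (((TopCat.toSSet.obj X).ιChainComplex
      (R := ModuleCat.of ℤ (ULift.{u} ℤ)) x).hom r) =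
      r.down • Finsupp.single (TopCat.toSSetObjEquiv X (.op ⦋n⦌) x) 1 :=
  congrArg (fun f => f.hom r) (Cofan.IsColimit.fac
    ((TopCat.toSSet.obj X).isColimitChainComplexXCofan (ModuleCat.of ℤ (ULift.{u} ℤ)) n)
    (fun x => ModuleCat.ofHom ((LinearMap.toSpanSingleton ℤ (SChain n X)
      (Finsupp.single (TopCat.toSSetObjEquiv X (.op ⦋n⦌) x) 1)) ∘ₗ
      (ULift.moduleEquiv : ULift.{u} ℤ ≃ₗ[ℤ] ℤ).toLinearMap)) x)

theorem toSingChains_injective (n : ℕ) : Function.Injective (toSingChains X n) := by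
  refine Function.LeftInverse.injective (g := (ofSingChains X n).hom) fun c => ?_
  refine linearMap_ext_single (f := (ofSingChains X n).hom ∘ₗ toSingChains X n)
    (g := LinearMap.id) (fun σ => ?_) c
  rw [LinearMap.comp_apply, toSingChains_single, ι_ofSingChains]
  simp [toSSetSimplex]

/-- The chain module is a coproduct of copies of the coefficients indexed by singular simplices, so
the right inverse can be checked on the coproduct injections. -/
theorem toSingChains_surjective (n : ℕ) : Function.Surjective (toSingChains X n) := by
  have : ofSingChains X n ≫ ModuleCat.ofHom (toSingChains X n) = 𝟙 _ := by
    refine SSet.chainComplex_hom_ext fun x => ?_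
    ext r
    obtain ⟨σ, rfl⟩ := (TopCat.toSSetObjEquiv X (.op ⦋n⦌)).symm.surjective x
    refine (congrArg (toSingChains X n) (ι_ofSingChains X n _ r)).trans ?_
    rw [Equiv.apply_symm_apply]
    refine (map_zsmul (toSingChains X n).toAddMonoidHom _ _).trans ?_
    refine (congrArg (r.down • ·) (toSingChains_single X n σ)).trans ?_
    refine (map_zsmul ((TopCat.toSSet.obj X).ιChainComplex (R := ModuleCat.of ℤ (ULift.{u} ℤ))
      (toSSetSimplex X n σ)).hom.toAddMonoidHom r.down ⟨1⟩).symm.trans ?_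
    refine congrArg ((TopCat.toSSet.obj X).ιChainComplex (R := ModuleCat.of ℤ (ULift.{u} ℤ))
      (toSSetSimplex X n σ)).hom ?_
    ext
    simp
  exact fun x => ⟨_, congrArg (fun f => f.hom x) this⟩

theorem isZero_homology_singChains {n : ℕ} (h : CyclesBound n X) :
    IsZero ((singChains.obj X).homology (n + 1)) := by
  rw [← HomologicalComplex.exactAt_iff_isZero_homology,
    HomologicalComplex.exactAt_iff' _ (n + 2) (n + 1) n (by simp) (by simp),
    ShortComplex.moduleCat_exact_iff]
  intro x hx
  obtain ⟨c, rfl⟩ := toSingChains_surjective X (n + 1) x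
  have hc : bdry c = 0 := toSingChains_injective X n (by
    rw [map_zero, ← d_toSingChains]
    exact hx)
  obtain ⟨w, rfl⟩ := h c hc
  exact ⟨toSingChains X (n + 2) w, d_toSingChains X w⟩

theorem subsingleton_singHomology {M : Type u} [TopologicalSpace M] {n : ℕ} {Y : Set M}
    (h : CyclesBoundOn n Y) : Subsingleton (singHomology (n + 1) Y) :=
  ModuleCat.subsingleton_of_isZero (isZero_homology_singChains (TopCat.of Y) (cyclesBoundOn_iff.1 h))

end Comparison

/-! ### Bundles over an interval -/

section IntervalBundle

variable {Z F : Type*} [TopologicalSpace Z] [TopologicalSpace F] {α : C(Z, ℝ)} {O : Set ℝ}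
  (φ : α ⁻¹' O ≃ₜ F × O) (hφ : ∀ z, ((φ z).2 : ℝ) = α z) {I J : Set ℝ}

/-- The fibre coordinate of a trivialization. -/
def fiberCoord (hI : I ⊆ O) : C(α ⁻¹' I, F) where
  toFun z := (φ (Set.inclusion (Set.preimage_mono hI) z)).1
  continuous_toFun :=
    continuous_fst.comp (φ.continuous.comp (continuous_inclusion (Set.preimage_mono hI)))

/-- The point with given coordinates in a trivialization. -/
def pointOfCoord (hI : I ⊆ O) : C(F × I, α ⁻¹' I) where
  toFun p := ⟨(φ.symm (p.1, Set.inclusion hI p.2)).1, by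
    have := hφ (φ.symm (p.1, Set.inclusion hI p.2))
    rw [Homeomorph.apply_symm_apply] at this
    rw [Set.mem_preimage, ← this]
    exact p.2.2⟩
  continuous_toFun := by
    refine Continuous.subtype_mk (continuous_subtype_val.comp (φ.symm.continuous.comp ?_)) _
    exact continuous_fst.prodMk ((continuous_inclusion hI).comp continuous_snd)

theorem pointOfCoord_fiberCoord (hI : I ⊆ O) (z : α ⁻¹' I) :
    pointOfCoord φ hφ hI (fiberCoord φ hI z, ⟨α z, z.2⟩) = z := by
  refine Subtype.ext ?_
  have : φ.symm ((φ (Set.inclusion (Set.preimage_mono hI) z)).1, Set.inclusion hI ⟨α z, z.2⟩) =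
      Set.inclusion (Set.preimage_mono hI) z := by
    rw [Homeomorph.symm_apply_eq]
    refine Prod.ext rfl (Subtype.ext ?_)
    exact (hφ (Set.inclusion (Set.preimage_mono hI) z)).symm
  have h := congrArg Subtype.val this
  exact h

/-- The fibre coordinate is kept and the base coordinate moves along the segment from s to its
actual value, which stays in I by convexity. -/
theorem homotopic_id_of_coord (hI : I ⊆ O) (hc : Convex ℝ I) (s : I) :
    ((pointOfCoord φ hφ hI).comp ((fiberCoord φ hI).prodMk (ContinuousMap.const _ s))).Homotopic
      (ContinuousMap.id _) := by
  have hmem : ∀ p : unitInterval × (α ⁻¹' I), (1 - p.1 : ℝ) * s + p.1 * α p.2 ∈ I := fun p =>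
    hc s.2 p.2.2 (sub_nonneg.2 p.1.2.2) p.1.2.1 (by ring)
  refine ⟨{ toFun := fun p => pointOfCoord φ hφ hI (fiberCoord φ hI p.2, ⟨_, hmem p⟩)
            continuous_toFun := ?_
            map_zero_left := fun z => ?_
            map_one_left := fun z => ?_ }⟩
  · refine (pointOfCoord φ hφ hI).continuous.comp (Continuous.prodMk ?_ ?_)
    · exact (fiberCoord φ hI).continuous.comp continuous_snd
    · refine Continuous.subtype_mk ?_ _
      fun_prop
  · refine congrArg (pointOfCoord φ hφ hI) (Prod.ext rfl (Subtype.ext ?_))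
    simp
  · have h : (⟨_, hmem (1, z)⟩ : I) = ⟨α z, z.2⟩ := Subtype.ext (by simp)
    refine Eq.trans ?_ (pointOfCoord_fiberCoord φ hφ hI z)
    exact congrArg (fun i => pointOfCoord φ hφ hI (fiberCoord φ hI z, i)) h

theorem cyclesBoundOn_preimage (φ : α ⁻¹' O ≃ₜ F × O) (hφ : ∀ z, ((φ z).2 : ℝ) = α z)
    (hI : I ⊆ O) (hc : Convex ℝ I) (hne : I.Nonempty) {n : ℕ}
    (hF : CyclesBound n F) : CyclesBoundOn n (α ⁻¹' I) := by
  obtain ⟨s, hs⟩ := hne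
  exact cyclesBoundOn_iff.2 (hF.of_leftInverse (i := fiberCoord φ hI)
    (r := (pointOfCoord φ hφ hI).comp ((ContinuousMap.id F).prodMk (ContinuousMap.const _ ⟨s, hs⟩)))
    (homotopic_id_of_coord φ hφ hI hc ⟨s, hs⟩))

/-- Both preimages retract to one fibre, so restricting the interval loses no homology. This
supplies the injectivity on overlaps in Mayer–Vietoris, in a degree where the fibres may have
homology. -/
theorem exists_bdry_eq_preimage (φ : α ⁻¹' O ≃ₜ F × O) (hφ : ∀ z, ((φ z).2 : ℝ) = α z)
    (hI : I ⊆ O) (hc : Convex ℝ I) (hne : I.Nonempty) (hJ : J ⊆ O)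
    (hIJ : I ⊆ J) {n : ℕ} {c : SChain (n + 1) Z} (hcI : c ∈ chainsOn (n + 1) (α ⁻¹' I))
    (hz : bdry c = 0) (hb : ∃ w ∈ chainsOn (n + 2) (α ⁻¹' J), bdry w = c) :
    ∃ w ∈ chainsOn (n + 2) (α ⁻¹' I), bdry w = c := by
  obtain ⟨s, hs⟩ := hne
  exact exists_bdry_eq_of_subset (Set.preimage_mono hIJ)
    ((pointOfCoord φ hφ hI).comp ((fiberCoord φ hJ).prodMk (ContinuousMap.const _ ⟨s, hs⟩)))
    (homotopic_id_of_coord φ hφ hI hc ⟨s, hs⟩) hcI hz hb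

end IntervalBundle

/-- The total space of a locally trivial bundle over an open interval has vanishing homology if the
fibres do. -/
theorem cyclesBound_of_locallyTrivial {Z : Type u} [TopologicalSpace Z] (α : C(Z, ℝ)) {l r : ℝ}
    (hα : ∀ z, α z ∈ Set.Ioo l r) {n : ℕ}
    (htriv : ∀ s ∈ Set.Ioo l r, ∃ O : Set ℝ, IsOpen O ∧ s ∈ O ∧
      ∃ (F : Type u) (_ : TopologicalSpace F), CyclesBound (n + 1) F ∧
        ∃ φ : α ⁻¹' O ≃ₜ F × O, ∀ z, ((φ z).2 : ℝ) = α z) : CyclesBound (n + 1) Z := by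
  intro c hz
  obtain ⟨T, -, hT, hcT⟩ := exists_isCompact_mem_chainsOn (mem_chainsOn_univ c)
  rcases T.eq_empty_or_nonempty with rfl | hne
  · rw [chainsOn_empty, Submodule.mem_bot] at hcT
    exact ⟨0, by rw [map_zero, hcT]⟩
  obtain ⟨x, hx, hxm⟩ := hT.exists_isMinOn hne α.continuous.continuousOn
  obtain ⟨y, hy, hym⟩ := hT.exists_isMaxOn hne α.continuous.continuousOn
  set a := α x
  set b := α y
  have hab : a ≤ b := hxm hy
  have hsub : Set.Icc a b ⊆ Set.Ioo l r := fun s hs =>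
    ⟨(hα x).1.trans_le hs.1, hs.2.trans_lt (hα y).2⟩
  have hint : ∀ s ∈ Set.Icc a b, ∃ ε > 0, (∀ I ⊆ Set.Ioo (s - ε) (s + ε), Convex ℝ I → I.Nonempty →
      CyclesBoundOn (n + 1) (α ⁻¹' I) ∧ ∀ J ⊆ Set.Ioo (s - ε) (s + ε), I ⊆ J →
        ∀ d ∈ chainsOn (n + 1) (α ⁻¹' I), bdry d = 0 →
          (∃ w ∈ chainsOn (n + 2) (α ⁻¹' J), bdry w = d) →
            ∃ w ∈ chainsOn (n + 2) (α ⁻¹' I), bdry w = d) := by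
    intro s hs
    obtain ⟨O, hO, hsO, F, _, hF, φ, hφ⟩ := htriv s (hsub hs)
    obtain ⟨ε, hε, hεO⟩ := Metric.isOpen_iff.1 hO s hsO
    rw [Real.ball_eq_Ioo] at hεO
    exact ⟨ε, hε, fun I hI hc hne => ⟨cyclesBoundOn_preimage φ hφ (hI.trans hεO) hc hne hF,
      fun J hJ hIJ d hd hz hb => exists_bdry_eq_preimage φ hφ (hI.trans hεO) hc hne
        (hJ.trans hεO) hIJ hd hz hb⟩⟩
  obtain ⟨a', ha'a, s₀, has₀, hs₀⟩ : ∃ a' < a, ∃ s > a,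
      CyclesBoundOn (n + 1) (α ⁻¹' Set.Ioo a' s) := by
    obtain ⟨ε, hε, h⟩ := hint a ⟨le_rfl, hab⟩
    exact ⟨a - ε, by linarith, a + ε, by linarith,
      (h _ subset_rfl (convex_Ioo _ _) ⟨a, by constructor <;> linarith⟩).1⟩
  -- The chain lives over [a, b]. The points t such that homology vanishes over an interval from a'
  -- to beyond t form a clopen set containing a, so vanishing propagates to b with only local
  -- trivializations.
  let S : Set (Set.Icc a b) := {t | ∃ s > (t : ℝ), CyclesBoundOn (n + 1) (α ⁻¹' Set.Ioo a' s)}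
  have hloc : ∀ t : Set.Icc a b, ∃ W ∈ 𝓝 t, ∀ p ∈ W, ∀ q ∈ W, p ∈ S → q ∈ S := by
    intro t
    obtain ⟨ε, hε, h⟩ := hint t t.2
    refine ⟨Subtype.val ⁻¹' Set.Ioo (t - ε : ℝ) (t + ε),
      continuous_subtype_val.continuousAt.preimage_mem_nhds
        (Ioo_mem_nhds (by linarith) (by linarith)), ?_⟩
    rintro p hp q hq ⟨s, hps, hs⟩
    by_cases hqs : (q : ℝ) < s
    · exact ⟨s, hqs, hs⟩
    rw [not_lt] at hqs
    obtain ⟨s', hqs', hs't⟩ := exists_between hq.2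
    -- The interval up to s is extended to s' by a piece inside the trivializing interval around t.
    -- They overlap, since p lies in that interval and p < s.
    have hus : max a' (t - ε) < s := max_lt (ha'a.trans (p.2.1.trans_lt hps)) (hp.1.trans hps)
    have hun : Set.Ioo a' s' = Set.Ioo a' s ∪ Set.Ioo (max a' (t - ε)) s' := by
      rw [Set.Ioo_union_Ioo' hus ((le_max_left _ _).trans_lt (hus.trans_le (hqs.trans hqs'.le))),
        min_eq_left (le_max_left _ _), max_eq_right (hqs.trans hqs'.le)]
    have hin : Set.Ioo a' s ∩ Set.Ioo (max a' (t - ε)) s' = Set.Ioo (max a' (t - ε)) s := by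
      rw [Set.Ioo_inter_Ioo, max_eq_right (le_max_left _ _), min_eq_left (hqs.trans hqs'.le)]
    have hsub1 : Set.Ioo (max a' (t - ε)) s' ⊆ Set.Ioo (t - ε : ℝ) (t + ε) :=
      Set.Ioo_subset_Ioo (le_max_right _ _) hs't.le
    have hsub2 : Set.Ioo (max a' (t - ε)) s ⊆ Set.Ioo (max a' (t - ε)) s' :=
      Set.Ioo_subset_Ioo_right (hqs.trans hqs'.le)
    refine ⟨s', hqs', ?_⟩
    rw [hun, Set.preimage_union]
    refine CyclesBoundOn.union_of_injective (isOpen_Ioo.preimage α.continuous)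
      (isOpen_Ioo.preimage α.continuous) hs
      (h _ hsub1 (convex_Ioo _ _) (Set.nonempty_Ioo.2 (hus.trans_le (hqs.trans hqs'.le)))).1 ?_
    rw [← Set.preimage_inter, hin]
    intro d hd hdz hdb
    exact (h _ (hsub2.trans hsub1) (convex_Ioo _ _) (Set.nonempty_Ioo.2 hus)).2 _ hsub1 hsub2 d hd
      hdz hdb
  have hclopen : IsClopen S := by
    constructor
    · rw [← isOpen_compl_iff, isOpen_iff_mem_nhds]
      intro t ht
      obtain ⟨W, hW, h⟩ := hloc t
      exact Filter.mem_of_superset hW fun p hp hpS => ht (h p hp t (mem_of_mem_nhds hW) hpS)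
    · rw [isOpen_iff_mem_nhds]
      intro t ht
      obtain ⟨W, hW, h⟩ := hloc t
      exact Filter.mem_of_superset hW fun p hp => h t (mem_of_mem_nhds hW) p hp ht
  have : PreconnectedSpace (Set.Icc a b) := isPreconnected_iff_preconnectedSpace.1 isPreconnected_Icc
  have hS : S = Set.univ := hclopen.eq_univ ⟨⟨a, le_rfl, hab⟩, s₀, has₀, hs₀⟩
  obtain ⟨s, hbs, hs⟩ : (⟨b, hab, le_rfl⟩ : Set.Icc a b) ∈ S := hS ▸ Set.mem_univ _
  have hTs : T ⊆ α ⁻¹' Set.Ioo a' s := fun z hz =>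
    ⟨ha'a.trans_le (hxm hz), lt_of_le_of_lt (hym hz) hbs⟩
  obtain ⟨w, -, hw⟩ := hs c (chainsOn_mono hTs hcT) hz
  exact ⟨w, hw⟩

/-! ### The topology of an open book -/

section OpenBookTopology

/-- A ball around the image of x in the target of a chart is homeomorphic to the whole plane. -/
theorem exists_complex_chart {F : Type*} [TopologicalSpace F]
    [ChartedSpace (EuclideanSpace ℝ (Fin 2)) F] (x : F) :
    ∃ f : ℂ → F, IsOpenEmbedding f ∧ x ∈ Set.range f := by
  let e := chartAt (EuclideanSpace ℝ (Fin 2)) x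
  have hx : x ∈ e.source := mem_chart_source _ x
  obtain ⟨r, hr, hrt⟩ := Metric.isOpen_iff.1 e.open_target (e x) (e.map_source hx)
  let g := OpenPartialHomeomorph.univBall (e x) r
  have hgt : ∀ y, g y ∈ e.target := fun y => hrt (by
    have := g.map_source (x := y) (by simp [g])
    rwa [OpenPartialHomeomorph.univBall_target _ hr] at this)
  have hs : (g.trans e.symm).source = Set.univ := by
    ext y
    simp [g, hgt]
  refine ⟨(g.trans e.symm) ∘ Complex.orthonormalBasisOneI.repr.toHomeomorph,
    ((g.trans e.symm).isOpenEmbedding hs).comp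
      Complex.orthonormalBasisOneI.repr.toHomeomorph.isOpenEmbedding, ?_⟩
  refine ⟨Complex.orthonormalBasisOneI.repr.toHomeomorph.symm 0, ?_⟩
  rw [Function.comp_apply, Homeomorph.apply_symm_apply]
  simp [g, e.left_inv hx]

variable {M : Type u} [TopologicalSpace M]

namespace OpenBook

variable (ob : OpenBook M)

theorem isCompact_binding : IsCompact ob.binding := by
  obtain ⟨k, -, ⟨e⟩⟩ := ob.binding_link
  have := e.symm.compactSpace
  exact isCompact_iff_compactSpace.2 this

theorem binding_nonempty : ob.binding.Nonempty := by
  obtain ⟨k, hk, ⟨e⟩⟩ := ob.binding_link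
  exact ⟨_, (e.symm (⟨0, hk⟩, 1)).2⟩

/-- The closed unit disc. -/
abbrev Disc : Type := Metric.closedBall (0 : ℂ) 1

/-- The point of the disc with given polar coordinates. -/
def polarPoint (θ : Circle) (s : unitInterval) : Disc :=
  ⟨(s : ℝ) * (θ : ℂ), by
    rw [mem_closedBall_zero_iff, norm_mul, Circle.norm_coe, mul_one, Complex.norm_real,
      Real.norm_of_nonneg s.2.1]
    exact s.2.2⟩

theorem norm_polarPoint (θ : Circle) (s : unitInterval) : ‖(polarPoint θ s : ℂ)‖ = s := by
  change ‖((s : ℝ) : ℂ) * (θ : ℂ)‖ = _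
  rw [norm_mul, Circle.norm_coe, mul_one, Complex.norm_real, Real.norm_of_nonneg s.2.1]

theorem continuous_polarPoint (θ : Circle) : Continuous (polarPoint θ) := by
  refine Continuous.subtype_mk ?_ _
  exact (Complex.continuous_ofReal.comp continuous_subtype_val).mul continuous_const

variable {ob} {τ : ob.binding × Disc → M}

/-- A binding point is also the centre of its own disc, so injectivity of τ forces z = 0. -/
theorem notMem_binding (hτ : IsEmbedding τ)
    (hτ0 : ∀ b : ob.binding, τ (b, ⟨0, by simp⟩) = b)
    {b : ob.binding} {z : Disc} (hz : (z : ℂ) ≠ 0) :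
    τ (b, z) ∉ ob.binding := fun h => by
  have h1 := hτ.injective (hτ0 ⟨τ (b, z), h⟩)
  exact hz (congrArg (fun p => (p.2 : ℂ)) h1).symm

theorem mem_page_iff (hτ : IsEmbedding τ)
    (hτ0 : ∀ b : ob.binding, τ (b, ⟨0, by simp⟩) = b)
    (hτp : ∀ (b : ob.binding) (z : Disc) (h : τ (b, z) ∈ ob.bindingᶜ),
      (z : ℂ) = (‖(z : ℂ)‖ : ℂ) * (ob.proj ⟨τ (b, z), h⟩ : ℂ))
    {b : ob.binding} {z : Disc} {θ : Circle} :
    τ (b, z) ∈ ob.page θ ↔ (z : ℂ) = (‖(z : ℂ)‖ : ℂ) * θ := by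
  constructor
  · rintro (⟨y, hy, hyz⟩ | h)
    · have hmem : τ (b, z) ∈ ob.bindingᶜ := hyz ▸ y.2
      have hy' : y = ⟨τ (b, z), hmem⟩ := Subtype.ext hyz
      have h1 := hτp b z hmem
      rw [← hy', show ob.proj y = θ from hy] at h1
      exact h1
    · by_contra hne
      have hz : (z : ℂ) ≠ 0 := fun h0 => hne (by simp [h0])
      exact notMem_binding hτ hτ0 hz h
  · intro hz
    by_cases h0 : (z : ℂ) = 0
    · refine Or.inr ?_
      have : z = ⟨0, by simp⟩ := Subtype.ext h0
      rw [this, hτ0]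
      exact b.2
    · have hmem : τ (b, z) ∈ ob.bindingᶜ := notMem_binding hτ hτ0 h0
      refine Or.inl ⟨⟨τ (b, z), hmem⟩, ?_, rfl⟩
      have h1 := hτp b z hmem
      have hn : (‖(z : ℂ)‖ : ℂ) ≠ 0 := by simpa using h0
      exact Circle.ext (mul_left_cancel₀ hn (h1.symm.trans hz))

theorem polarPoint_mem_page (hτ : IsEmbedding τ)
    (hτ0 : ∀ b : ob.binding, τ (b, ⟨0, by simp⟩) = b)
    (hτp : ∀ (b : ob.binding) (z : Disc) (h : τ (b, z) ∈ ob.bindingᶜ),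
      (z : ℂ) = (‖(z : ℂ)‖ : ℂ) * (ob.proj ⟨τ (b, z), h⟩ : ℂ))
    (b : ob.binding) (θ : Circle) (s : unitInterval) :
    τ (b, polarPoint θ s) ∈ ob.page θ := by
  rw [mem_page_iff hτ hτ0 hτp, norm_polarPoint]
  rfl

theorem mem_page_of_notMem_binding {θ : Circle} {x : M} (hx : x ∈ ob.page θ)
    (hxb : x ∈ ob.bindingᶜ) : ob.proj ⟨x, hxb⟩ = θ := by
  rcases hx with ⟨y, hy, rfl⟩ | h
  · exact hy
  · exact absurd h hxb

/-- A compact fibre would be closed in M, yet its points at radius 1 / (n + 1) in the tube converge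
to a point of the binding. -/
theorem noncompactSpace_fiber [T2Space M] (ob : OpenBook M) (θ : Circle) :
    NoncompactSpace (ob.proj ⁻¹' {θ}) := by
  rw [← not_compactSpace_iff]
  intro hc
  obtain ⟨τ, hτ, -, hτ0, hτp⟩ := ob.tubular
  obtain ⟨b, hb⟩ := ob.binding_nonempty
  have hcl : IsClosed (Subtype.val '' (ob.proj ⁻¹' {θ})) :=
    ((isCompact_iff_compactSpace.2 hc).image continuous_subtype_val).isClosed
  have hlim : Filter.Tendsto (fun n : ℕ => τ (⟨b, hb⟩, polarPoint θ
      ⟨1 / ((n : ℝ) + 1), by positivity, by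
        rw [div_le_one (by positivity)]; linarith [n.cast_nonneg (α := ℝ)]⟩))
      Filter.atTop (𝓝 b) := by
    have h0 : b = τ (⟨b, hb⟩, polarPoint θ 0) := by
      have : polarPoint θ 0 = ⟨0, by simp⟩ := Subtype.ext (by simp [polarPoint])
      rw [this, hτ0]
    nth_rw 2 [h0]
    refine (hτ.continuous.tendsto _).comp (Filter.Tendsto.prodMk_nhds tendsto_const_nhds ?_)
    refine ((continuous_polarPoint θ).tendsto 0).comp ?_
    rw [tendsto_subtype_rng]
    exact tendsto_one_div_add_atTop_nhds_zero_nat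
  have hmem : b ∈ Subtype.val '' (ob.proj ⁻¹' {θ}) := by
    refine hcl.mem_of_tendsto hlim (Filter.Eventually.of_forall fun n => ?_)
    have hne : (polarPoint θ ⟨1 / ((n : ℝ) + 1), by positivity, by
        rw [div_le_one (by positivity)]; linarith [n.cast_nonneg (α := ℝ)]⟩ : ℂ) ≠ 0 := by
      rw [← norm_ne_zero_iff, norm_polarPoint]
      positivity
    have h1 := notMem_binding hτ hτ0 (b := ⟨b, hb⟩) hne
    exact ⟨⟨_, h1⟩, mem_page_of_notMem_binding (polarPoint_mem_page hτ hτ0 hτp _ _ _) h1, rfl⟩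
  obtain ⟨y, -, hy⟩ := hmem
  exact y.2 (hy ▸ hb)

/-- The second homology of the fibres of an open book vanishes. -/
theorem cyclesBound_fiber [T2Space M] (ob : OpenBook M) (θ : Circle) :
    CyclesBound 1 (ob.proj ⁻¹' {θ}) := by
  have := ob.noncompactSpace_fiber θ
  have := isConnected_iff_connectedSpace.1 (ob.fiber_connected θ)
  obtain ⟨_⟩ := ob.fiber_surface θ
  exact cyclesBound_one_of_noncompact exists_complex_chart

/-- The binding is compact, so the tube lemma gives one radius that works along all of it. -/
theorem exists_isOpen_tube (hτn : ∀ b : ob.binding, Set.range τ ∈ 𝓝 (b : M)) (hτ : IsEmbedding τ)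
    (hτ0 : ∀ b : ob.binding, τ (b, ⟨0, by simp⟩) = b) :
    ∃ ε : ℝ, 0 < ε ∧ ε ≤ 1 ∧ IsOpen (τ '' {p | ‖(p.2 : ℂ)‖ < ε}) := by
  have hcomp := isCompact_iff_compactSpace.1 ob.isCompact_binding
  obtain ⟨u, v, -, hv, hu, hv0, huv⟩ := generalized_tube_lemma (s := Set.univ)
    (t := {(⟨0, by simp⟩ : Disc)}) isCompact_univ isCompact_singleton
    ((isOpen_interior (s := Set.range τ)).preimage hτ.continuous) (by
      rintro ⟨b, z⟩ ⟨-, hz⟩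
      rw [Set.mem_singleton_iff] at hz
      subst hz
      rw [Set.mem_preimage, hτ0]
      exact mem_interior_iff_mem_nhds.2 (hτn b))
  obtain ⟨ε, hε, hεv⟩ := Metric.isOpen_iff.1 hv _ (hv0 rfl)
  refine ⟨min ε 1, lt_min hε one_pos, min_le_right _ _, ?_⟩
  have hopen : IsOpen {p : ob.binding × Disc | ‖(p.2 : ℂ)‖ < min ε 1} :=
    isOpen_lt (by fun_prop) continuous_const
  obtain ⟨W, hW, hWV⟩ := hτ.isOpen_iff.1 hopen
  have : τ '' {p | ‖(p.2 : ℂ)‖ < min ε 1} = W ∩ interior (Set.range τ) := by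
    ext x
    constructor
    · rintro ⟨⟨b, z⟩, hp, rfl⟩
      refine ⟨hWV.symm.subset hp, huv ⟨hu trivial, hεv ?_⟩⟩
      rw [Metric.mem_ball, Subtype.dist_eq, dist_zero_right]
      exact lt_of_lt_of_le hp (min_le_left _ _)
    · rintro ⟨hxW, hxi⟩
      obtain ⟨p, rfl⟩ := interior_subset hxi
      exact ⟨p, hWV.subset hxW, rfl⟩
  rw [this]
  exact hW.inter isOpen_interior

/-- The second homology of the pages of an open book vanishes. -/
theorem cyclesBoundOn_page [T2Space M] (ob : OpenBook M) (θ : Circle) :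
    CyclesBoundOn 1 (ob.page θ) := by
  obtain ⟨τ, hτ, hτn, hτ0, hτp⟩ := ob.tubular
  obtain ⟨ε, hε, hε1, hopen⟩ := exists_isOpen_tube hτn hτ hτ0
  have hcomp := isCompact_iff_compactSpace.1 ob.isCompact_binding
  have hclosed : IsClosed (Set.range τ) := (isCompact_range hτ.continuous).isClosed
  let e := hτ.toHomeomorph
  let ρ : Set.range τ → unitInterval := fun x =>
    ⟨‖((e.symm x).2 : ℂ)‖, norm_nonneg _, mem_closedBall_zero_iff.1 (e.symm x).2.2⟩
  have hρ : Continuous ρ := Continuous.subtype_mk (by fun_prop) _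
  let ε' : unitInterval := ⟨ε / 2, by positivity, by linarith⟩
  -- At time t the radius is raised to at least t * ε / 2. Points of the page at radius ε or more do
  -- not move, so the homotopy extends by the identity outside the tube; at time 1 it has left the
  -- binding.
  let k : Set.range τ × unitInterval → M := fun p =>
    τ ((e.symm p.1).1, polarPoint θ (max (ρ p.1) (p.2 * ε')))
  have hk : Continuous k := by
    refine hτ.continuous.comp (Continuous.prodMk (by fun_prop) ?_)
    exact (continuous_polarPoint θ).comp ((hρ.comp continuous_fst).max
      (continuous_snd.mul continuous_const))
  have hτe : ∀ x : Set.range τ, τ (e.symm x) = x := fun x =>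
    congrArg Subtype.val (e.apply_symm_apply x)
  have hkid : ∀ (x : Set.range τ) (t : unitInterval), (x : M) ∈ ob.page θ → t * ε' ≤ ρ x →
      k (x, t) = x := by
    intro x t hx ht
    have h1 : max (ρ x) (t * ε') = ρ x := max_eq_left ht
    rw [← hτe x, mem_page_iff hτ hτ0 hτp] at hx
    have h2 : polarPoint θ (ρ x) = (e.symm x).2 := Subtype.ext hx.symm
    change τ (_, polarPoint θ (max (ρ x) (t * ε'))) = _
    rw [h1, h2, Prod.mk.eta, hτe]
  classical
  let H : ob.page θ × unitInterval → M := fun p =>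
    if h : (p.1 : M) ∈ Set.range τ then k (⟨p.1, h⟩, p.2) else p.1
  have hHk : ∀ (p : ob.page θ × unitInterval) (h : (p.1 : M) ∈ Set.range τ),
      H p = k (⟨p.1, h⟩, p.2) := fun p h => dif_pos h
  have hHid : ∀ p : ob.page θ × unitInterval, (p.1 : M) ∉ τ '' {p | ‖(p.2 : ℂ)‖ < ε} →
      H p = p.1 := by
    intro p hp
    by_cases h : (p.1 : M) ∈ Set.range τ
    · rw [hHk p h]
      refine hkid ⟨p.1, h⟩ p.2 p.1.2 ?_
      have h1 : ε ≤ ρ ⟨p.1, h⟩ := by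
        by_contra! hlt
        exact hp ⟨e.symm ⟨p.1, h⟩, hlt, hτe _⟩
      have h2 : (p.2 : ℝ) * (ε / 2) ≤ 1 * (ε / 2) :=
        mul_le_mul_of_nonneg_right p.2.2.2 (by positivity)
      change (p.2 : ℝ) * (ε / 2) ≤ ρ ⟨p.1, h⟩
      linarith
    · exact dif_neg h
  have hH : Continuous H := by
    have h1 : ContinuousOn H {p | (p.1 : M) ∈ Set.range τ} := by
      rw [continuousOn_iff_continuous_domRestrict]
      have : ({p | (p.1 : M) ∈ Set.range τ} : Set (ob.page θ × unitInterval)).domRestrict H =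
          fun p => k (⟨p.1.1, p.2⟩, p.1.2) := funext fun p => hHk p.1 p.2
      rw [this]
      exact hk.comp (by fun_prop)
    -- The range of τ and the complement of the open tube of radius ε are closed and cover M, so
    -- continuity can be checked on each.
    have h2 : ContinuousOn H {p | (p.1 : M) ∉ τ '' {p | ‖(p.2 : ℂ)‖ < ε}} :=
      ContinuousOn.congr (f := fun p : ob.page θ × unitInterval => (p.1 : M))
        (by fun_prop) fun p hp => hHid p hp
    have hc : Continuous fun p : ob.page θ × unitInterval => (p.1 : M) := by fun_prop
    have h3 := h1.union_of_isClosed h2 (hclosed.preimage hc) (hopen.isClosed_compl.preimage hc)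
    rw [← continuousOn_univ]
    refine h3.mono fun p _ => ?_
    by_cases h : (p.1 : M) ∈ τ '' {p | ‖(p.2 : ℂ)‖ < ε}
    · exact Or.inl (Set.image_subset_range _ _ h)
    · exact Or.inr h
  have hHpage : ∀ p, H p ∈ ob.page θ := by
    intro p
    by_cases h : (p.1 : M) ∈ Set.range τ
    · rw [hHk p h]
      exact polarPoint_mem_page hτ hτ0 hτp _ _ _
    · rw [show H p = p.1 from dif_neg h]
      exact p.1.2
  have hH0 : ∀ x, H (x, 0) = x := by
    intro x
    by_cases h : (x : M) ∈ Set.range τ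
    · rw [hHk _ h]
      exact hkid ⟨x, h⟩ 0 x.2 (by rw [zero_mul]; exact (ρ _).2.1)
    · exact dif_neg h
  have hH1 : ∀ x, H (x, 1) ∈ ob.bindingᶜ := by
    intro x
    by_cases h : (x : M) ∈ Set.range τ
    · rw [hHk _ h]
      refine notMem_binding hτ hτ0 ?_
      rw [← norm_ne_zero_iff, norm_polarPoint]
      have : (ε' : ℝ) ≤ (max (ρ ⟨x, h⟩) (1 * ε') : unitInterval) := by
        rw [one_mul]
        exact le_max_right (ρ ⟨x, h⟩) ε'
      have h2 : (0 : ℝ) < ε' := by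
        change 0 < ε / 2
        positivity
      exact (h2.trans_le this).ne'
    · rw [show H (x, 1) = x from dif_neg h]
      intro hb
      exact h ⟨_, hτ0 ⟨x, hb⟩⟩
  let i : C(ob.page θ, ob.proj ⁻¹' {θ}) :=
    ⟨fun x => ⟨⟨H (x, 1), hH1 x⟩, mem_page_of_notMem_binding (hHpage _) (hH1 x)⟩,
      ((hH.comp (by fun_prop)).subtype_mk _).subtype_mk _⟩
  let r : C(ob.proj ⁻¹' {θ}, ob.page θ) :=
    ⟨fun x => ⟨x.1.1, Or.inl ⟨x.1, x.2, rfl⟩⟩, by fun_prop⟩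
  refine cyclesBoundOn_iff.2 ((ob.cyclesBound_fiber θ).of_leftInverse (i := i) (r := r)
    (ContinuousMap.Homotopic.symm ⟨?_⟩))
  exact
    { toFun := fun p => ⟨H (p.2, p.1), hHpage _⟩
      continuous_toFun := (hH.comp (by fun_prop)).subtype_mk _
      map_zero_left := fun x => Subtype.ext (hH0 x)
      map_one_left := fun x => rfl }

end OpenBook

end OpenBookTopology

/-! ### The complement of a page -/

section Geometry

theorem cyclesBound_compl_fiber {E : Type u} [TopologicalSpace E] (p : C(E, Circle)) {n : ℕ}
    (htriv : ∀ θ : Circle, ∃ t : Bundle.Trivialization ↥(p ⁻¹' {θ}) p, θ ∈ t.baseSet)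
    (hp : ∀ θ, CyclesBound (n + 1) (p ⁻¹' {θ})) (θ : Circle) :
    CyclesBound (n + 1) {y : E // p y ≠ θ} := by
  -- Rotation by u takes θ to -1, where the argument jumps; away from the fibre over θ the rotated
  -- argument is continuous with values in (-π, π).
  let u : Circle := θ⁻¹ * Circle.exp Real.pi
  have harg : ∀ y : {y : E // p y ≠ θ}, Complex.arg (p y * u : Circle) ≠ Real.pi := by
    intro y hy
    have h1 := Circle.exp_arg (p y * u)
    rw [hy] at h1
    have h2 : Circle.exp Real.pi = p y * θ⁻¹ * Circle.exp Real.pi := by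
      rw [mul_assoc]
      exact h1
    exact y.2 (mul_inv_eq_one.1 (mul_eq_right.1 h2.symm))
  let α : C({y : E // p y ≠ θ}, ℝ) :=
    { toFun := fun y => Complex.arg (p y * u : Circle)
      continuous_toFun := by
        refine continuous_iff_continuousAt.2 fun y => ?_
        refine ContinuousAt.comp (f := fun y : {y : E // p y ≠ θ} => ((p y * u : Circle) : ℂ))
          (Complex.continuousAt_arg (Complex.mem_slitPlane_iff_arg.2
            ⟨harg y, Circle.coe_ne_zero _⟩)) ?_
        fun_prop }
  have hexp : ∀ y, Circle.exp (α y) * u⁻¹ = p y := fun y => by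
    rw [show Circle.exp (α y) = p y * u from Circle.exp_arg _, mul_inv_cancel_right]
  refine cyclesBound_of_locallyTrivial α (l := -Real.pi) (r := Real.pi)
    (fun y => ⟨Complex.neg_pi_lt_arg _, lt_of_le_of_ne (Complex.arg_le_pi _) (harg y)⟩)
    fun s hs => ?_
  obtain ⟨t, ht⟩ := htriv (Circle.exp s * u⁻¹)
  have hc : Continuous fun s : ℝ => Circle.exp s * u⁻¹ := by fun_prop
  -- Within (-π, π) the argument inverts the exponential, so base points over O are recovered from
  -- α.
  let O : Set ℝ := (fun s => Circle.exp s * u⁻¹) ⁻¹' t.baseSet ∩ Set.Ioo (-Real.pi) Real.pi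
  refine ⟨O, (t.open_baseSet.preimage hc).inter isOpen_Ioo, ⟨ht, hs⟩,
    ↥(p ⁻¹' {Circle.exp s * u⁻¹}), inferInstance, hp _, ?_⟩
  have hprojt : ∀ q : ↥(p ⁻¹' {Circle.exp s * u⁻¹}) × O,
      p (t.toOpenPartialHomeomorph.symm (Circle.exp q.2 * u⁻¹, q.1)) = Circle.exp q.2 * u⁻¹ :=
    fun q => t.proj_symm_apply' q.2.2.1
  have hargO : ∀ s' : O, Complex.arg (Circle.exp s') = s' := fun s' =>
    Circle.arg_exp s'.2.2.1 s'.2.2.2.le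
  have hne : ∀ q : ↥(p ⁻¹' {Circle.exp s * u⁻¹}) × O,
      p (t.toOpenPartialHomeomorph.symm (Circle.exp q.2 * u⁻¹, q.1)) ≠ θ := by
    intro q hq
    rw [hprojt, mul_inv_eq_iff_eq_mul, mul_inv_cancel_left] at hq
    have h1 := hargO q.2
    rw [hq, Circle.arg_exp (by linarith [Real.pi_pos]) le_rfl] at h1
    exact q.2.2.2.2.ne h1.symm
  have hα : ∀ q : ↥(p ⁻¹' {Circle.exp s * u⁻¹}) × O, α ⟨_, hne q⟩ = q.2 := by
    intro q
    change Complex.arg (p _ * u : Circle) = q.2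
    rw [hprojt, inv_mul_cancel_right, hargO]
  have hsource : ∀ z : α ⁻¹' O, z.1.1 ∈ t.source := fun z => by
    rw [t.mem_source, ← hexp]
    exact z.2.1
  refine ⟨
    { toFun := fun z => ((t z.1.1).2, ⟨α z, z.2⟩)
      invFun := fun q => ⟨⟨_, hne q⟩, by
        rw [Set.mem_preimage, hα]
        exact q.2.2⟩
      left_inv := fun z => ?_
      right_inv := fun q => ?_
      continuous_toFun := ?_
      continuous_invFun := ?_ }, fun z => rfl⟩
  · refine Subtype.ext (Subtype.ext ?_)
    change t.toOpenPartialHomeomorph.symm (Circle.exp (α z) * u⁻¹, (t z.1.1).2) = z.1.1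
    rw [hexp]
    exact t.symm_apply_mk_proj (hsource z)
  · refine Prod.ext ?_ (Subtype.ext (hα q))
    change (t (t.toOpenPartialHomeomorph.symm _)).2 = q.1
    rw [t.apply_symm_apply' q.2.2.1]
  · refine Continuous.prodMk (continuous_snd.comp ?_) (by fun_prop)
    exact t.continuousOn_toFun.comp_continuous (by fun_prop) hsource
  · refine Continuous.subtype_mk (Continuous.subtype_mk ?_ _) _
    exact t.toOpenPartialHomeomorph.continuousOn_symm.comp_continuous (by fun_prop)
      fun q => t.mem_target.2 q.2.2.1

variable {M : Type u} [TopologicalSpace M]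

/-- The second homology of the complement of a page vanishes. -/
theorem OpenBook.cyclesBoundOn_compl_page [T2Space M] (ob : OpenBook M) (θ : Circle) :
    CyclesBoundOn 1 (ob.page θ)ᶜ := by
  have hf : IsEmbedding fun y : {y : ↥(ob.bindingᶜ) // ob.proj y ≠ θ} => (y.1 : M) :=
    IsEmbedding.subtypeVal.comp IsEmbedding.subtypeVal
  have : (ob.page θ)ᶜ = Set.range fun y : {y : ↥(ob.bindingᶜ) // ob.proj y ≠ θ} => (y.1 : M) := by
    ext x
    constructor
    · intro hx
      have hb : x ∈ ob.bindingᶜ := fun h => hx (Or.inr h)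
      exact ⟨⟨⟨x, hb⟩, fun h => hx (Or.inl ⟨_, h, rfl⟩)⟩, rfl⟩
    · rintro ⟨y, rfl⟩ hy
      exact y.2 (mem_page_of_notMem_binding hy y.1.2)
  rw [this, cyclesBoundOn_range hf]
  exact cyclesBound_compl_fiber ob.proj ob.locallyTrivial ob.cyclesBound_fiber θ

/-! ### Regular neighbourhoods and knots -/

namespace IsRegularNeighborhood

variable {K N : Set M}

/-- K consists of limits of points in the closed set N, so it lies in N. A frontier point is at
height 0 of the cylinder, and heights below 1 map into N ∖ K, so it is not in K. -/
theorem subset_interior (h : IsRegularNeighborhood K N) : K ⊆ interior N := by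
  obtain ⟨Φ, hΦ0, -, hΦN, hΦK⟩ := h.mappingCylinder
  have hsub : K ⊆ N := by
    rw [← hΦK]
    rintro _ ⟨⟨x, s⟩, rfl : s = 1, rfl⟩
    refine h.isClosed.closure_subset_iff.2 (hΦN.le.trans Set.sdiff_subset) ?_
    refine image_closure_subset_closure_image Φ.continuous (Set.mem_image_of_mem _ ?_)
    have h1 : (1 : unitInterval) ∈ closure (Set.Iio 1) := by
      rw [closure_Iio' ⟨0, by simp⟩]
      simp
    have h2 : Continuous fun s : unitInterval => (x, s) := by fun_prop
    exact (map_mem_closure h2 h1 fun s hs => hs :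
      (x, (1 : unitInterval)) ∈ closure {p : frontier N × unitInterval | p.2 < 1})
  intro x hx
  by_contra hxi
  have hxf : x ∈ frontier N := ⟨subset_closure (hsub hx), hxi⟩
  have h1 : x ∈ Φ '' {p | p.2 < 1} := ⟨(⟨x, hxf⟩, 0), by simp, hΦ0 _⟩
  rw [hΦN] at h1
  exact h1.2 hx

/-- Raising the cylinder coordinate s to max s t deforms N into K, so N → K → N is homotopic to the
identity. -/
theorem cyclesBoundOn [CompactSpace M] [T2Space M] (h : IsRegularNeighborhood K N) {n : ℕ}
    (hK : CyclesBoundOn n K) : CyclesBoundOn n N := by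
  have hKN : K ⊆ N := h.subset_interior.trans interior_subset
  obtain ⟨Φ, hΦ0, hΦi, hΦN, hΦK⟩ := h.mappingCylinder
  have hcomp : CompactSpace (frontier N) := isCompact_iff_compactSpace.1 isClosed_frontier.isCompact
  have hlt : ∀ p : frontier N × unitInterval, p.2 ≠ 1 → p.2 < 1 := fun p hp =>
    lt_of_le_of_ne p.2.2.2 hp
  have hmem1 : ∀ p, p.2 = 1 → Φ p ∈ K := fun p hp => hΦK.subset ⟨p, hp, rfl⟩
  have hmem2 : ∀ p, p.2 ≠ 1 → Φ p ∈ N \ K := fun p hp => hΦN.subset ⟨p, hlt p hp, rfl⟩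
  have hmem : ∀ p, Φ p ∈ N := fun p => by
    by_cases hp : p.2 = 1
    · exact hKN (hmem1 p hp)
    · exact (hmem2 p hp).1
  let q : frontier N × unitInterval → N := fun p => ⟨Φ p, hmem p⟩
  have hq : Continuous q := by fun_prop
  have hqs : Function.Surjective q := by
    intro y
    by_cases hy : (y : M) ∈ K
    · obtain ⟨p, -, hp⟩ := hΦK.symm.subset hy
      exact ⟨p, Subtype.ext hp⟩
    · obtain ⟨p, -, hp⟩ := hΦN.symm.subset ⟨y.2, hy⟩
      exact ⟨p, Subtype.ext hp⟩
  let Q : (frontier N × unitInterval) × unitInterval → N × unitInterval := Prod.map q id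
  -- A surjection from a compact space onto a Hausdorff one is a quotient map. Including the time
  -- factor here makes the descended homotopy jointly continuous.
  have hQ : IsQuotientMap Q :=
    (hq.prodMap continuous_id).isClosedMap.isQuotientMap (hq.prodMap continuous_id)
      (hqs.prodMap Function.surjective_id)
  let G : (frontier N × unitInterval) × unitInterval → N := fun z => q (z.1.1, max z.1.2 z.2)
  have hG : Continuous G := hq.comp (by fun_prop)
  -- Distinct cylinder points are identified only at height 1, and there the deformation is
  -- stationary.
  have hwd : ∀ z w, Q z = Q w → G z = G w := by
    rintro ⟨p, t⟩ ⟨p', t'⟩ hz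
    obtain rfl : t = t' := congrArg Prod.snd hz
    have hpp : Φ p = Φ p' := congrArg (fun v : N × unitInterval => (v.1 : M)) hz
    by_cases hp : p.2 = 1
    · have hp' : p'.2 = 1 := by
        by_contra hne
        exact (hmem2 p' hne).2 (hpp ▸ hmem1 p hp)
      refine Subtype.ext ?_
      change Φ (p.1, max p.2 t) = Φ (p'.1, max p'.2 t)
      have hm : max 1 t = 1 := max_eq_left t.2.2
      rw [hp, hp', hm]
      convert hpp using 2
      exacts [Prod.ext rfl hp.symm, Prod.ext rfl hp'.symm]
    · have hp' : p'.2 ≠ 1 := by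
        intro he
        exact (hmem2 p hp).2 (hpp ▸ hmem1 p' he)
      rw [hΦi (hlt p hp) (hlt p' hp') hpp]
  let D : N × unitInterval → N := Function.surjInv hQ.surjective |> fun s v => G (s v)
  have hDQ : ∀ z, D (Q z) = G z := fun z => hwd _ _ (Function.surjInv_eq hQ.surjective (Q z))
  have hD : Continuous D := hQ.continuous_iff.2 (by
    rw [show D ∘ Q = G from funext hDQ]
    exact hG)
  have hD0 : ∀ y, D (y, 0) = y := by
    intro y
    obtain ⟨p, rfl⟩ := hqs y
    refine (hDQ (p, 0)).trans ?_
    have hm : max p.2 0 = p.2 := max_eq_left p.2.2.1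
    change q (p.1, max p.2 0) = q p
    rw [hm]
  have hD1 : ∀ y, (D (y, 1) : M) ∈ K := by
    intro y
    obtain ⟨p, rfl⟩ := hqs y
    rw [show D (q p, 1) = G (p, 1) from hDQ (p, 1)]
    exact hmem1 _ (max_eq_right p.2.2.2)
  let i : C(N, K) := ⟨fun y => ⟨D (y, 1), hD1 y⟩, by fun_prop⟩
  let r : C(K, N) := ⟨Set.inclusion hKN, continuous_inclusion hKN⟩
  refine cyclesBoundOn_iff.2 ((cyclesBoundOn_iff.1 hK).of_leftInverse (i := i) (r := r)
    (ContinuousMap.Homotopic.symm ⟨?_⟩))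
  exact
    { toFun := fun p => D (p.2, p.1)
      continuous_toFun := by fun_prop
      map_zero_left := hD0
      map_one_left := fun y => rfl }

end IsRegularNeighborhood

/-- The circle is a retract of the punctured plane, by normalization. -/
theorem cyclesBound_circle (n : ℕ) : CyclesBound (n + 1) Circle := by
  let i : C(Circle, ({0}ᶜ : Set ℂ)) := ⟨fun z => ⟨z, Circle.coe_ne_zero z⟩, by fun_prop⟩
  have hr : ∀ z : ({0}ᶜ : Set ℂ), (z : ℂ) / (‖(z : ℂ)‖ : ℂ) ∈ Submonoid.unitSphere ℂ := by
    refine fun z => mem_sphere_zero_iff_norm.2 ?_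
    rw [norm_div, Complex.norm_real, norm_norm, div_self (norm_ne_zero_iff.2 z.2)]
  let r : C(({0}ᶜ : Set ℂ), Circle) :=
    { toFun := fun z => ⟨z / (‖(z : ℂ)‖ : ℂ), hr z⟩
      continuous_toFun := Continuous.subtype_mk (Continuous.div₀ (by fun_prop) (by fun_prop)
        fun z => Complex.ofReal_ne_zero.2 (norm_ne_zero_iff.2 z.2)) _ }
  refine CyclesBound.of_leftInverse (i := i) (r := r) ?_
    (cyclesBoundOn_iff.1 (cyclesBoundOn_compl_zero n))
  rw [show r.comp i = ContinuousMap.id _ from ContinuousMap.ext fun z => Circle.ext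
    (by rw [Circle.norm_coe, Complex.ofReal_one, div_one] : (z : ℂ) / (‖(z : ℂ)‖ : ℂ) = z)]

theorem cyclesBoundOn_union_regularNeighborhood [CompactSpace M] [T2Space M] {K N L : Set M}
    (h : IsRegularNeighborhood K N) {n : ℕ} (hK : CyclesBoundOn (n + 1) K)
    (hL : Nonempty (L ≃ₜ Circle)) (hd : Disjoint L N) : CyclesBoundOn (n + 1) (L ∪ N) := by
  obtain ⟨e⟩ := hL
  have hLc : IsClosed L := by
    have := e.symm.compactSpace
    exact (isCompact_iff_compactSpace.2 this).isClosed
  exact CyclesBoundOn.union_of_disjoint hd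
    (fun m => chainsOn_union_of_isClosed hLc h.isClosed hd)
    (cyclesBoundOn_iff.2 ((cyclesBound_circle n).of_homeomorph e)) (h.cyclesBoundOn hK)

end Geometry

/-! ### The long exact sequence of a pair -/

section Pairs

variable {M : Type u} [TopologicalSpace M]

theorem singHomologyMap_refl (n : ℕ) {Y : Set M} (x : singHomology n Y) :
    singHomologyMap n (subset_refl Y) x = x := by
  have : subsetIncl (subset_refl Y) = 𝟙 _ := rfl
  rw [singHomologyMap, this, CategoryTheory.Functor.map_id, HomologicalComplex.homologyMap_id]
  rfl

theorem singHomologyMap_comp (n : ℕ) {Y Y' Y'' : Set M} (h : Y ⊆ Y') (h' : Y' ⊆ Y'')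
    (x : singHomology n Y) :
    singHomologyMap n h' (singHomologyMap n h x) = singHomologyMap n (h.trans h') x := by
  have : subsetIncl h ≫ subsetIncl h' = subsetIncl (h.trans h') := rfl
  rw [singHomologyMap, singHomologyMap, singHomologyMap, ← this, Functor.map_comp,
    HomologicalComplex.homologyMap_comp]
  rfl

theorem relHomologyMap_comp (n : ℕ) {A Y A' Y' A'' Y'' : Set M} (h : A ⊆ Y) (h' : A' ⊆ Y')
    (h'' : A'' ⊆ Y'') (hY : Y ⊆ Y') (hA : A ⊆ A') (hY' : Y' ⊆ Y'') (hA' : A' ⊆ A'')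
    (x : relHomology n h) :
    relHomologyMap n h' h'' hY' hA' (relHomologyMap n h h' hY hA x) =
      relHomologyMap n h h'' (hY.trans hY') (hA.trans hA') x := by
  rw [← ConcreteCategory.comp_apply, relHomologyMap, relHomologyMap, relHomologyMap,
    ← HomologicalComplex.homologyMap_comp]
  congr 3
  rw [← cancel_epi (cokernel.π _)]
  simp only [cokernel.π_desc_assoc, cokernel.π_desc, cokernel.map, Category.assoc]
  rw [← Category.assoc, ← Functor.map_comp]
  rfl

/-- The map of short complexes induced by an inclusion of pairs. -/
def pairShortComplexMap {A Y A' Y' : Set M} (h : A ⊆ Y) (h' : A' ⊆ Y') (hY : Y ⊆ Y')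
    (hA : A ⊆ A') : pairShortComplex h ⟶ pairShortComplex h' where
  τ₁ := singChains.map (subsetIncl hA)
  τ₂ := singChains.map (subsetIncl hY)
  τ₃ := cokernel.map _ _ (singChains.map (subsetIncl hA)) (singChains.map (subsetIncl hY))
      (by rw [← Functor.map_comp, ← Functor.map_comp]; rfl)
  comm₁₂ := by
    rw [← Functor.map_comp, ← Functor.map_comp]
    rfl
  comm₂₃ := (cokernel.π_desc _ _ _).symm

theorem relBoundary_relHomologyMap (n : ℕ) {A Y A' Y' : Set M} (h : A ⊆ Y) (h' : A' ⊆ Y')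
    (hY : Y ⊆ Y') (hA : A ⊆ A') (x : relHomology (n + 1) h) :
    relBoundary n h' (relHomologyMap (n + 1) h h' hY hA x) =
      singHomologyMap n hA (relBoundary n h x) :=
  (ConcreteCategory.congr_hom (HomologicalComplex.HomologySequence.δ_naturality
    (pairShortComplexMap h h' hY hA) (pairShortComplex_shortExact h)
    (pairShortComplex_shortExact h') (n + 1) n (by simp)) x).symm

/-- The map `H_n(Y) → H_n(Y, A)`. -/
def toRelHomology (n : ℕ) {A Y : Set M} (h : A ⊆ Y) : singHomology n Y ⟶ relHomology n h :=
  HomologicalComplex.homologyMap (pairShortComplex h).g n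

theorem relHomologyMap_toRelHomology (n : ℕ) {A Y A' Y' : Set M} (h : A ⊆ Y) (h' : A' ⊆ Y')
    (hY : Y ⊆ Y') (hA : A ⊆ A') (x : singHomology n Y) :
    relHomologyMap n h h' hY hA (toRelHomology n h x) =
      toRelHomology n h' (singHomologyMap n hY x) := by
  have := congrArg (fun f => HomologicalComplex.homologyMap f n)
    (pairShortComplexMap h h' hY hA).comm₂₃
  simp only [HomologicalComplex.homologyMap_comp] at this
  exact (ConcreteCategory.congr_hom this x).symm

theorem exists_toRelHomology_eq {n : ℕ} {A Y : Set M} {h : A ⊆ Y} {x : relHomology (n + 1) h}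
    (hx : relBoundary n h x = 0) : ∃ y, toRelHomology (n + 1) h y = x :=
  (ShortComplex.moduleCat_exact_iff _).1
    ((pairShortComplex_shortExact h).homology_exact₃ (n + 1) n (by simp)) x hx

theorem exists_singHomologyMap_eq {n : ℕ} {A Y : Set M} {h : A ⊆ Y} {x : singHomology n Y}
    (hx : toRelHomology n h x = 0) : ∃ y, singHomologyMap n h y = x :=
  (ShortComplex.moduleCat_exact_iff _).1
    ((pairShortComplex_shortExact h).homology_exact₂ n) x hx

theorem relBoundary_injective {n : ℕ} {A Y : Set M} (h : A ⊆ Y)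
    (hY : Subsingleton (singHomology (n + 1) Y)) : Function.Injective (relBoundary n h) := by
  refine (injective_iff_map_eq_zero _).2 fun x hx => ?_
  obtain ⟨y, rfl⟩ := exists_toRelHomology_eq hx
  rw [Subsingleton.elim y 0, map_zero]

theorem toRelHomology_injective {n : ℕ} {A Y : Set M} (h : A ⊆ Y)
    (hA : Subsingleton (singHomology n A)) : Function.Injective (toRelHomology n h) := by
  refine (injective_iff_map_eq_zero _).2 fun x hx => ?_
  obtain ⟨y, rfl⟩ := exists_singHomologyMap_eq hx
  rw [Subsingleton.elim y 0, map_zero]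

/-- The difference has zero boundary, so it lifts to an absolute class of Y. That class dies
relative to A', and H_{n+1}(A') = 0 makes H_{n+1}(Y) → H_{n+1}(Y, A') injective. -/
theorem eq_of_relBoundary_eq {n : ℕ} {A Y A' : Set M} (h : A ⊆ Y) (h' : A' ⊆ Y) (hA : A ⊆ A')
    (hA' : Subsingleton (singHomology (n + 1) A')) {x y : relHomology (n + 1) h}
    (hb : relBoundary n h x = relBoundary n h y)
    (hr : relHomologyMap (n + 1) h h' subset_rfl hA x =
      relHomologyMap (n + 1) h h' subset_rfl hA y) : x = y := by
  rw [← sub_eq_zero] at hb hr ⊢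
  rw [← map_sub] at hb hr
  obtain ⟨z, hz⟩ := exists_toRelHomology_eq hb
  rw [← hz, relHomologyMap_toRelHomology, singHomologyMap_refl] at hr
  rw [← hz, toRelHomology_injective h' hA' (hr.trans (map_zero _).symm), map_zero]

end Pairs

/-! ### Seifert surfaces -/

section Seifert

variable {M : Type u} [TopologicalSpace M] {L : Set M} {o : singHomology 1 L}

namespace SeifertSurface

theorem relBoundary_homologyClass (S : SeifertSurface L o) :
    relBoundary 1 (Set.subset_univ L) S.homologyClass = o := by
  rw [homologyClass, relBoundary_relHomologyMap, S.boundary_eq, singHomologyMap_refl]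

/-- Relative to `L ∪ N`, the class of a Seifert surface comes from a class in the complement of `K`
with prescribed boundary. -/
theorem MeetsIn.exists_outer_class {S : SeifertSurface L o} {N : Set M} {hN : IsClosed N}
    {hL : Disjoint L N} {X : Set M} {ξ : singHomology 1 X} (h : S.MeetsIn hN hL X ξ) {K : Set M}
    (hK : K ⊆ interior N) (hLX : L ∪ X ⊆ Kᶜ) (hXN : L ∪ X ⊆ L ∪ N) :
    ∃ ν : relHomology 2 hLX,
      relBoundary 1 hLX ν =
        singHomologyMap 1 Set.subset_union_left o + singHomologyMap 1 Set.subset_union_right ξ ∧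
      relHomologyMap 2 hLX (Set.subset_univ (L ∪ N)) (Set.subset_univ _) hXN ν =
        relHomologyMap 2 (Set.subset_univ L) (Set.subset_univ (L ∪ N)) subset_rfl
          Set.subset_union_left S.homologyClass := by
  obtain ⟨-, hX, μ, hμ, hb⟩ := h
  have hY : S.outer N ⊆ Kᶜ := fun x hx hxK => hx.2 (hK hxK)
  refine ⟨relHomologyMap 2 (S.boundary_union_slice_subset hL) hLX hY
    (Set.union_subset_union_right L hX.symm.subset) μ, ?_, ?_⟩
  · rw [relBoundary_relHomologyMap, hb, map_add, singHomologyMap_comp, singHomologyMap_comp]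
  -- Both classes reach the pair (M, L ∪ N) through the surface relative to L and its inner part,
  -- where the fundamental class of the outer piece and that of S agree by the choice of μ.
  · have h1 := congrArg (relHomologyMap 2 (S.boundary_union_inner_subset N)
      (Set.subset_univ (L ∪ N)) (Set.subset_univ _)
      (Set.union_subset_union_right L Set.inter_subset_right)) hμ
    refine (relHomologyMap_comp _ _ _ _ _ _ _ _ _).trans
      (Eq.trans ?_ (relHomologyMap_comp _ _ _ _ _ _ _ _ _).symm)
    exact (relHomologyMap_comp _ _ _ _ _ _ _ _ _).symm.trans
      (h1.trans (relHomologyMap_comp _ _ _ _ _ _ _ _ _))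

end SeifertSurface

end Seifert

end

theorem lemma1p2 {M : Type u} [TopologicalSpace M] [T2Space M] [CompactSpace M]
    [ChartedSpace E3 M]
    (ob : OpenBook M) (θ : Circle)
    (N : Set M) (hN : IsRegularNeighborhood (ob.page θ) N)
    (L : Set M) (o : singHomology 1 L) (_hK : IsOrientedKnot L o)
    (hL : Disjoint L N)
    (X : Set M) (ξ : singHomology 1 X)
    (S S' : SeifertSurface L o)
    (_hS : S.MeetsIn hN.isClosed hL X ξ) (_hS' : S'.MeetsIn hN.isClosed hL X ξ) :
    S.homologyClass = S'.homologyClass := by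
  have hXS : L ∪ X ⊆ S.outer N :=
    (Set.union_subset_union_right L _hS.slice_eq.subset).trans (S.boundary_union_slice_subset hL)
  have hLX : L ∪ X ⊆ (ob.page θ)ᶜ := fun x hx hxK => (hXS hx).2 (hN.subset_interior hxK)
  have hXN : L ∪ X ⊆ L ∪ N := Set.union_subset_union_right L
    (_hS.slice_eq.subset.trans ((S.slice_subset_inner hN.isClosed).trans Set.inter_subset_right))
  obtain ⟨ν, hν, hνS⟩ := _hS.exists_outer_class hN.subset_interior hLX hXN
  obtain ⟨ν', hν', hνS'⟩ := _hS'.exists_outer_class hN.subset_interior hLX hXN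
  -- Both boundaries are the sum of the classes of L and X; this is where the orientation of X
  -- enters.
  have hνν : ν = ν' := relBoundary_injective hLX
    (subsingleton_singHomology (ob.cyclesBoundOn_compl_page θ)) (hν.trans hν'.symm)
  -- What remains is the ambiguity by classes of H_2(M), excluded by comparing relative to L ∪ N,
  -- where only the outer pieces count.
  refine eq_of_relBoundary_eq (Set.subset_univ L) (Set.subset_univ (L ∪ N)) Set.subset_union_left
    (subsingleton_singHomology (cyclesBoundOn_union_regularNeighborhood hN
      (ob.cyclesBoundOn_page θ) _hK.circle hL))
    (S.relBoundary_homologyClass.trans S'.relBoundary_homologyClass.symm) ?_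
  rw [← hνS, ← hνS', hνν]
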